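/- Let $p$ be an odd prime, let $\mathcal O$ be a complete discrete valuation ring of characteristic $p$ with fraction field $K$, and let $E/K$ be an elliptic curve with ordinary reduction, that is, the formal group of the reduction of a minimal Weierstrass equation has height $1$. Fix a minimal Weierstrass equation $y^2+a_1xy+a_3y=x^3+a_2x^2+a_4x+a_6$ of $E$ and put $\omega=dx/(2y+a_1x+a_3)$. Let $z$ be a uniformizing parameter on the formal completion $\widehat E/\mathcal O$ of $E$ along the zero section $O$ (so $-x/y=c_1z+c_2z^2+\cdots$ with $c_i\in\mathcal O$, $c_1\in\mathcal O^\times$), put $\beta=(\omega/dz)(O)$, and for $m\ge 1$ let $[m](z)$ be the power series of multiplication by $m$ on $\widehat E$. Let $\alpha\in\mathcal O^\times$ be the Hasse invariant of $(E,\omega)$, so $[p](z)=\alpha\beta^{p-1}z^p+\cdots$, and put $\alpha_n=\alpha\cdot\alpha^{p}\cdots\alpha^{p^{n-1}}$. Let $f_p\in K(E)\subset K((z))$ be the $p$-th division polynomial with respect to $\omega$: the function with divisor $[p]^{-1}(O)-p^2(O)$ normalized by $\bigl(z^{p^2}f_p(z)/[p](z)\bigr)(O)=\beta^{1-p^2}$.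 Let $\sigma_{E,\omega}$ be the Mazur–Tate sigma function, i.e. the unique series $\sigma\in\beta z(1+z\mathcal O[[z]])$ such that $\sigma([p](z))=\sigma(z)^{p^2}f_p(z)$. For every $n\ge 1$ there is a unique power series $[p^n]^{-1}(z)$ without constant term in $z^{1/p^n}$, with coefficients in the perfect closure of $K$, such that $[p^n]\bigl([p^n]^{-1}(z)\bigr)=z$, and each factor in brackets below lies in $\mathcal O[[z]]$. The product $$\sigma(z)=\beta z\prod_{n\ge 1}\left[\frac{\beta^{p-1}}{\alpha^{p^{n-1}}\alpha_n^{p-1}}\,z^{p-1}\,f_p\bigl([p^n]^{-1}(z)\bigr)^{p^{n-1}}\right]^{p^{n-1}}$$ converges $z$-adically in $\mathcal O[[z]]$, the series $\sigma_{E,\omega}$ exists, and $\sigma(z)=\sigma_{E,\omega}(z)$. -/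

import Mathlib

open scoped PowerSeries LaurentSeries

namespace MazurTate

noncomputable section

open WeierstrassCurve

/-! ### Expansions of functions on a Weierstrass curve at the origin -/

/-- A uniformizing parameter `z` on the formal completion along the zero section, given by the
expansion `t = c₁ z + c₂ z² + ⋯` (with `c₁` a unit) of the standard parameter `t = -x / y`. -/
structure FormalParameter (R : Type*) [CommRing R] where
  /-- The expansion of `t = -x / y` as a power series in `z`. -/
  series : R⟦X⟧
  constantCoeff_series : series.constantCoeff = 0
  isUnit_coeff_one : IsUnit (series.coeff 1)

/-- The standard parameter `z = -x / y`. -/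
def FormalParameter.standard (R : Type*) [CommRing R] : FormalParameter R where
  series := PowerSeries.X
  constantCoeff_series := by simp
  isUnit_coeff_one := by simp

/-- Base change of a parameter along a ring homomorphism. -/
def FormalParameter.map {R S : Type*} [CommRing R] [CommRing S] (φ : R →+* S)
    (T : FormalParameter R) : FormalParameter S where
  series := T.series.map φ
  constantCoeff_series := by
    rw [← PowerSeries.coeff_zero_eq_constantCoeff_apply, PowerSeries.coeff_map,
      PowerSeries.coeff_zero_eq_constantCoeff_apply, T.constantCoeff_series, map_zero]
  isUnit_coeff_one := by
    rw [PowerSeries.coeff_map]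
    exact T.isUnit_coeff_one.map φ

section Expansion

variable {K : Type*} [Field K] (W : WeierstrassCurve K)

/-- The right-hand side of the Weierstrass equation in the coordinates `t = -x / y`,
`w = -1 / y` at the origin: `w = t³ + a₁tw + a₂t²w + a₃w² + a₄tw² + a₆w³`. -/
def wStep (u : K⟦X⟧) : K⟦X⟧ :=
  PowerSeries.X ^ 3 +
    (PowerSeries.C W.a₁ * PowerSeries.X + PowerSeries.C W.a₂ * PowerSeries.X ^ 2) * u +
    (PowerSeries.C W.a₃ + PowerSeries.C W.a₄ * PowerSeries.X) * u ^ 2 + PowerSeries.C W.a₆ * u ^ 3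

/-- The expansion `w(t) = t³ + ⋯` of `w = -1 / y` in `t = -x / y`, as the limit of the iterates of
`wStep` (the coefficient of degree `n` no longer changes after `n` steps). -/
def wSeries : K⟦X⟧ :=
  PowerSeries.mk fun n => ((wStep W)^[n] 0).coeff n

lemma X_dvd_wStep {u : K⟦X⟧} (hu : PowerSeries.X ∣ u) : PowerSeries.X ∣ wStep W u := by
  obtain ⟨v, rfl⟩ := hu
  refine ⟨PowerSeries.X ^ 2 +
    (PowerSeries.C W.a₁ * PowerSeries.X + PowerSeries.C W.a₂ * PowerSeries.X ^ 2) * v +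
    (PowerSeries.C W.a₃ + PowerSeries.C W.a₄ * PowerSeries.X) * PowerSeries.X * v ^ 2 +
    PowerSeries.C W.a₆ * PowerSeries.X ^ 2 * v ^ 3, ?_⟩
  rw [wStep]; ring

lemma wStep_sub_dvd {u v : K⟦X⟧} (hu : PowerSeries.X ∣ u) (hv : PowerSeries.X ∣ v) {n : ℕ}
    (h : PowerSeries.X ^ n ∣ u - v) : PowerSeries.X ^ (n + 1) ∣ wStep W u - wStep W v := by
  obtain ⟨u, rfl⟩ := hu
  obtain ⟨v, rfl⟩ := hv
  obtain ⟨d, hd⟩ := h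
  refine ⟨d * (PowerSeries.C W.a₁ + PowerSeries.C W.a₂ * PowerSeries.X +
    (PowerSeries.C W.a₃ + PowerSeries.C W.a₄ * PowerSeries.X) * (u + v) +
    PowerSeries.C W.a₆ * PowerSeries.X * (u ^ 2 + u * v + v ^ 2)), ?_⟩
  rw [wStep, wStep]
  linear_combination (PowerSeries.C W.a₁ * PowerSeries.X + PowerSeries.C W.a₂ * PowerSeries.X ^ 2 +
    (PowerSeries.C W.a₃ + PowerSeries.C W.a₄ * PowerSeries.X) * PowerSeries.X * (u + v) +
    PowerSeries.C W.a₆ * PowerSeries.X ^ 2 * (u ^ 2 + u * v + v ^ 2)) * hd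

lemma X_dvd_iterate (n : ℕ) : PowerSeries.X ∣ (wStep W)^[n] 0 := by
  induction n with
  | zero => simp
  | succ n ih => rw [Function.iterate_succ_apply']; exact X_dvd_wStep W ih

lemma X_pow_dvd_iterate_succ_sub (n : ℕ) :
    PowerSeries.X ^ (n + 1) ∣ (wStep W)^[n + 1] 0 - (wStep W)^[n] 0 := by
  induction n with
  | zero => simpa using X_dvd_iterate W 1
  | succ n ih =>
    rw [Function.iterate_succ_apply', Function.iterate_succ_apply' _ n]
    rw [Function.iterate_succ_apply'] at ih
    exact wStep_sub_dvd W (X_dvd_wStep W (X_dvd_iterate W n)) (X_dvd_iterate W n) ih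

lemma X_pow_dvd_wSeries_sub (n : ℕ) : PowerSeries.X ^ (n + 1) ∣ wSeries W - (wStep W)^[n] 0 := by
  have key : ∀ k m, m ≤ k → ((wStep W)^[k] 0).coeff m = ((wStep W)^[m] 0).coeff m := by
    intro k m hmk
    induction k, hmk using Nat.le_induction with
    | base => rfl
    | succ k hk ih =>
      rw [← ih, ← sub_eq_zero, ← map_sub]
      exact PowerSeries.X_pow_dvd_iff.mp (X_pow_dvd_iterate_succ_sub W k) m (by omega)
  rw [PowerSeries.X_pow_dvd_iff]
  intro m hm
  rw [map_sub, wSeries, PowerSeries.coeff_mk, key n m (by omega), sub_self]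

lemma X_dvd_wSeries : PowerSeries.X ∣ wSeries W := by
  simpa using X_pow_dvd_wSeries_sub W 0

/-- `w(t)` solves the Weierstrass equation at the origin. -/
lemma wStep_wSeries : wStep W (wSeries W) = wSeries W := by
  ext m
  rw [← sub_eq_zero, ← map_sub]
  have h1 := wStep_sub_dvd W (X_dvd_wSeries W) (X_dvd_iterate W m) (X_pow_dvd_wSeries_sub W m)
  rw [← Function.iterate_succ_apply' (wStep W)] at h1
  have h3 := dvd_sub h1 (X_pow_dvd_wSeries_sub W (m + 1))
  rw [sub_sub_sub_cancel_right] at h3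
  exact PowerSeries.X_pow_dvd_iff.mp h3 m (by omega)

/-- The factor `w(t) / t³` is a unit. -/
lemma exists_wSeries_mul : ∃ v : K⟦X⟧, wSeries W * v = PowerSeries.X ^ 3 ∧ v.constantCoeff = 1 := by
  refine ⟨1 - (PowerSeries.C W.a₁ * PowerSeries.X + PowerSeries.C W.a₂ * PowerSeries.X ^ 2) -
    (PowerSeries.C W.a₃ + PowerSeries.C W.a₄ * PowerSeries.X) * wSeries W -
    PowerSeries.C W.a₆ * wSeries W ^ 2, ?_, ?_⟩
  · have h := wStep_wSeries W
    rw [wStep] at h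
    linear_combination -h
  · have h : (wSeries W).constantCoeff = 0 := PowerSeries.X_dvd_iff.mp (X_dvd_wSeries W)
    simp [h]

variable (T : FormalParameter K)

lemma FormalParameter.hasSubst : PowerSeries.HasSubst T.series :=
  PowerSeries.HasSubst.of_constantCoeff_zero' T.constantCoeff_series

lemma FormalParameter.series_ne_zero : T.series ≠ 0 := by
  intro h
  have := T.isUnit_coeff_one.ne_zero
  simp [h] at this

/-- The expansion of `w = -1 / y` in the parameter `z`. -/
def wExp : K⟦X⟧ := (wSeries W).subst T.series

/-- The expansion of the function `x` in the parameter `z`, that is `t / w`. -/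
def xExp : K⸨X⸩ := (T.series : K⸨X⸩) / (wExp W T : K⸨X⸩)

/-- The expansion of the function `y` in the parameter `z`, that is `-1 / w`. -/
def yExp : K⸨X⸩ := -1 / (wExp W T : K⸨X⸩)

lemma exists_wExp_mul : ∃ v : K⟦X⟧, wExp W T * v = T.series ^ 3 := by
  obtain ⟨v, hv, -⟩ := exists_wSeries_mul W
  refine ⟨v.subst T.series, ?_⟩
  rw [wExp, ← PowerSeries.subst_mul T.hasSubst, hv, PowerSeries.subst_pow T.hasSubst,
    PowerSeries.subst_X T.hasSubst]

lemma wExp_ne_zero : wExp W T ≠ 0 := by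
  obtain ⟨v, hv⟩ := exists_wExp_mul W T
  intro h
  rw [h, zero_mul] at hv
  exact T.series_ne_zero (pow_eq_zero_iff (by norm_num) |>.mp hv.symm)

lemma T_cube_dvd_wExp : T.series ^ 3 ∣ wExp W T := by
  obtain ⟨v, hv, hv1⟩ := exists_wSeries_mul W
  obtain ⟨v', hv'⟩ : IsUnit v := by
    rw [PowerSeries.isUnit_iff_constantCoeff, hv1]; exact isUnit_one
  have h : wSeries W = PowerSeries.X ^ 3 * (↑v'⁻¹ : K⟦X⟧) := by
    rw [← hv, ← hv', mul_assoc, Units.mul_inv, mul_one]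
  refine ⟨(↑v'⁻¹ : K⟦X⟧).subst T.series, ?_⟩
  rw [wExp, h, PowerSeries.subst_mul T.hasSubst, PowerSeries.subst_pow T.hasSubst,
    PowerSeries.subst_X T.hasSubst]

lemma wExp_eq : wExp W T = T.series ^ 3 +
    (PowerSeries.C W.a₁ * T.series + PowerSeries.C W.a₂ * T.series ^ 2) * wExp W T +
    (PowerSeries.C W.a₃ + PowerSeries.C W.a₄ * T.series) * wExp W T ^ 2 +
    PowerSeries.C W.a₆ * wExp W T ^ 3 := by
  have h := congrArg (PowerSeries.subst T.series) (wStep_wSeries W)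
  have hC : ∀ a : K, PowerSeries.subst T.series (PowerSeries.C a : K⟦X⟧) = PowerSeries.C a := by
    intro a
    exact PowerSeries.subst_C a
  rw [wStep] at h
  simp only [PowerSeries.subst_add T.hasSubst, PowerSeries.subst_mul T.hasSubst,
    PowerSeries.subst_pow T.hasSubst, PowerSeries.subst_X T.hasSubst, hC] at h
  exact h.symm

/-- The expansions of `x` and `y` satisfy the Weierstrass equation. -/
lemma equation_exp : yExp W T ^ 2 + HahnSeries.C W.a₁ * xExp W T * yExp W T +
    HahnSeries.C W.a₃ * yExp W T = xExp W T ^ 3 + HahnSeries.C W.a₂ * xExp W T ^ 2 +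
    HahnSeries.C W.a₄ * xExp W T + HahnSeries.C W.a₆ := by
  have hw : (wExp W T : K⸨X⸩) ≠ 0 := fun h => wExp_ne_zero W T
    ((map_eq_zero_iff _ HahnSeries.ofPowerSeries_injective).mp h)
  have h := congrArg (HahnSeries.ofPowerSeries ℤ K) (wExp_eq W T)
  simp only [map_add, map_mul, map_pow, HahnSeries.ofPowerSeries_C] at h
  rw [xExp, yExp]
  field_simp
  linear_combination h

/-- Expansion at the origin on the affine coordinate ring. -/
def expandRing : W.toAffine.CoordinateRing →+* K⸨X⸩ :=
  AdjoinRoot.lift (Polynomial.eval₂RingHom (HahnSeries.C) (xExp W T)) (yExp W T) <| by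
    have h := equation_exp W T
    simp only [Affine.polynomial, Polynomial.eval₂_add, Polynomial.eval₂_sub, Polynomial.eval₂_mul,
      Polynomial.eval₂_pow, Polynomial.eval₂_X, Polynomial.eval₂_C,
      Polynomial.coe_eval₂RingHom]
    linear_combination h

/-- The function `x` is transcendental at the origin: no nonzero polynomial in `x` expands to `0`. -/
lemma eval_xExp_ne_zero {q : Polynomial K} (hq : q.eval₂ HahnSeries.C (xExp W T) = 0) : q = 0 := by
  by_contra hq0
  have hw : (wExp W T : K⸨X⸩) ≠ 0 := fun h => wExp_ne_zero W T
    ((map_eq_zero_iff _ HahnSeries.ofPowerSeries_injective).mp h)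
  have hint : IsIntegral K⟦X⟧ (xExp W T) := by
    refine ⟨(Polynomial.C q.leadingCoeff⁻¹ * q).map PowerSeries.C, ?_, ?_⟩
    · refine Polynomial.Monic.map _ ?_
      rw [mul_comm]
      exact Polynomial.monic_mul_leadingCoeff_inv hq0
    · rw [Polynomial.eval₂_map]
      have : (algebraMap K⟦X⟧ K⸨X⸩).comp PowerSeries.C = HahnSeries.C := by
        ext1 a
        exact HahnSeries.ofPowerSeries_C a
      rw [this, Polynomial.eval₂_mul, hq, mul_zero]
  obtain ⟨r, hr⟩ := IsIntegrallyClosed.isIntegral_iff.mp hint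
  have hr' : (r : K⸨X⸩) = xExp W T := hr
  rw [xExp, eq_div_iff hw, ← map_mul] at hr'
  have hr2 := HahnSeries.ofPowerSeries_injective hr'
  obtain ⟨c, hc⟩ := T_cube_dvd_wExp W T
  have h1 : T.series * (r * T.series ^ 2 * c) = T.series * 1 := by
    rw [mul_one]; nth_rewrite 3 [← hr2]; rw [hc]; ring
  have h2 := congrArg PowerSeries.constantCoeff (mul_left_cancel₀ T.series_ne_zero h1)
  simp [T.constantCoeff_series] at h2

lemma expandRing_injective : Function.Injective (expandRing W T) := by
  rw [injective_iff_map_eq_zero]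
  intro r hr
  obtain ⟨a, b, rfl⟩ := Affine.CoordinateRing.exists_smul_basis_eq r
  have hmul : expandRing W T (Affine.CoordinateRing.mk W.toAffine
      (Polynomial.C (Algebra.norm (Polynomial K) (a • (1 : W.toAffine.CoordinateRing) +
        b • Affine.CoordinateRing.mk W.toAffine Polynomial.X)))) = 0 := by
    have h := Affine.CoordinateRing.coe_norm_smul_basis (W' := W.toAffine) a b
    rw [map_mul] at h
    refine (congrArg (expandRing W T) h).trans ?_
    rw [map_mul]
    refine mul_eq_zero_of_left ?_ _
    rw [← hr, map_add, map_mul, Affine.CoordinateRing.smul, Affine.CoordinateRing.smul, mul_one]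
  have hn : Algebra.norm (Polynomial K) (a • (1 : W.toAffine.CoordinateRing) +
      b • Affine.CoordinateRing.mk W.toAffine Polynomial.X) = 0 := by
    apply eval_xExp_ne_zero W T
    rw [← hmul, expandRing, Affine.CoordinateRing.mk, AdjoinRoot.lift_mk, Polynomial.eval₂_C]
    rfl
  have hd := Affine.CoordinateRing.degree_norm_smul_basis (W' := W.toAffine) a b
  rw [hn, Polynomial.degree_zero, eq_comm, max_eq_bot] at hd
  have ha : a = 0 := by
    by_contra h
    have h1 := hd.1
    rw [Polynomial.degree_eq_natDegree h] at h1
    exact absurd h1 (by rw [two_nsmul]; exact WithBot.coe_ne_bot)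
  have hb : b = 0 := by
    by_contra h
    have h1 := hd.2
    rw [Polynomial.degree_eq_natDegree h] at h1
    exact absurd h1 (by rw [two_nsmul]; exact WithBot.coe_ne_bot)
  rw [ha, hb, zero_smul, zero_smul, add_zero]

/-- Expansion at the origin, the embedding of the function field `K(E)` into the field of Laurent
series in the parameter `z`. -/
def expand : W.toAffine.FunctionField →+* K⸨X⸩ :=
  IsFractionRing.lift (expandRing_injective W T)

/-- The number `β = (ω / dz)(O)`, where `ω = dx / (2y + a₁x + a₃)`. -/
def beta : K :=
  (LaurentSeries.derivative K (xExp W T) /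
    (2 * yExp W T + HahnSeries.C W.a₁ * xExp W T + HahnSeries.C W.a₃)).coeff 0

end Expansion

/-! ### Multiplication by `m` -/

section Multiplication

variable {K : Type*} [Field K] (W : WeierstrassCurve K)

/-- The function `x` in the function field `K(E)`. -/
def xFun : W.toAffine.FunctionField :=
  algebraMap W.toAffine.CoordinateRing _
    (Affine.CoordinateRing.mk W.toAffine (Polynomial.C Polynomial.X))

/-- The function `y` in the function field `K(E)`. -/
def yFun : W.toAffine.FunctionField :=
  algebraMap W.toAffine.CoordinateRing _ (Affine.CoordinateRing.mk W.toAffine Polynomial.X)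

/-- The curve over its function field. -/
abbrev overFunctionField : WeierstrassCurve W.toAffine.FunctionField :=
  W.map (algebraMap K W.toAffine.FunctionField)

lemma equation_generic : (overFunctionField W).toAffine.Equation (xFun W) (yFun W) := by
  have h : algebraMap W.toAffine.CoordinateRing W.toAffine.FunctionField
      (Affine.CoordinateRing.mk W.toAffine W.toAffine.polynomial) = 0 := by
    rw [AdjoinRoot.mk_self, map_zero]
  have hC : ∀ a : K, algebraMap W.toAffine.CoordinateRing W.toAffine.FunctionField
      (Affine.CoordinateRing.mk W.toAffine (Polynomial.C (Polynomial.C a))) =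
        algebraMap K W.toAffine.FunctionField a := by
    intro a
    rw [IsScalarTower.algebraMap_apply K W.toAffine.CoordinateRing W.toAffine.FunctionField]
    rfl
  rw [Affine.equation_iff, xFun, yFun]
  simp only [Affine.polynomial, map_add, map_sub, map_mul, map_pow, hC] at h
  simp only [WeierstrassCurve.map]
  linear_combination h

variable [W.IsElliptic]

/-- The generic point `(x, y)` of `E`, a point of `E` over the function field `K(E)`. -/
def genericPoint : (overFunctionField W).toAffine.Point :=
  .some (xFun W) (yFun W) (Affine.equation_iff_nonsingular.mp (equation_generic W))

open scoped Classical in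
/-- The image `m • (x, y)` of the generic point under multiplication by `m`. -/
def mulGeneric (m : ℕ) : (overFunctionField W).toAffine.Point := m • genericPoint W

/-- The function `x ∘ [m]` in `K(E)` (zero by convention if `[m] = 0`). -/
def mulX (m : ℕ) : W.toAffine.FunctionField :=
  match mulGeneric W m with
  | .zero => 0
  | .some x _ _ => x

/-- The function `y ∘ [m]` in `K(E)` (zero by convention if `[m] = 0`). -/
def mulY (m : ℕ) : W.toAffine.FunctionField :=
  match mulGeneric W m with
  | .zero => 0
  | .some _ y _ => y

variable (T : FormalParameter K)

/-- The expansion in `z` of the function `t ∘ [m]`, where `t = -x / y` (a power series, since `[m]`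
fixes the origin). -/
def mulT (m : ℕ) : K⟦X⟧ :=
  PowerSeries.mk fun n => (expand W T (-mulX W m / mulY W m)).coeff n

/-- The power series `[m](z)` giving multiplication by `m` on the formal group in the
parameter `z`: since `t = T(z)`, it is `T⁻¹(t ∘ [m])`. -/
def mulSeries (m : ℕ) : K⟦X⟧ :=
  (T.series.substInvOfIsUnit T.isUnit_coeff_one).subst (mulT W T m)

/-- The Hasse invariant `α` of `(E, ω)`: the derivative at the origin of the Verschiebung `V`,
where `[p] = V ∘ Frobenius`. In the parameter `t = -x / y`, for which `ω = (1 + ⋯) dt`, it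
is the coefficient of `t ^ p` in `[p](t)`. -/
def hasseInvariant (p : ℕ) : K :=
  (mulSeries W (FormalParameter.standard K) p).coeff p

/-- `α_n = α · α ^ p ⋯ α ^ (p ^ (n - 1))`. -/
def hasseProd (p n : ℕ) : K :=
  ∏ i ∈ Finset.range n, hasseInvariant W p ^ p ^ i

/-- `f ∈ K(E)` is the `m`-th division polynomial with respect to `ω = dx / (2y + a₁x + a₃)`.

* Its divisor is `[m]⁻¹(O) - m²(O)`. The places of `K(E) / K` are the nontrivial valuation rings
  that contain `K`. As `x` has polar divisor `2(O)`, the function `x ∘ [m]` has polar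
  divisor `2[m]⁻¹(O)`, so that the order of `f` at a place satisfies
  `2 ord f = max (0, -ord (x ∘ [m])) - m² max (0, -ord x)`; this is written multiplicatively.
* It is normalized by `(z ^ m² f(z) / [m](z))(O) = β ^ (1 - m²)`. -/
structure IsDivisionPolynomial (m : ℕ) (f : W.toAffine.FunctionField) : Prop where
  divisor : ∀ A : ValuationSubring W.toAffine.FunctionField,
    (∀ c : K, algebraMap K W.toAffine.FunctionField c ∈ A) →
    A.valuation f ^ 2 * max 1 (A.valuation (mulX W m)) = max 1 (A.valuation (xFun W)) ^ m ^ 2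
  normalized :
    ((HahnSeries.single 1 1 : K⸨X⸩) ^ m ^ 2 * expand W T f / (mulSeries W T m : K⸨X⸩)).coeff 0 =
      beta W T ^ (1 - (m : ℤ) ^ 2)

end Multiplication

/-! ### Inverting `[p ^ n]` -/

section Inverse

variable {K : Type*} [Field K] (W : WeierstrassCurve K) [W.IsElliptic] (T : FormalParameter K)
  (p : ℕ) [Fact p.Prime] [CharP K p]

/-- Substitution of a power series without constant term into a Laurent series. -/
def laurentSubst {F : Type*} [Field F] (g : F⸨X⸩) (ζ : F⟦X⟧) : F⸨X⸩ :=
  (ζ : F⸨X⸩) ^ g.order * (g.powerSeriesPart.subst ζ : F⟦X⟧)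

/-- `ζ` is the compositional inverse `[p ^ n]⁻¹(z)`, which is a series without constant term in
`u = z ^ (1 / p ^ n)`, with coefficients in the perfect closure of `K`: that
is `[p ^ n](ζ(u)) = u ^ (p ^ n) = z`. -/
def IsMulPowInverse (n : ℕ) (ζ : (PerfectClosure K p)⟦X⟧) : Prop :=
  ζ.constantCoeff = 0 ∧
    ((mulSeries W T (p ^ n)).map (PerfectClosure.of K p)).subst ζ = PowerSeries.X ^ p ^ n

/-- For `n ≥ 1`, the `n`-th factor of the product without its outer exponent,
`β ^ (p - 1) / (α ^ (p ^ (n - 1)) α_n ^ (p - 1)) · z ^ (p - 1) · f(ζ) ^ (p ^ (n - 1))`,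
as a Laurent series in the variable `u = z ^ (1 / p ^ n)`. -/
def factor (f : W.toAffine.FunctionField) (n : ℕ) (ζ : (PerfectClosure K p)⟦X⟧) :
    (PerfectClosure K p)⸨X⸩ :=
  HahnSeries.C (PerfectClosure.of K p (beta W T ^ (p - 1) /
      (hasseInvariant W p ^ p ^ (n - 1) * hasseProd W p n ^ (p - 1)))) *
    (HahnSeries.single 1 1 ^ p ^ n) ^ (p - 1) *
    laurentSubst ((expand W T f).map (PerfectClosure.of K p)) ζ ^ p ^ (n - 1)

end Inverse

/-! ### The sigma function -/

section Sigma

variable (O : Type*) [CommRing O] {K : Type*} [Field K] [Algebra O K]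
  (W : WeierstrassCurve K) [W.IsElliptic]

/-- For a minimal equation, ordinary reduction means that the reduction of the formal group has
height one, so that the Hasse invariant is a unit of `O`. -/
def IsOrdinary (p : ℕ) : Prop :=
  ∃ a : Oˣ, algebraMap O K a = hasseInvariant W p

/-- `σ` lies in `βz(1 + zO[[z]])` and satisfies `σ(pQ) = σ(Q) ^ p² f(Q)`, as an identity of
functions on the formal group. -/
structure IsSigmaSolution (T : FormalParameter O) (p : ℕ) (f : W.toAffine.FunctionField)
    (σ : O⟦X⟧) : Prop where
  mem : ∃ g : O⟦X⟧, σ.map (algebraMap O K) =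
    PowerSeries.C (beta W (T.map (algebraMap O K))) * PowerSeries.X *
      (1 + PowerSeries.X * g.map (algebraMap O K))
  mul_p : (((σ.map (algebraMap O K)).subst
      (mulSeries W (T.map (algebraMap O K)) p) : K⟦X⟧) : K⸨X⸩) =
    (σ.map (algebraMap O K) : K⸨X⸩) ^ p ^ 2 * expand W (T.map (algebraMap O K)) f

/-- `σ` is the Mazur-Tate sigma function of `(E, ω)`, the unique series in `βz(1 + zO[[z]])` with
`σ(pQ) = σ(Q) ^ p² f(Q)`, where `f` is the `p`-th division polynomial. -/
def IsMazurTateSigma (T : FormalParameter O) (p : ℕ) (f : W.toAffine.FunctionField)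
    (σ : O⟦X⟧) : Prop :=
  IsSigmaSolution O W T p f σ ∧ ∀ τ : O⟦X⟧, IsSigmaSolution O W T p f τ → τ = σ

end Sigma

end

end MazurTate

/-! The argument takes place on the formal group over O, in characteristic p. The pullback of the
invariant differential is additive in points (`HasLogDeriv.add`), so [p] pulls it back to p·ω = 0.
Hence [p](z) has derivative zero and [p](z) = m(z^p) with m integral and m'(0) = c = αβ^(p-1)
(`exists_mulSeries_eq`). Integrality holds because points whose coordinates t = -x/y and w = -1/y
lie in zO[[z]] are closed under addition (`isNear_add`). Ordinary reduction makes c a unit, so m has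
a compositional inverse s over O. Composing p-power roots of s gives the unique inverses of [p^n]
over the perfect closure.

The second ingredient is the expansion f = cβ^(1-p²) z^(p-p²) k(z^p) with k integral and k(0) = 1
(`IsDivisionPolynomial.exists_expand_eq`). The divisor of f is symmetric and its order at O is even,
so f is an even function; its only pole is at O, so f = P(x). With X = x∘[p] one has P² X = Q(x)
with P² and Q coprime (`exists_polyFun_of_divisor`). Since dX = 0, differentiating shows P ∣ 2P', so
P' = 0 and f has derivative zero. A Bezout relation shows that 1/f as well as f has bounded
denominators, and Gauss's lemma (`exists_hasUnitExpansion`) makes f a constant times a power of z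
times a unit of O[[z]]. The normalization fixes the constant.

Write σ = βzS, M = [p](z) = c z^p e with e(0) = 1, and κ = k(z^p). The defining equation of σ
becomes e·S(M) = κ·S^(p²) (`mul_p_iff`). Put h = (z/(cs))^(p-1). The bracketed factors are b₁ =
h·k(s) and b_(n+1) = h·b_n^Frob(s), where Frob raises coefficients to the p-th power (`factor_eq`).
As s(M) = z^p and h(M) = e^(p-1), it follows that b₁(M) = e^(p-1) κ and b_(n+1)(M) = e^(p-1) b_n^p.
The partial products P_N of the b_n^(p^(n-1)) therefore satisfy e·P_(N+1)(M) = e^(p^(N+1)) κ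
P_N^(p²) (`partialProduct_subst`). Since b_n and e are 1 modulo z, their p^n-th powers are 1 modulo
z^(p^n), so the product converges and its limit solves the equation (`exists_product`). If two
solutions have ratio 1 + D, then D(M) = D^(p²); comparing orders of vanishing forces D = 0
(`eq_of_functional_equation`). -/

namespace MazurTate

noncomputable section

open WeierstrassCurve

/-! ### The group law near the origin in the coordinates t = -x/y, w = -1/y -/

section Collinear

variable {L : Type*} [Field L] [DecidableEq L] {W : WeierstrassCurve L}

/-- The symmetric functions of the `x`-coordinates of three collinear points. -/
lemma symm_of_slope {x₁ x₂ y₁ y₂ : L} (h₁ : W.toAffine.Equation x₁ y₁)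
    (h₂ : W.toAffine.Equation x₂ y₂) (hxy : ¬(x₁ = x₂ ∧ y₁ = W.toAffine.negY x₂ y₂)) {ℓ n x₃ : L}
    (hℓ : ℓ = W.toAffine.slope x₁ x₂ y₁ y₂) (hn : n = y₁ - ℓ * x₁)
    (hx₃ : x₃ = W.toAffine.addX x₁ x₂ ℓ) :
    x₁ + x₂ + x₃ = ℓ ^ 2 + W.a₁ * ℓ - W.a₂ ∧
    x₁ * x₂ + x₁ * x₃ + x₂ * x₃ = W.a₄ - 2 * ℓ * n - W.a₁ * n - W.a₃ * ℓ ∧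
    x₁ * x₂ * x₃ = n ^ 2 + W.a₃ * n - W.a₆ := by
  have h := Affine.addPolynomial_slope h₁ h₂ hxy
  rw [← hℓ, ← hx₃, Affine.addPolynomial_eq, neg_inj, Cubic.prod_X_sub_C_eq,
    Cubic.toPoly_injective] at h
  simp only [Cubic.mk.injEq] at h
  obtain ⟨-, hb, hc, hd⟩ := h
  subst hn
  refine ⟨by linear_combination hb, by linear_combination -hc, by linear_combination hd⟩

lemma eq_slope_mul_add {x₁ x₂ y₁ y₂ : L} (h₁ : W.toAffine.Equation x₁ y₁)
    (h₂ : W.toAffine.Equation x₂ y₂) (hxy : ¬(x₁ = x₂ ∧ y₁ = W.toAffine.negY x₂ y₂)) :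
    y₁ - y₂ = W.toAffine.slope x₁ x₂ y₁ y₂ * (x₁ - x₂) := by
  by_cases hx : x₁ = x₂
  · have hy := Affine.Y_eq_of_Y_ne h₁ h₂ hx fun h => hxy ⟨hx, h⟩
    rw [hx, hy]; ring
  · rw [Affine.slope_of_X_ne hx, div_mul_cancel₀ _ (sub_ne_zero.mpr hx)]

end Collinear

section Near

variable {S L : Type*} [CommRing S] [Field L] (φ : S →+* L) (J : Ideal S)

/-- A point of a Weierstrass curve over `L` is near the origin, with respect to an ideal `J` of a
ring `S` that maps to `L`, if its coordinates `-x / y` and `-1 / y` come from `J`. -/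
def IsNear {W : WeierstrassCurve L} : W.toAffine.Point → Prop
  | .zero => True
  | .some x y _ => ∃ t w, t ∈ J ∧ w ∈ J ∧ φ w ≠ 0 ∧ x = φ t / φ w ∧ y = -1 / φ w

variable {φ J} {V : WeierstrassCurve S}

lemma equation_tw (hφ : Function.Injective φ) {t w : S} (hw : φ w ≠ 0)
    (h : (V.map φ).toAffine.Equation (φ t / φ w) (-1 / φ w)) :
    w = t ^ 3 + (V.a₁ * t + V.a₂ * t ^ 2) * w + (V.a₃ + V.a₄ * t) * w ^ 2 + V.a₆ * w ^ 3 := by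
  apply hφ
  rw [Affine.equation_iff] at h
  simp only [map_add, map_mul, map_pow, WeierstrassCurve.map] at h ⊢
  field_simp at h
  linear_combination h

/-- Negation sends (t, w) to (-t, -w) divided by 1 - a₁t - a₃w, which is a unit because J lies in
the Jacobson radical. -/
lemma isNear_neg (hJ : J ≤ Ideal.jacobson ⊥) {P : (V.map φ).toAffine.Point}
    (hP : IsNear φ J P) : IsNear φ J (-P) := by
  obtain _ | ⟨x, y, h⟩ := P
  · exact trivial
  obtain ⟨t, w, ht, hw, hw0, hx, hy⟩ := hP
  have hm : V.a₁ * t + V.a₃ * w ∈ J := J.add_mem (J.mul_mem_left _ ht) (J.mul_mem_left _ hw)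
  obtain ⟨v, hv⟩ : IsUnit (1 - (V.a₁ * t + V.a₃ * w)) := by
    have := (Ideal.mem_jacobson_bot.mp (hJ hm)) (-1)
    convert this using 1; ring
  have hvφ : φ (↑v⁻¹ : S) * (1 - (φ V.a₁ * φ t + φ V.a₃ * φ w)) = 1 := by
    have : (↑v⁻¹ : S) * v = 1 := v.inv_mul
    rw [hv] at this
    simpa using congrArg φ this
  have hv0 := left_ne_zero_of_mul_eq_one hvφ
  refine ⟨-(↑v⁻¹ * t), -(↑v⁻¹ * w), J.neg_mem (J.mul_mem_left _ ht),
    J.neg_mem (J.mul_mem_left _ hw), ?_, ?_, ?_⟩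
  · rw [map_neg, map_mul]; exact neg_ne_zero.mpr (mul_ne_zero hv0 hw0)
  · rw [hx]; simp only [map_neg, map_mul]; field_simp
  · rw [Affine.negY, hx, hy]; simp only [map_neg, map_mul, WeierstrassCurve.map]; field_simp
    linear_combination hvφ

/-- The slope of the line through two points near the origin, in the coordinates `t = -x / y`
and `w = -1 / y`, is again integral. -/
lemma exists_slope_tw [DecidableEq L] (hφ : Function.Injective φ) (hJ : J ≤ Ideal.jacobson ⊥)
    {t₁ w₁ t₂ w₂ : S} (ht₁ : t₁ ∈ J) (hw₁ : w₁ ∈ J) (ht₂ : t₂ ∈ J) (hw₂ : w₂ ∈ J)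
    (hw₁0 : φ w₁ ≠ 0) (hw₂0 : φ w₂ ≠ 0) {x₁ x₂ y₁ y₂ : L}
    (hx₁ : x₁ = φ t₁ / φ w₁) (hy₁ : y₁ = -1 / φ w₁) (hx₂ : x₂ = φ t₂ / φ w₂) (hy₂ : y₂ = -1 / φ w₂)
    (h₁ : (V.map φ).toAffine.Equation x₁ y₁) (h₂ : (V.map φ).toAffine.Equation x₂ y₂)
    (hxy : ¬(x₁ = x₂ ∧ y₁ = (V.map φ).toAffine.negY x₂ y₂)) {ℓ : L}
    (hℓ : ℓ = (V.map φ).toAffine.slope x₁ x₂ y₁ y₂) :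
    ∃ l ∈ J, φ l * (y₁ - ℓ * x₁) = -ℓ ∧ y₁ - ℓ * x₁ ≠ 0 := by
  have e₁ := equation_tw hφ hw₁0 (hx₁ ▸ hy₁ ▸ h₁)
  have e₂ := equation_tw hφ hw₂0 (hx₂ ▸ hy₂ ▸ h₂)
  -- Divided differences of the equation for w: subtracting the two equations, A gathers the
  -- multiples of t₁ - t₂ (with w₁ held fixed) and B those of w₁ - w₂ (with t₂ held fixed). The
  -- slope in the (t, w)-plane is then A / (1 - B), a formula that also covers the tangent.
  set A : S := t₁ * t₁ + t₁ * t₂ + t₂ * t₂ + V.a₁ * w₁ + V.a₂ * (t₁ + t₂) * w₁ + V.a₄ * w₁ * w₁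
    with hA
  set B : S := V.a₁ * t₂ + V.a₂ * t₂ * t₂ + V.a₃ * (w₁ + w₂) + V.a₄ * t₂ * (w₁ + w₂) +
    V.a₆ * (w₁ * w₁ + w₁ * w₂ + w₂ * w₂) with hB
  have hAm : A ∈ J := by
    refine J.add_mem (J.add_mem (J.add_mem (J.add_mem (J.add_mem ?_ ?_) ?_) ?_) ?_) ?_
    all_goals exact J.mul_mem_left _ (by assumption)
  have hBm : B ∈ J := by
    refine J.add_mem (J.add_mem (J.add_mem (J.add_mem ?_ ?_) ?_) ?_) ?_
    · exact J.mul_mem_left _ ht₂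
    · exact J.mul_mem_left _ ht₂
    · exact J.mul_mem_left _ (J.add_mem hw₁ hw₂)
    · exact J.mul_mem_left _ (J.add_mem hw₁ hw₂)
    · exact J.mul_mem_left _ (J.add_mem (J.add_mem (J.mul_mem_left _ hw₁) (J.mul_mem_left _ hw₂))
        (J.mul_mem_left _ hw₂))
  obtain ⟨v, hv⟩ : IsUnit (1 - B) := by
    have := (Ideal.mem_jacobson_bot.mp (hJ hBm)) (-1)
    convert this using 1; ring
  have hv1 : (↑v⁻¹ : S) * (1 - B) = 1 := by rw [← hv]; exact v.inv_mul
  have key : (w₁ - w₂) * (1 - B) = (t₁ - t₂) * A := by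
    rw [hA, hB]; linear_combination e₁ - e₂
  have key' : w₁ - w₂ = (↑v⁻¹ * A) * (t₁ - t₂) := by
    linear_combination (↑v⁻¹ : S) * key - (w₁ - w₂) * hv1
  refine ⟨↑v⁻¹ * A, J.mul_mem_left _ hAm, ?_⟩
  by_cases hx : x₁ = x₂
  · have hy : y₁ ≠ (V.map φ).toAffine.negY x₂ y₂ := fun h => hxy ⟨hx, h⟩
    have hyy := Affine.Y_eq_of_Y_ne h₁ h₂ hx hy
    have hww : w₁ = w₂ := by
      apply hφ
      rw [hy₁, hy₂] at hyy
      field_simp at hyy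
      linear_combination hyy
    have htt : t₁ = t₂ := by
      apply hφ
      rw [hx₁, hx₂, hww] at hx
      field_simp at hx
      exact hx
    subst hww htt
    subst hx
    subst hyy
    set η := y₁ - (V.map φ).toAffine.negY x₁ y₁ with hη
    have hη0 : η ≠ 0 := sub_ne_zero.mpr hy
    rw [Affine.slope_of_Y_ne rfl hy, ← hη] at hℓ
    have hℓη : ℓ * η = 3 * x₁ ^ 2 + 2 * φ V.a₂ * x₁ + φ V.a₄ - φ V.a₁ * y₁ := by
      rw [hℓ, div_mul_cancel₀ _ hη0]; rfl
    have hηe : η = 2 * y₁ + φ V.a₁ * x₁ + φ V.a₃ := by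
      rw [hη, Affine.negY]; simp only [WeierstrassCurve.map]; ring
    have hAφ : φ A = (3 * x₁ ^ 2 + 2 * φ V.a₂ * x₁ + φ V.a₄ - φ V.a₁ * y₁) * φ w₁ ^ 2 := by
      rw [hA, hx₁, hy₁]; simp only [map_add, map_mul]; field_simp; ring
    have hyw : y₁ * φ w₁ = -1 := by rw [hy₁]; field_simp
    have hxw : x₁ * φ w₁ = φ t₁ := by rw [hx₁]; field_simp
    -- The intercept of the tangent is nonzero because, up to the factor ηw², it is minus the unit 1
    -- - B.
    have hnη : (y₁ - ℓ * x₁) * η * φ w₁ ^ 2 = -φ (1 - B) := by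
      have eq := (Affine.equation_iff _ _).mp h₁
      simp only [WeierstrassCurve.map] at eq
      have : (y₁ - ℓ * x₁) * η = y₁ * η - (ℓ * η) * x₁ := by ring
      rw [this, hℓη, hηe, hB]
      simp only [map_sub, map_add, map_mul, map_one, ← hxw]
      linear_combination 3 * φ w₁ ^ 2 * eq + (-2 * φ V.a₃ * φ w₁ - φ V.a₁ * x₁ * φ w₁ 
         + 1 -  y₁ * φ w₁) * hyw
    have hB0 : φ (1 - B) ≠ 0 := by
      rw [← hv]; exact (v.isUnit.map φ).ne_zero
    have hn0 : y₁ - ℓ * x₁ ≠ 0 := by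
      intro h
      rw [h, zero_mul, zero_mul, eq_comm, neg_eq_zero] at hnη
      exact hB0 hnη
    refine ⟨?_, hn0⟩
    have hv1φ : φ ↑v⁻¹ * φ (1 - B) = 1 := by rw [← map_mul, hv1, map_one]
    have hc : η * φ w₁ ^ 2 ≠ 0 := mul_ne_zero hη0 (pow_ne_zero _ hw₁0)
    apply mul_right_cancel₀ hc
    rw [map_mul, hAφ]
    linear_combination φ ↑v⁻¹ * (3 * x₁ ^ 2 + 2 * φ V.a₂ * x₁ + φ V.a₄ - φ V.a₁ * y₁) * φ w₁ ^ 2 *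
      hnη + φ w₁ ^ 2 * hℓη - (3 * x₁ ^ 2 + 2 * φ V.a₂ * x₁ + φ V.a₄ - φ V.a₁ * y₁) * φ w₁ ^ 2 * hv1φ
  · have hx0 : x₁ - x₂ ≠ 0 := sub_ne_zero.mpr hx
    have hs := eq_slope_mul_add h₁ h₂ hxy
    rw [← hℓ] at hs
    have hn : (y₁ - ℓ * x₁) * (x₁ - x₂) * (φ w₁ * φ w₂) = φ t₂ - φ t₁ := by
      have : (y₁ - ℓ * x₁) * (x₁ - x₂) = y₂ * x₁ - y₁ * x₂ := by linear_combination x₁ * hs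
      rw [this, hx₁, hx₂, hy₁, hy₂]; field_simp; ring
    have hk := congrArg φ key'
    rw [map_mul, map_sub, map_sub] at hk
    constructor
    · have hc : (x₁ - x₂) * (φ w₁ * φ w₂) ≠ 0 := mul_ne_zero hx0 (mul_ne_zero hw₁0 hw₂0)
      apply mul_right_cancel₀ hc
      have : (y₁ - y₂) * (φ w₁ * φ w₂) = φ w₁ - φ w₂ := by rw [hy₁, hy₂]; field_simp; ring
      linear_combination φ (↑v⁻¹ * A) * hn + hk - (φ w₁ * φ w₂) * hs + this
    · intro h0
      rw [h0, zero_mul, zero_mul] at hn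
      have htt : t₁ = t₂ := by apply hφ; linear_combination hn
      rw [htt, sub_self, mul_zero, sub_eq_zero] at key'
      exact hx (by rw [hx₁, hx₂, htt, key'])

/-- In the (t, w)-plane the line is w = lt + ν with l = -ℓ/n and ν = -1/n, both from J. Substituted
into the equation it gives a cubic in t with leading coefficient 1 + a₂l + a₄l² + a₆l³, a unit. The
sum of its roots yields the third t-coordinate in J, and negation finishes. -/
lemma isNear_add [DecidableEq L] (hφ : Function.Injective φ) (hJ : J ≤ Ideal.jacobson ⊥)
    {P Q : (V.map φ).toAffine.Point} (hP : IsNear φ J P) (hQ : IsNear φ J Q) :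
    IsNear φ J (P + Q) := by
  obtain _ | ⟨x₁, y₁, h₁⟩ := P
  · change IsNear φ J (0 + Q); rwa [zero_add]
  obtain _ | ⟨x₂, y₂, h₂⟩ := Q
  · change IsNear φ J (_ + 0); rwa [add_zero]
  by_cases hxy : x₁ = x₂ ∧ y₁ = (V.map φ).toAffine.negY x₂ y₂
  · rw [Affine.Point.add_of_Y_eq hxy.1 hxy.2]; exact trivial
  obtain ⟨t₁, w₁, ht₁, hw₁, hw₁0, hx₁, hy₁⟩ := hP
  obtain ⟨t₂, w₂, ht₂, hw₂, hw₂0, hx₂, hy₂⟩ := hQ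
  obtain ⟨ℓ, hℓ⟩ : ∃ ℓ, ℓ = (V.map φ).toAffine.slope x₁ x₂ y₁ y₂ := ⟨_, rfl⟩
  obtain ⟨l, hlJ, hl, hn0⟩ := exists_slope_tw hφ hJ ht₁ hw₁ ht₂ hw₂ hw₁0 hw₂0 hx₁ hy₁ hx₂ hy₂
    h₁.1 h₂.1 hxy hℓ
  rw [Affine.Point.add_some hxy]
  have hneg : Affine.Point.some _ _ (Affine.nonsingular_add h₁ h₂ hxy) =
    -(Affine.Point.some _ _ (Affine.nonsingular_negAdd h₁ h₂ hxy)) := rfl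
  rw [hneg]
  apply isNear_neg hJ
  obtain ⟨n, hn⟩ : ∃ n, n = y₁ - ℓ * x₁ := ⟨_, rfl⟩
  obtain ⟨x₃, hx₃⟩ : ∃ x₃, x₃ = (V.map φ).toAffine.addX x₁ x₂ ℓ := ⟨_, rfl⟩
  obtain ⟨s₁, s₂, s₃⟩ := symm_of_slope h₁.1 h₂.1 hxy hℓ hn hx₃
  have hs := eq_slope_mul_add h₁.1 h₂.1 hxy
  rw [← hℓ] at hs
  have hx₁' : (V.map φ).toAffine.addX x₁ x₂ ((V.map φ).toAffine.slope x₁ x₂ y₁ y₂) = x₃ := by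
    rw [hx₃, hℓ]
  have hy₃' : (V.map φ).toAffine.negAddY x₁ x₂ y₁ ((V.map φ).toAffine.slope x₁ x₂ y₁ y₂) =
      ℓ * x₃ + n := by
    rw [Affine.negAddY, hx₁', ← hℓ, hn]; ring
  change ∃ t w, t ∈ J ∧ w ∈ J ∧ φ w ≠ 0 ∧ _ = φ t / φ w ∧ _ = -1 / φ w
  rw [hx₁', hy₃']
  rw [← hn] at hl hn0
  simp only [WeierstrassCurve.map] at s₁ s₂ s₃
  have hm : V.a₂ * l + V.a₄ * l * l + V.a₆ * l ^ 2 * l ∈ J :=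
    J.add_mem (J.add_mem (J.mul_mem_left _ hlJ) (J.mul_mem_left _ hlJ)) (J.mul_mem_left _ hlJ)
  obtain ⟨v, hv⟩ : IsUnit (1 + (V.a₂ * l + V.a₄ * l * l + V.a₆ * l ^ 2 * l)) := by
    have := (Ideal.mem_jacobson_bot.mp (hJ hm)) 1
    convert this using 1; ring
  have hvφ : φ (↑v⁻¹ : S) * (1 + (φ V.a₂ * φ l + φ V.a₄ * φ l * φ l + φ V.a₆ * φ l ^ 2 * φ l))
      = 1 := by
    have : (↑v⁻¹ : S) * v = 1 := v.inv_mul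
    rw [hv] at this
    simpa using congrArg φ this
  have hνJ : w₁ - l * t₁ ∈ J := J.sub_mem hw₁ (J.mul_mem_left _ ht₁)
  obtain ⟨ν, hν⟩ : ∃ ν, ν = w₁ - l * t₁ := ⟨_, rfl⟩
  rw [← hν] at hνJ
  have hlφ : φ l = -ℓ / n := by field_simp; linear_combination hl
  have hy₁0 : y₁ ≠ 0 := by rw [hy₁]; simpa using hw₁0
  have hy₂0 : y₂ ≠ 0 := by rw [hy₂]; simpa using hw₂0
  have hy₁n : y₁ = ℓ * x₁ + n := by rw [hn]; ring
  have hy₂n : y₂ = ℓ * x₂ + n := by linear_combination hy₁n - hs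
  have hw₁y : φ w₁ = -1 / y₁ := by rw [hy₁]; field_simp
  have hw₂y : φ w₂ = -1 / y₂ := by rw [hy₂]; field_simp
  have ht₁y : φ t₁ = -x₁ / y₁ := by rw [hy₁, hx₁]; field_simp
  have ht₂y : φ t₂ = -x₂ / y₂ := by rw [hy₂, hx₂]; field_simp
  have hνφ : φ ν = -1 / n := by
    rw [hν, map_sub, map_mul, hlφ, hw₁y, ht₁y]; field_simp; linear_combination hy₁n
  -- The leading coefficient times n³ is the product of the three y-coordinates on the line; being
  -- nonzero, it shows that the third point has y ≠ 0, so its t and w are defined.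
  have hc₃ : (1 + (φ V.a₂ * φ l + φ V.a₄ * φ l * φ l + φ V.a₆ * φ l ^ 2 * φ l)) * n ^ 3 =
      y₁ * y₂ * (ℓ * x₃ + n) := by
    rw [hlφ, hy₁n, hy₂n]
    field_simp
    linear_combination -(ℓ * n ^ 2) * s₁ - ℓ ^ 2 * n * s₂ - ℓ ^ 3 * s₃
  have hy₃0 : ℓ * x₃ + n ≠ 0 := by
    intro h0
    rw [h0, mul_zero] at hc₃
    exact mul_ne_zero (right_ne_zero_of_mul_eq_one hvφ) (pow_ne_zero 3 hn0) hc₃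
  have ht₃ : φ (-t₁ - t₂ - ↑v⁻¹ * (V.a₁ * l + V.a₂ * ν + V.a₃ * l * l + 2 * V.a₄ * l * ν +
      3 * V.a₆ * l ^ 2 * ν)) = -x₃ / (ℓ * x₃ + n) := by
    have hvn : φ (↑v⁻¹ : S) = n ^ 3 / (y₁ * y₂ * (ℓ * x₃ + n)) := by
      rw [← hc₃, eq_div_iff (mul_ne_zero (right_ne_zero_of_mul_eq_one hvφ) (pow_ne_zero 3 hn0))]
      linear_combination n ^ 3 * hvφ
    simp only [map_sub, map_neg, map_mul, map_add, map_pow, map_ofNat]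
    rw [hvn, hνφ, hlφ, ht₁y, ht₂y]
    field_simp
    rw [hy₁n, hy₂n]
    linear_combination 3 * ℓ ^ 2 * s₃ + 2 * ℓ * n * s₂ + n ^ 2 * s₁
  have hw₃ : φ (l * (-t₁ - t₂ - ↑v⁻¹ * (V.a₁ * l + V.a₂ * ν + V.a₃ * l * l + 2 * V.a₄ * l * ν +
      3 * V.a₆ * l ^ 2 * ν)) + ν) = -1 / (ℓ * x₃ + n) := by
    rw [map_add, map_mul, ht₃, hlφ, hνφ]; field_simp; ring
  have hmem : -t₁ - t₂ - ↑v⁻¹ * (V.a₁ * l + V.a₂ * ν + V.a₃ * l * l + 2 * V.a₄ * l * ν +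
      3 * V.a₆ * l ^ 2 * ν) ∈ J :=
    J.sub_mem (J.sub_mem (J.neg_mem ht₁) ht₂) (J.mul_mem_left _ (J.add_mem (J.add_mem (J.add_mem
      (J.add_mem (J.mul_mem_left _ hlJ) (J.mul_mem_left _ hνJ)) (J.mul_mem_left _ hlJ))
      (J.mul_mem_left _ hνJ)) (J.mul_mem_left _ hνJ)))
  refine ⟨_, _, hmem, J.add_mem (J.mul_mem_left l hmem) hνJ, ?_, ?_, ?_⟩
  · rw [hw₃]; exact div_ne_zero (neg_ne_zero.mpr one_ne_zero) hy₃0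
  · rw [hw₃, ht₃, div_div_div_cancel_right₀ hy₃0, neg_div_neg_eq, div_one]
  · rw [hw₃]; field_simp

end Near

/-! ### Additivity of the invariant differential along a derivation -/

section Logarithm

variable {L : Type*} [Field L] (D : Derivation ℤ L L)
  {W : WeierstrassCurve L}

/-- The logarithmic derivative `Dx / (2y + a₁x + a₃)` of a point along a derivation `D`, that is the
value on `D` of the pull back of the invariant differential, is `d`. -/
def HasLogDeriv (d : L) : W.toAffine.Point → Prop
  | .zero => d = 0
  | .some x y _ => D x = d * (2 * y + W.a₁ * x + W.a₃) ∧
      D y = d * (3 * x ^ 2 + 2 * W.a₂ * x + W.a₄ - W.a₁ * y)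

variable {D}

lemma HasLogDeriv.neg (h₁ : D W.a₁ = 0) (h₃ : D W.a₃ = 0) {P : W.toAffine.Point} {d : L}
    (hP : HasLogDeriv D d P) : HasLogDeriv D (-d) (-P) := by
  obtain _ | ⟨x, y, h⟩ := P
  · change -d = 0
    rw [neg_eq_zero]; exact hP
  obtain ⟨hx, hy⟩ := hP
  constructor
  · rw [hx, Affine.negY]; ring
  · rw [Affine.negY, map_sub, map_sub, map_neg, Derivation.leibniz, smul_eq_mul, smul_eq_mul, h₁, h₃,
      hx, hy]
    ring

/-- For a chord, differentiate y₁ - y₂ = ℓ(x₁ - x₂); for a tangent, differentiate the equation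
defining ℓ, where d₁ = d₂ because the denominator of the slope is nonzero. -/
lemma deriv_slope [DecidableEq L] (h₁ : D W.a₁ = 0) (h₂ : D W.a₂ = 0) (h₃ : D W.a₃ = 0)
    (h₄ : D W.a₄ = 0) {x₁ x₂ y₁ y₂ : L} (hP : W.toAffine.Equation x₁ y₁)
    (hQ : W.toAffine.Equation x₂ y₂) (hxy : ¬(x₁ = x₂ ∧ y₁ = W.toAffine.negY x₂ y₂)) {ℓ x₃ : L}
    (hℓ : ℓ = W.toAffine.slope x₁ x₂ y₁ y₂) (hx₃ : x₃ = W.toAffine.addX x₁ x₂ ℓ) {d₁ d₂ : L}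
    (hx₁ : D x₁ = d₁ * (2 * y₁ + W.a₁ * x₁ + W.a₃))
    (hy₁ : D y₁ = d₁ * (3 * x₁ ^ 2 + 2 * W.a₂ * x₁ + W.a₄ - W.a₁ * y₁))
    (hx₂ : D x₂ = d₂ * (2 * y₂ + W.a₁ * x₂ + W.a₃))
    (hy₂ : D y₂ = d₂ * (3 * x₂ ^ 2 + 2 * W.a₂ * x₂ + W.a₄ - W.a₁ * y₂)) :
    D ℓ = d₁ * (x₁ - x₃) + d₂ * (x₂ - x₃) := by
  by_cases hx : x₁ = x₂
  · have hy : y₁ ≠ W.toAffine.negY x₂ y₂ := fun h => hxy ⟨hx, h⟩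
    have hyy := Affine.Y_eq_of_Y_ne hP hQ hx hy
    subst hx hyy
    have hη0 := sub_ne_zero.mpr hy
    have hη : y₁ - W.toAffine.negY x₁ y₁ = 2 * y₁ + W.a₁ * x₁ + W.a₃ := by rw [Affine.negY]; ring
    have hℓη := hℓ
    rw [Affine.slope_of_Y_ne rfl hy, eq_div_iff hη0, hη] at hℓη
    rw [hη] at hη0
    have hd : d₁ = d₂ := mul_right_cancel₀ hη0 (hx₁.symm.trans hx₂)
    subst hd
    have h2 : D (2 : L) = 0 := by simpa using D.map_natCast 2
    have h3 : D (3 : L) = 0 := by simpa using D.map_natCast 3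
    have hD := congrArg D hℓη
    simp only [map_add, map_sub, Derivation.leibniz, smul_eq_mul, h₁, h₂, h₃, h₄, h2, h3, hx₁, hy₁,
      Derivation.leibniz_pow, mul_zero, add_zero, nsmul_eq_mul] at hD
    apply mul_right_cancel₀ hη0
    rw [hx₃, Affine.addX]
    linear_combination hD + d₁ * (2 * ℓ + W.a₁) * hℓη
  · have hs := eq_slope_mul_add hP hQ hxy
    rw [← hℓ] at hs
    obtain ⟨s₁, s₂, s₃⟩ := symm_of_slope hP hQ hxy hℓ rfl hx₃
    have hD := congrArg D hs
    simp only [map_sub, Derivation.leibniz, smul_eq_mul, hx₁, hy₁, hx₂, hy₂] at hD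
    apply mul_right_cancel₀ (sub_ne_zero.mpr hx)
    -- This is the derivative at x₁ of the cubic cut out by the line, whose roots are x₁, x₂, x₃.
    have k₁ : 3 * x₁ ^ 2 + 2 * W.a₂ * x₁ + W.a₄ - W.a₁ * y₁ - ℓ * (2 * y₁ + W.a₁ * x₁ + W.a₃) =
        (x₁ - x₂) * (x₁ - x₃) := by
      linear_combination -s₂ + 2 * x₁ * s₁
    have k₂ : 3 * x₂ ^ 2 + 2 * W.a₂ * x₂ + W.a₄ - W.a₁ * y₂ - ℓ * (2 * y₂ + W.a₁ * x₂ + W.a₃) =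
        (x₂ - x₁) * (x₂ - x₃) := by
      linear_combination -s₂ + 2 * x₂ * s₁ + (2 * ℓ + W.a₁) * hs
    linear_combination -hD + d₁ * k₁ - d₂ * k₂

/-- The third collinear point has x₃ = ℓ² + a₁ℓ - a₂ - x₁ - x₂, so its derivative follows from that
of ℓ; it has logarithmic derivative -(d₁ + d₂), and negation changes the sign. -/
lemma HasLogDeriv.add [DecidableEq L] (h₁ : D W.a₁ = 0) (h₂ : D W.a₂ = 0) (h₃ : D W.a₃ = 0)
    (h₄ : D W.a₄ = 0) {P Q : W.toAffine.Point} {d₁ d₂ : L} (hP : HasLogDeriv D d₁ P)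
    (hQ : HasLogDeriv D d₂ Q) : HasLogDeriv D (d₁ + d₂) (P + Q) := by
  obtain _ | ⟨x₁, y₁, hW₁⟩ := P
  · change d₁ = 0 at hP
    change HasLogDeriv D _ (0 + Q); rwa [zero_add, hP, zero_add]
  obtain _ | ⟨x₂, y₂, hW₂⟩ := Q
  · change d₂ = 0 at hQ
    change HasLogDeriv D _ (_ + 0); rwa [add_zero, hQ, add_zero]
  obtain ⟨hx₁, hy₁⟩ := hP
  obtain ⟨hx₂, hy₂⟩ := hQ
  by_cases hxy : x₁ = x₂ ∧ y₁ = W.toAffine.negY x₂ y₂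
  · rw [Affine.Point.add_of_Y_eq hxy.1 hxy.2]
    change d₁ + d₂ = 0
    obtain ⟨rfl, hy⟩ := hxy
    have hDy := congrArg D hy
    rw [Affine.negY, map_sub, map_sub, map_neg, Derivation.leibniz, smul_eq_mul, smul_eq_mul, h₁, h₃,
      hx₂, hy₁, hy₂] at hDy
    rw [Affine.negY] at hy
    have k₁ : (d₁ + d₂) * (2 * y₁ + W.a₁ * x₁ + W.a₃) = 0 := by
      linear_combination hx₂ - hx₁ + 2 * d₂ * hy
    have k₂ : (d₁ + d₂) * (3 * x₁ ^ 2 + 2 * W.a₂ * x₁ + W.a₄ - W.a₁ * y₁) = 0 := by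
      linear_combination hDy - d₂ * W.a₁ * hy
    -- At opposite points d₁ + d₂ annihilates both partial derivatives of the equation, and
    -- nonsingularity says that one of them is nonzero.
    rcases ((Affine.nonsingular_iff _ _).mp hW₁).2 with h | h
    · exact (mul_eq_zero.mp k₂).resolve_right fun h0 => h (by linear_combination -h0)
    · exact (mul_eq_zero.mp k₁).resolve_right fun h0 => h (by linear_combination h0)
  rw [Affine.Point.add_some hxy]
  have hneg : Affine.Point.some _ _ (Affine.nonsingular_add hW₁ hW₂ hxy) =
    -(Affine.Point.some _ _ (Affine.nonsingular_negAdd hW₁ hW₂ hxy)) := rfl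
  rw [hneg, ← neg_neg (d₁ + d₂)]
  apply HasLogDeriv.neg h₁ h₃
  obtain ⟨ℓ, hℓ⟩ : ∃ ℓ, ℓ = W.toAffine.slope x₁ x₂ y₁ y₂ := ⟨_, rfl⟩
  obtain ⟨x₃, hx₃⟩ : ∃ x₃, x₃ = W.toAffine.addX x₁ x₂ ℓ := ⟨_, rfl⟩
  have hDℓ := deriv_slope h₁ h₂ h₃ h₄ hW₁.1 hW₂.1 hxy hℓ hx₃ hx₁ hy₁ hx₂ hy₂
  obtain ⟨s₁, s₂, s₃⟩ := symm_of_slope hW₁.1 hW₂.1 hxy hℓ rfl hx₃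
  have hs := eq_slope_mul_add hW₁.1 hW₂.1 hxy
  rw [← hℓ] at hs
  have hDx₃ : D x₃ = -(d₁ + d₂) * (2 * (ℓ * (x₃ - x₁) + y₁) + W.a₁ * x₃ + W.a₃) := by
    rw [hx₃, Affine.addX]
    simp only [map_add, map_sub, Derivation.leibniz, Derivation.leibniz_pow, smul_eq_mul, h₁, h₂,
      hx₁, hx₂, hDℓ, nsmul_eq_mul]
    rw [hx₃, Affine.addX]
    push_cast
    linear_combination 2 * d₂ * hs
  have hDy₃ : D (ℓ * (x₃ - x₁) + y₁) = -(d₁ + d₂) *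
      (3 * x₃ ^ 2 + 2 * W.a₂ * x₃ + W.a₄ - W.a₁ * (ℓ * (x₃ - x₁) + y₁)) := by
    rw [map_add, Derivation.leibniz, map_sub, hDx₃, hDℓ, hx₁, hy₁, smul_eq_mul, smul_eq_mul]
    linear_combination (d₁ + d₂) * (2 * x₃ * s₁ - s₂) + d₁ * (2 * x₁ * s₁ - s₂)
  have hx₁' : W.toAffine.addX x₁ x₂ (W.toAffine.slope x₁ x₂ y₁ y₂) = x₃ := by
    rw [hx₃, hℓ]
  have hy₃' : W.toAffine.negAddY x₁ x₂ y₁ (W.toAffine.slope x₁ x₂ y₁ y₂) =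
      ℓ * (x₃ - x₁) + y₁ := by
    rw [Affine.negAddY, hx₁', ← hℓ]
  change D _ = _ * (2 * _ + W.a₁ * _ + W.a₃) ∧
      D _ = _ * (3 * _ ^ 2 + 2 * W.a₂ * _ + W.a₄ - W.a₁ * _)
  rw [hx₁', hy₃']
  exact ⟨hDx₃, hDy₃⟩

lemma HasLogDeriv.nsmul [DecidableEq L] (h₁ : D W.a₁ = 0) (h₂ : D W.a₂ = 0) (h₃ : D W.a₃ = 0)
    (h₄ : D W.a₄ = 0) {P : W.toAffine.Point} {d : L} (hP : HasLogDeriv D d P) (n : ℕ) :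
    HasLogDeriv D (n * d) (n • P) := by
  induction n with
  | zero => rw [Nat.cast_zero, zero_mul, zero_smul]; exact rfl
  | succ n ih =>
    rw [Nat.cast_succ, add_mul, one_mul, succ_nsmul]
    exact ih.add h₁ h₂ h₃ h₄ hP

end Logarithm

/-! ### The derivation d/dz on Laurent series -/

section Derivation

variable {L : Type*} [Field L] (D : Derivation ℤ L L)

lemma derivation_mul (a b : L) : D (a * b) = a * D b + b * D a := D.leibniz a b

lemma derivation_pow (a : L) (n : ℕ) : D (a ^ n) = n * a ^ (n - 1) * D a := by
  rw [Derivation.leibniz_pow, nsmul_eq_mul, smul_eq_mul, mul_assoc]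

lemma derivation_div_eq_zero {a b : L} (ha : D a = 0) (hb : D b = 0) : D (a / b) = 0 := by
  rw [Derivation.leibniz_div]
  simp [ha, hb]

end Derivation

section LaurentDerivative

variable {K : Type*} [Field K]

lemma coeff_single_one_mul (n k : ℤ) (g : K⸨X⸩) :
    (HahnSeries.single n 1 * g).coeff k = g.coeff (k - n) := by
  have := HahnSeries.coeff_single_mul_add (r := (1 : K)) (x := g) (a := k - n) (b := n)
  rwa [sub_add_cancel, one_mul] at this

lemma laurentDerivative_coeff (g : K⸨X⸩) (k : ℤ) :
    (LaurentSeries.derivative K g).coeff k = (k + 1) * g.coeff (k + 1) := by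
  rw [LaurentSeries.derivative_apply, LaurentSeries.hasseDeriv_coeff]
  simp

lemma laurentDerivative_single_mul (n : ℤ) (g : K⸨X⸩) :
    LaurentSeries.derivative K (HahnSeries.single n 1 * g) =
      HahnSeries.C (n : K) * HahnSeries.single (n - 1) 1 * g +
        HahnSeries.single n 1 * LaurentSeries.derivative K g := by
  ext k
  rw [HahnSeries.coeff_add, mul_assoc, HahnSeries.C_mul_eq_smul, HahnSeries.coeff_smul, smul_eq_mul, coeff_single_one_mul,
    laurentDerivative_coeff, coeff_single_one_mul, coeff_single_one_mul, laurentDerivative_coeff]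
  rw [show k + 1 - n = k - (n - 1) by ring, show k - n + 1 = k - (n - 1) by ring]
  push_cast
  ring

lemma laurentDerivative_coe (f : K⟦X⟧) :
    LaurentSeries.derivative K (f : K⸨X⸩) = (PowerSeries.derivative K f : K⟦X⟧) := by
  ext k
  rw [laurentDerivative_coeff, PowerSeries.coeff_coe, PowerSeries.coeff_coe]
  rcases lt_trichotomy k (-1) with h | h | h
  · rw [if_pos (by omega), if_pos (by omega), mul_zero]
  · subst h; simp
  · rw [if_neg (by omega), if_neg (by omega), PowerSeries.coeff_derivative]
    obtain ⟨m, rfl⟩ := Int.eq_ofNat_of_zero_le (show 0 ≤ k by omega)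
    rw [show (((m : ℤ) + 1).natAbs) = m + 1 by omega, Int.natAbs_natCast]
    push_cast
    ring

lemma laurentDerivative_mul (f g : K⸨X⸩) :
    LaurentSeries.derivative K (f * g) =
      f * LaurentSeries.derivative K g + g * LaurentSeries.derivative K f := by
  rw [← LaurentSeries.single_order_mul_powerSeriesPart f,
    ← LaurentSeries.single_order_mul_powerSeriesPart g]
  generalize f.order = a
  generalize g.order = b
  generalize f.powerSeriesPart = F
  generalize g.powerSeriesPart = G
  have h4 : HahnSeries.single (a + b) (1 : K) =
    HahnSeries.single a 1 * HahnSeries.single b 1 := by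
      rw [HahnSeries.single_mul_single, one_mul]
  have h1 : (HahnSeries.single a (1 : K) * (F : K⸨X⸩)) * (HahnSeries.single b 1 * (G : K⸨X⸩)) =
      HahnSeries.single (a + b) 1 * ((F * G : K⟦X⟧) : K⸨X⸩) := by
    rw [map_mul, h4]; ring
  rw [h1]
  rw [laurentDerivative_single_mul, laurentDerivative_single_mul, laurentDerivative_single_mul,
    laurentDerivative_coe, laurentDerivative_coe, laurentDerivative_coe, Derivation.leibniz,
    smul_eq_mul, smul_eq_mul, map_add, map_mul, map_mul, map_mul]
  have h2 : HahnSeries.single (a + b - 1) (1 : K) =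
    HahnSeries.single (a - 1) 1 * HahnSeries.single b 1 := by
      rw [HahnSeries.single_mul_single, one_mul, sub_add_eq_add_sub]
  have h3 : HahnSeries.single (a - 1) (1 : K) * HahnSeries.single b 1  =
    HahnSeries.single a 1 * HahnSeries.single (b - 1) 1 := by
      rw [HahnSeries.single_mul_single, HahnSeries.single_mul_single]; ring_nf
  rw [h4, h2]
  push_cast
  rw [map_add]
  linear_combination HahnSeries.C (b : K) * (F : K⸨X⸩) * (G : K⸨X⸩) * h3

/-- An additive map that satisfies the Leibniz rule, as a derivation. -/
def derivationOfLeibniz {L : Type*} [Field L] (D : L →+ L)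
    (hD : ∀ a b, D (a * b) = a * D b + b * D a) : Derivation ℤ L L :=
  Derivation.mk' D.toIntLinearMap hD

/-- The derivation `d / dz` of the field of Laurent series. -/
def laurentDeriv (K : Type*) [Field K] :=
  derivationOfLeibniz (LaurentSeries.derivative (V := K) K).toAddMonoidHom laurentDerivative_mul

lemma laurentDeriv_apply (g : K⸨X⸩) : laurentDeriv K g = LaurentSeries.derivative K g := rfl

lemma laurentDeriv_C (a : K) : laurentDeriv K (HahnSeries.C a) = 0 := by
  rw [laurentDeriv_apply, ← HahnSeries.ofPowerSeries_C, laurentDerivative_coe,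
    PowerSeries.derivative_C, map_zero]

end LaurentDerivative

/-! ### Functoriality of points and substitution into Laurent series -/

section MapPoint

variable {F L : Type*} [Field F] [Field L] {W : WeierstrassCurve F} {V : WeierstrassCurve L}

lemma nonsingular_map_iff (g : F →+* L) (hV : W.map g = V) {x y : F} :
    V.toAffine.Nonsingular (g x) (g y) ↔ W.toAffine.Nonsingular x y := by
  subst hV
  exact Affine.map_nonsingular W.toAffine g.injective x y

variable [DecidableEq F] [DecidableEq L]

/-- The homomorphism on points induced by a homomorphism of fields. -/
def mapPoint (g : F →+* L) (hV : W.map g = V) : W.toAffine.Point →+ V.toAffine.Point where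
  toFun P := match P with
    | .zero => .zero
    | .some x y h => .some (g x) (g y) ((nonsingular_map_iff g hV).mpr h)
  map_zero' := rfl
  map_add' := by
    subst hV
    rintro (_ | ⟨x₁, y₁, h₁⟩) (_ | ⟨x₂, y₂, h₂⟩)
    any_goals rfl
    by_cases hxy : x₁ = x₂ ∧ y₁ = W.toAffine.negY x₂ y₂
    · rw [Affine.Point.add_of_Y_eq hxy.left hxy.right,
        Affine.Point.add_of_Y_eq (congr_arg _ hxy.left) <| by
          rw [hxy.right]; exact (Affine.map_negY ..).symm]
      rfl
    · have hxy' : ¬(g x₁ = g x₂ ∧ g y₁ = (W.map g).toAffine.negY (g x₂) (g y₂)) := fun h =>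
        hxy ⟨g.injective h.1, g.injective (h.2.trans (Affine.map_negY ..))⟩
      rw [Affine.Point.add_some hxy, Affine.Point.add_some hxy']
      change Affine.Point.some _ _ _ = Affine.Point.some _ _ _
      rw [Affine.Point.some.injEq]
      constructor
      · rw [← Affine.map_addX, ← Affine.map_slope]
      · rw [← Affine.map_addY, ← Affine.map_slope]

lemma mapPoint_some (g : F →+* L) (hV : W.map g = V) {x y : F} (h : W.toAffine.Nonsingular x y) :
    mapPoint g hV (.some x y h) =
      .some (g x) (g y) ((nonsingular_map_iff g hV).mpr h) := rfl

end MapPoint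

section Subst

variable {K F : Type*} [Field K] [Field F] (φ : K →+* F) {s : F⟦X⟧} (h0 : s.constantCoeff = 0)
  (hs : s ≠ 0)

lemma constantCoeff_subst_of_zero {R : Type*} [CommRing R] {a : R⟦X⟧} (ha : a.constantCoeff = 0)
    (f : R⟦X⟧) : PowerSeries.constantCoeff (f.subst a : R⟦X⟧) = f.constantCoeff := by
  have h := PowerSeries.constantCoeff_subst_eq_zero (a := a) ha
    (f - PowerSeries.C f.constantCoeff) (by simp)
  rw [PowerSeries.subst_sub (PowerSeries.HasSubst.of_constantCoeff_zero' ha),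
    PowerSeries.subst_C, map_sub, sub_eq_zero] at h
  exact h.trans (MvPowerSeries.constantCoeff_C _)

/-- Substitution of a nonzero power series without constant term, on power series. -/
def substRingHom : K⟦X⟧ →+* F⟦X⟧ :=
  (PowerSeries.substAlgHom (PowerSeries.HasSubst.of_constantCoeff_zero' h0)).toRingHom.comp
    (PowerSeries.map φ)

lemma substRingHom_apply (g : K⟦X⟧) : substRingHom φ h0 g = (g.map φ).subst s :=
  congrFun (PowerSeries.coe_substAlgHom (PowerSeries.HasSubst.of_constantCoeff_zero' h0)) _

/-- A nonzero g is X^n g₀ with g₀(0) ≠ 0; its image is s^n times a series with nonzero constant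
coefficient. Injectivity is what extends the substitution to Laurent series. -/
lemma substRingHom_injective (hs : s ≠ 0) : Function.Injective (substRingHom φ h0) := by
  rw [injective_iff_map_eq_zero]
  intro g hg
  by_contra hg0
  have h : PowerSeries.constantCoeff (g.divXPowOrder.map φ) ≠ 0 := by
    rw [← PowerSeries.coeff_zero_eq_constantCoeff_apply, PowerSeries.coeff_map,
      PowerSeries.coeff_zero_eq_constantCoeff_apply, Ne, map_eq_zero]
    rwa [PowerSeries.constantCoeff_divXPowOrder_eq_zero_iff]
  rw [← PowerSeries.X_pow_order_mul_divXPowOrder (f := g), map_mul, map_pow, mul_eq_zero] at hg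
  rcases hg with hg | hg
  · rw [substRingHom_apply, PowerSeries.map_X,
      PowerSeries.subst_X (PowerSeries.HasSubst.of_constantCoeff_zero' h0)] at hg
    exact hs (eq_zero_of_pow_eq_zero hg)
  · apply h
    rw [← constantCoeff_subst_of_zero h0, ← substRingHom_apply φ h0, hg, map_zero]

/-- Substitution of a nonzero power series without constant term, on Laurent series. -/
def laurentSubstHom : K⸨X⸩ →+* F⸨X⸩ :=
  IsFractionRing.lift (A := K⟦X⟧) (K := K⸨X⸩)
    (g := (HahnSeries.ofPowerSeries ℤ F).comp (substRingHom φ h0))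
    fun _ _ h => substRingHom_injective φ h0 hs (HahnSeries.ofPowerSeries_injective h)

lemma laurentSubstHom_coe (g : K⟦X⟧) :
    laurentSubstHom φ h0 hs (g : K⸨X⸩) = ((g.map φ).subst s : F⟦X⟧) := by
  rw [← substRingHom_apply φ h0]
  exact IsFractionRing.lift_algebraMap (A := K⟦X⟧) (K := K⸨X⸩) _ g

lemma laurentSubstHom_C (a : K) :
    laurentSubstHom φ h0 hs (HahnSeries.C a) = HahnSeries.C (φ a) := by
  rw [← HahnSeries.ofPowerSeries_C, laurentSubstHom_coe, PowerSeries.map_C, PowerSeries.subst_C]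
  exact HahnSeries.ofPowerSeries_C _

lemma laurentSubstHom_single (n : ℤ) :
    laurentSubstHom φ h0 hs (HahnSeries.single n 1) = (s : F⸨X⸩) ^ n := by
  have h1 : laurentSubstHom φ h0 hs (HahnSeries.single 1 1) = (s : F⸨X⸩) := by
    rw [← PowerSeries.coe_X, laurentSubstHom_coe, PowerSeries.map_X,
      PowerSeries.subst_X (PowerSeries.HasSubst.of_constantCoeff_zero' h0)]
  rw [← h1, ← map_zpow₀]
  congr 1
  exact (RatFunc.single_zpow n)

/-- Identifies the substitution defined by splitting off the order with a ring homomorphism, so that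
it can be computed factor by factor. -/
lemma laurentSubst_map (g : K⸨X⸩) : laurentSubst (g.map φ) s = laurentSubstHom φ h0 hs g := by
  have ho : (g.map φ).order = g.order := by
    by_cases hg : g = 0
    · subst hg
      rw [show (0 : K⸨X⸩).map φ = 0 by ext; simp]
      simp
    · apply le_antisymm
      · apply HahnSeries.order_le_of_coeff_ne_zero
        rw [HahnSeries.map_coeff, Ne, map_eq_zero]
        rwa [← HahnSeries.leadingCoeff_eq, HahnSeries.leadingCoeff_eq_zero]
      · have h1 : g.map φ ≠ 0 := by
          intro h
          have := congrArg (fun x => HahnSeries.coeff x g.order) h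
          simp only [HahnSeries.map_coeff, HahnSeries.coeff_zero, map_eq_zero] at this
          rw [← HahnSeries.leadingCoeff_eq, HahnSeries.leadingCoeff_eq_zero] at this
          exact hg this
        apply HahnSeries.order_le_of_coeff_ne_zero
        have := HahnSeries.leadingCoeff_ne_zero.mpr h1
        rw [HahnSeries.leadingCoeff_eq, HahnSeries.map_coeff, Ne, map_eq_zero] at this
        exact this
  have hp : LaurentSeries.powerSeriesPart (g.map φ) = g.powerSeriesPart.map φ := by
    ext n
    rw [LaurentSeries.powerSeriesPart_coeff, PowerSeries.coeff_map,
      LaurentSeries.powerSeriesPart_coeff, HahnSeries.map_coeff, ho]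
  rw [laurentSubst, ho, hp]
  conv_rhs => rw [← LaurentSeries.single_order_mul_powerSeriesPart g]
  rw [map_mul, laurentSubstHom_single, laurentSubstHom_coe]

end Subst

/-! ### Expansions at the origin in different parameters -/

section Expand

variable {K : Type*} [Field K] (W : WeierstrassCurve K) (T : FormalParameter K)

lemma expand_algebraMap_coordinateRing (r : W.toAffine.CoordinateRing) :
    expand W T (algebraMap _ _ r) = expandRing W T r :=
  IsFractionRing.lift_algebraMap _ _

lemma expand_xFun : expand W T (xFun W) = xExp W T := by
  rw [xFun, expand_algebraMap_coordinateRing, expandRing, Affine.CoordinateRing.mk,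
    AdjoinRoot.lift_mk, Polynomial.eval₂_C]
  simp

lemma expand_yFun : expand W T (yFun W) = yExp W T := by
  rw [yFun, expand_algebraMap_coordinateRing, expandRing, Affine.CoordinateRing.mk,
    AdjoinRoot.lift_mk, Polynomial.eval₂_X]

lemma expand_algebraMap (c : K) :
    expand W T (algebraMap K W.toAffine.FunctionField c) = HahnSeries.C c := by
  rw [IsScalarTower.algebraMap_apply K W.toAffine.CoordinateRing W.toAffine.FunctionField,
    expand_algebraMap_coordinateRing]
  change expandRing W T (Affine.CoordinateRing.mk _ (Polynomial.C (Polynomial.C c))) = _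
  rw [expandRing, Affine.CoordinateRing.mk, AdjoinRoot.lift_mk, Polynomial.eval₂_C]
  simp

/-- Homomorphisms from the function field are determined by the values at constants, `x` and `y`. -/
lemma functionField_hom_ext {L : Type*} [Field L] {g h : W.toAffine.FunctionField →+* L}
    (hC : ∀ c, g (algebraMap K _ c) = h (algebraMap K _ c)) (hx : g (xFun W) = h (xFun W))
    (hy : g (yFun W) = h (yFun W)) : g = h := by
  apply IsFractionRing.injective_comp_algebraMap (A := W.toAffine.CoordinateRing)
  apply AdjoinRoot.ringHom_ext
  · apply Polynomial.ringHom_ext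
    · exact hC
    · exact hx
  · exact hy

lemma map_algebraMap_map_expand : (overFunctionField W).map (expand W T) = W.map HahnSeries.C := by
  rw [overFunctionField, WeierstrassCurve.map_map]
  congr 1
  ext1 c
  exact expand_algebraMap W T c

lemma C_map_laurentSubstHom {s : K⟦X⟧} (h0 : s.constantCoeff = 0) (hs : s ≠ 0) :
    (W.map (HahnSeries.C : K →+* K⸨X⸩)).map (laurentSubstHom (RingHom.id K) h0 hs) =
      W.map HahnSeries.C := by
  rw [WeierstrassCurve.map_map]
  congr 1
  ext1 c
  exact laurentSubstHom_C _ h0 hs c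

/-- Two embeddings of the function field agree once they agree on constants, x and y. This links [p]
in the parameter z to the Hasse invariant, which is read off in the parameter t. -/
lemma expand_eq_subst_standard (f : W.toAffine.FunctionField) :
    expand W T f = laurentSubstHom (RingHom.id K) T.constantCoeff_series T.series_ne_zero
      (expand W (FormalParameter.standard K) f) := by
  suffices h : expand W T = (laurentSubstHom (RingHom.id K) T.constantCoeff_series
      T.series_ne_zero).comp (expand W (FormalParameter.standard K)) from congrArg (· f) h
  have hw : wExp W (FormalParameter.standard K) = wSeries W := PowerSeries.X_subst _
  apply functionField_hom_ext
  · intro c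
    rw [RingHom.comp_apply, expand_algebraMap, expand_algebraMap, laurentSubstHom_C]; rfl
  · rw [RingHom.comp_apply, expand_xFun, expand_xFun, xExp, xExp, map_div₀, laurentSubstHom_coe,
      laurentSubstHom_coe, hw, PowerSeries.map_id]
    simp only [FormalParameter.standard, id, PowerSeries.subst_X T.hasSubst]; rfl
  · rw [RingHom.comp_apply, expand_yFun, expand_yFun, yExp, yExp, map_div₀, map_neg, map_one,
      laurentSubstHom_coe, hw, PowerSeries.map_id]
    rfl

end Expand

/-! ### Integrality of the expansions -/

section Integrality

variable {O K : Type*} [CommRing O] [Field K] [Algebra O K] {V : WeierstrassCurve O}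
  {W : WeierstrassCurve K}

/-- Integral power series, as Laurent series over the field. -/
def integralToLaurent (O K : Type*) [CommRing O] [Field K] [Algebra O K] : O⟦X⟧ →+* K⸨X⸩ :=
  (HahnSeries.ofPowerSeries ℤ K).comp (PowerSeries.map (algebraMap O K))

lemma integralToLaurent_apply (g : O⟦X⟧) :
    integralToLaurent O K g = (g.map (algebraMap O K) : K⟦X⟧) := rfl

lemma integralToLaurent_injective [FaithfulSMul O K] :
    Function.Injective (integralToLaurent O K) := fun _ _ h =>
  PowerSeries.map_injective _ (FaithfulSMul.algebraMap_injective O K)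
    (HahnSeries.ofPowerSeries_injective h)

lemma map_C_map_integralToLaurent (hV : V.map (algebraMap O K) = W) :
    (V.map (PowerSeries.C : O →+* O⟦X⟧)).map (integralToLaurent O K) =
      W.map (HahnSeries.C : K →+* K⸨X⸩) := by
  rw [← hV, WeierstrassCurve.map_map, WeierstrassCurve.map_map]
  congr 1
  ext1 a
  change integralToLaurent O K (PowerSeries.C a) = HahnSeries.C _
  rw [integralToLaurent_apply, PowerSeries.map_C]
  exact HahnSeries.ofPowerSeries_C _

/-- Every iterate of the fixed-point equation for w has integral coefficients when the Weierstrass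
equation does. -/
lemma exists_map_eq_wSeries (hV : V.map (algebraMap O K) = W) :
    ∃ w : O⟦X⟧, w.map (algebraMap O K) = wSeries W := by
  have h : ∀ n, ∃ u : O⟦X⟧, u.map (algebraMap O K) = (wStep W)^[n] 0 := by
    intro n
    induction n with
    | zero => exact ⟨0, by simp⟩
    | succ n ih =>
      obtain ⟨u, hu⟩ := ih
      refine ⟨PowerSeries.X ^ 3 +
        (PowerSeries.C V.a₁ * PowerSeries.X + PowerSeries.C V.a₂ * PowerSeries.X ^ 2) * u +
        (PowerSeries.C V.a₃ + PowerSeries.C V.a₄ * PowerSeries.X) * u ^ 2 +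
        PowerSeries.C V.a₆ * u ^ 3, ?_⟩
      rw [Function.iterate_succ_apply', ← hu, wStep, ← hV]
      simp [WeierstrassCurve.map]
  choose u hu using h
  refine ⟨PowerSeries.mk fun n => (u n).coeff n, ?_⟩
  ext n
  rw [PowerSeries.coeff_map, PowerSeries.coeff_mk, wSeries, PowerSeries.coeff_mk, ← hu,
    PowerSeries.coeff_map]

lemma powerSeries_map_subst {R S : Type*} [CommRing R] [CommRing S] (h : R →+* S) {a : R⟦X⟧}
    (ha : a.constantCoeff = 0) (f : R⟦X⟧) :
    PowerSeries.map h (f.subst a) = (f.map h).subst (a.map h) :=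
  PowerSeries.map_subst (PowerSeries.HasSubst.of_constantCoeff_zero' ha) f

lemma FormalParameter.series_map (T : FormalParameter O) :
    (T.map (algebraMap O K)).series = T.series.map (algebraMap O K) := rfl

lemma FormalParameter.standard_map :
    (FormalParameter.standard O).map (algebraMap O K) = FormalParameter.standard K := by
  simp only [FormalParameter.map, FormalParameter.standard, PowerSeries.map_X]

lemma exists_map_eq_wExp [FaithfulSMul O K] (hV : V.map (algebraMap O K) = W)
    (T : FormalParameter O) :
    ∃ w : O⟦X⟧, PowerSeries.X ∣ w ∧ w.map (algebraMap O K) = wExp W (T.map (algebraMap O K)) := by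
  obtain ⟨w, hw⟩ := exists_map_eq_wSeries hV
  refine ⟨w.subst T.series, ?_, ?_⟩
  · rw [PowerSeries.X_dvd_iff, constantCoeff_subst_of_zero T.constantCoeff_series]
    apply FaithfulSMul.algebraMap_injective O K
    rw [← PowerSeries.coeff_zero_eq_constantCoeff_apply, ← PowerSeries.coeff_map, hw,
      PowerSeries.coeff_zero_eq_constantCoeff_apply, map_zero]
    exact PowerSeries.X_dvd_iff.mp (X_dvd_wSeries W)
  · rw [powerSeries_map_subst _ T.constantCoeff_series, hw]; rfl

/-- Makes the closure of points near the origin available with J = zO[[z]]. -/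
lemma span_X_le_jacobson (O : Type*) [CommRing O] :
    Ideal.span {(PowerSeries.X : O⟦X⟧)} ≤ Ideal.jacobson ⊥ := by
  intro g hg
  obtain ⟨g, rfl⟩ := Ideal.mem_span_singleton.mp hg
  rw [Ideal.mem_jacobson_bot]
  intro y
  rw [PowerSeries.isUnit_iff_constantCoeff]
  simp

end Integrality

/-! ### Multiplication on the expanded generic point is substitution of [n](z) -/

section Points

open scoped Classical

variable {K : Type*} [Field K] (W : WeierstrassCurve K) [W.IsElliptic] (T : FormalParameter K)

/-- The generic point, as a point over the field of Laurent series. -/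
def expandPoint : (W.map (HahnSeries.C : K →+* K⸨X⸩)).toAffine.Point :=
  mapPoint (expand W T) (map_algebraMap_map_expand W T) (genericPoint W)

lemma expandPoint_eq : ∃ h, expandPoint W T = .some (xExp W T) (yExp W T) h := by
  have h := (nonsingular_map_iff (expand W T) (map_algebraMap_map_expand W T)).mpr
    (Affine.equation_iff_nonsingular.mp (equation_generic W))
  rw [expand_xFun, expand_yFun] at h
  refine ⟨h, ?_⟩
  rw [expandPoint, genericPoint, mapPoint_some, Affine.Point.some.injEq]
  exact ⟨expand_xFun W T, expand_yFun W T⟩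

lemma mapPoint_mulGeneric (n : ℕ) :
    mapPoint (expand W T) (map_algebraMap_map_expand W T) (mulGeneric W n) =
      n • expandPoint W T := by
  rw [mulGeneric, map_nsmul, expandPoint]

/-- The function `-x / y` on points. -/
def tCoord {L : Type*} [Field L] {V : WeierstrassCurve L} : V.toAffine.Point → L
  | .zero => 0
  | .some x y _ => -x / y

lemma tCoord_mapPoint {F L : Type*} [Field F] [Field L] [DecidableEq F] [DecidableEq L]
    {V : WeierstrassCurve F}
    {U : WeierstrassCurve L} (g : F →+* L) (hV : V.map g = U) (P : V.toAffine.Point) :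
    tCoord (mapPoint g hV P) = g (tCoord P) := by
  obtain _ | ⟨x, y, h⟩ := P
  · exact (map_zero g).symm
  · change -(g x) / g y = g (-x / y)
    rw [map_div₀, map_neg]

lemma expand_neg_mulX_div_mulY (n : ℕ) :
    expand W T (-mulX W n / mulY W n) = tCoord (n • expandPoint W T) := by
  rw [← mapPoint_mulGeneric, tCoord_mapPoint]
  congr 1
  rw [mulX, mulY]
  cases mulGeneric W n with
  | zero => simp [tCoord]
  | some x y h => rfl

end Points

section FormalMultiplication

open scoped Classical

variable {O K : Type*} [CommRing O] [Field K] [Algebra O K] [FaithfulSMul O K]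
  {V : WeierstrassCurve O} {W : WeierstrassCurve K} [W.IsElliptic]

lemma isNear_nsmul {S L : Type*} [CommRing S] [Field L] {φ : S →+* L} {J : Ideal S}
    {V : WeierstrassCurve S} {U : WeierstrassCurve L} (hU : V.map φ = U)
    (hφ : Function.Injective φ) (hJ : J ≤ Ideal.jacobson ⊥) {P : U.toAffine.Point}
    (hP : IsNear φ J P) (n : ℕ) : IsNear φ J (n • P) := by
  subst hU
  induction n with
  | zero => rw [zero_smul]; exact trivial
  | succ n ih => rw [succ_nsmul]; exact isNear_add hφ hJ ih hP

lemma isNear_nsmul_expandPoint (hV : V.map (algebraMap O K) = W) (T : FormalParameter O) (n : ℕ) :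
    IsNear (integralToLaurent O K) (Ideal.span {PowerSeries.X})
      (n • expandPoint W (T.map (algebraMap O K))) := by
  refine isNear_nsmul (map_C_map_integralToLaurent hV) integralToLaurent_injective
    (span_X_le_jacobson O) ?_ n
  obtain ⟨h, hP⟩ := expandPoint_eq W (T.map (algebraMap O K))
  rw [hP]
  obtain ⟨w, hw, hw'⟩ := exists_map_eq_wExp hV T
  refine ⟨T.series, w, ?_, Ideal.mem_span_singleton.mpr hw, ?_, ?_, ?_⟩
  · exact Ideal.mem_span_singleton.mpr (PowerSeries.X_dvd_iff.mpr T.constantCoeff_series)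
  · rw [integralToLaurent_apply, hw']
    exact (map_ne_zero_iff _ HahnSeries.ofPowerSeries_injective).mpr (wExp_ne_zero W _)
  · rw [integralToLaurent_apply, integralToLaurent_apply, hw']; rfl
  · rw [integralToLaurent_apply, hw']; rfl

lemma coe_mk_coeff {t : K⟦X⟧} {g : K⸨X⸩} (h : g = t) :
    (PowerSeries.mk fun n => g.coeff n) = t := by
  ext n
  rw [PowerSeries.coeff_mk, h, LaurentSeries.coeff_coe_powerSeries]

/-- The expansion of `t ∘ [n]` is integral. -/
lemma exists_map_eq_mulT (hV : V.map (algebraMap O K) = W) (T : FormalParameter O) (n : ℕ) :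
    ∃ t : O⟦X⟧, t.constantCoeff = 0 ∧
      t.map (algebraMap O K) = mulT W (T.map (algebraMap O K)) n ∧
      tCoord (n • expandPoint W (T.map (algebraMap O K))) =
        (mulT W (T.map (algebraMap O K)) n : K⟦X⟧) := by
  obtain ⟨t, ht0, ht⟩ : ∃ t : O⟦X⟧, t.constantCoeff = 0 ∧
      tCoord (n • expandPoint W (T.map (algebraMap O K))) = integralToLaurent O K t := by
    have h := isNear_nsmul_expandPoint hV T n
    generalize n • expandPoint W (T.map (algebraMap O K)) = P at h
    obtain _ | ⟨x, y, hxy⟩ := P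
    · exact ⟨0, map_zero _, (map_zero _).symm⟩
    · obtain ⟨t, w, ht, hw, hw0, hx, hy⟩ := h
      refine ⟨t, PowerSeries.X_dvd_iff.mp (Ideal.mem_span_singleton.mp ht), ?_⟩
      change -x / y = _
      rw [hx, hy]; field_simp
  have := coe_mk_coeff ((expand_neg_mulX_div_mulY W (T.map (algebraMap O K)) n).trans ht)
  refine ⟨t, ht0, this.symm, ht.trans ?_⟩
  rw [integralToLaurent_apply]
  exact congrArg _ this.symm

lemma constantCoeff_mulT (hV : V.map (algebraMap O K) = W) (T : FormalParameter O) (n : ℕ) :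
    (mulT W (T.map (algebraMap O K)) n).constantCoeff = 0 := by
  obtain ⟨t, h0, ht, -⟩ := exists_map_eq_mulT hV T n
  rw [← ht, ← PowerSeries.coeff_zero_eq_constantCoeff_apply, PowerSeries.coeff_map,
    PowerSeries.coeff_zero_eq_constantCoeff_apply, h0, map_zero]

lemma constantCoeff_mulSeries (hV : V.map (algebraMap O K) = W) (T : FormalParameter O) (n : ℕ) :
    (mulSeries W (T.map (algebraMap O K)) n).constantCoeff = 0 := by
  rw [mulSeries, constantCoeff_subst_of_zero (constantCoeff_mulT hV T n),
    PowerSeries.constantCoeff_substInvOfIsUnit]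

lemma series_subst_mulSeries (hV : V.map (algebraMap O K) = W) (T : FormalParameter O) (n : ℕ) :
    (T.map (algebraMap O K)).series.subst (mulSeries W (T.map (algebraMap O K)) n) =
      mulT W (T.map (algebraMap O K)) n := by
  have h := PowerSeries.HasSubst.of_constantCoeff_zero' (constantCoeff_mulT hV T n)
  rw [mulSeries, ← PowerSeries.subst_comp_subst_apply (PowerSeries.HasSubst.substInvOfIsUnit ..) h,
    PowerSeries.subst_substInvOfIsUnit_right _ (T.map (algebraMap O K)).constantCoeff_series,
    PowerSeries.subst_X h]

/-- The solution `w` of the Weierstrass equation at the origin is unique. -/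
lemma w_unique (W : WeierstrassCurve K) {t w : K⟦X⟧} (ht : t.constantCoeff = 0)
    (hw : w.constantCoeff = 0)
    (h : w = t ^ 3 + (PowerSeries.C W.a₁ * t + PowerSeries.C W.a₂ * t ^ 2) * w +
      (PowerSeries.C W.a₃ + PowerSeries.C W.a₄ * t) * w ^ 2 + PowerSeries.C W.a₆ * w ^ 3) :
    w = (wSeries W).subst t := by
  have hs := PowerSeries.HasSubst.of_constantCoeff_zero' ht
  have h' := congrArg (PowerSeries.subst t) (wStep_wSeries W)
  have hC : ∀ a : K, PowerSeries.subst t (PowerSeries.C a : K⟦X⟧) = PowerSeries.C a :=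
    fun a => PowerSeries.subst_C a
  rw [wStep] at h'
  simp only [PowerSeries.subst_add hs, PowerSeries.subst_mul hs,
    PowerSeries.subst_pow hs, PowerSeries.subst_X hs, hC] at h'
  have h0 : PowerSeries.constantCoeff ((wSeries W).subst t : K⟦X⟧) = 0 := by
    rw [constantCoeff_subst_of_zero ht]; exact PowerSeries.X_dvd_iff.mp (X_dvd_wSeries W)
  generalize (wSeries W).subst t = u at h' h0
  -- The difference of two solutions is annihilated by a series with constant coefficient 1.
  have key : (w - u) * (1 - (PowerSeries.C W.a₁ * t + PowerSeries.C W.a₂ * t ^ 2) -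
      (PowerSeries.C W.a₃ + PowerSeries.C W.a₄ * t) * (w + u) -
      PowerSeries.C W.a₆ * (w ^ 2 + w * u + u ^ 2)) = 0 := by
    linear_combination h + h'
  rw [mul_eq_zero, sub_eq_zero] at key
  refine key.resolve_right fun h1 => ?_
  have := congrArg PowerSeries.constantCoeff h1
  simp [ht, hw, h0] at this

/-- Multiplication by `n` on the expanded generic point is substitution of `[n](z)`. -/
lemma nsmul_expandPoint (hV : V.map (algebraMap O K) = W) (T : FormalParameter O) (n : ℕ)
    (hn : mulSeries W (T.map (algebraMap O K)) n ≠ 0) :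
    n • expandPoint W (T.map (algebraMap O K)) =
      mapPoint (laurentSubstHom (RingHom.id K) (constantCoeff_mulSeries hV T n) hn)
        (C_map_laurentSubstHom W _ hn) (expandPoint W (T.map (algebraMap O K))) := by
  obtain ⟨h, hP⟩ := expandPoint_eq W (T.map (algebraMap O K))
  have hmul := series_subst_mulSeries hV T n
  obtain ⟨-, -, -, htc⟩ := exists_map_eq_mulT hV T n
  have hnear := isNear_nsmul_expandPoint hV T n
  generalize hQ : n • expandPoint W (T.map (algebraMap O K)) = Q at htc hnear
  obtain _ | ⟨x, y, hxy⟩ := Q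
  -- If the multiple were the origin, then t∘[n] would be 0 and hence [n](z) = 0.
  · exfalso
    apply hn
    have h0 : mulT W (T.map (algebraMap O K)) n = 0 :=
      HahnSeries.ofPowerSeries_injective (htc.symm.trans (map_zero _).symm)
    rw [mulSeries, h0]
    exact PowerSeries.subst_zero_of_constantCoeff_zero
      (PowerSeries.constantCoeff_substInvOfIsUnit _ _)
  · obtain ⟨t, w, ht, hw, hw0, hx, hy⟩ := hnear
    have hmem := hxy.1
    rw [hx, hy, ← map_C_map_integralToLaurent hV] at hmem
    have hweq := congrArg (PowerSeries.map (algebraMap O K))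
      (equation_tw integralToLaurent_injective hw0 hmem)
    have hmap : t.map (algebraMap O K) = mulT W (T.map (algebraMap O K)) n := by
      apply HahnSeries.ofPowerSeries_injective (Γ := ℤ)
      rw [← htc, ← integralToLaurent_apply]
      change _ = -x / y
      rw [hx, hy]; field_simp
    have hw0' : (w.map (algebraMap O K)).constantCoeff = 0 := by
      rw [← PowerSeries.coeff_zero_eq_constantCoeff_apply, PowerSeries.coeff_map,
        PowerSeries.coeff_zero_eq_constantCoeff_apply,
        PowerSeries.X_dvd_iff.mp (Ideal.mem_span_singleton.mp hw), map_zero]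
    -- The multiple is near the origin, so its w-coordinate is determined by its t-coordinate;
    -- agreement of t-coordinates is therefore enough.
    have hwt := w_unique W (t := mulT W (T.map (algebraMap O K)) n) (constantCoeff_mulT hV T n) hw0' (by
      rw [← hmap]
      rw [← hV]
      simpa [WeierstrassCurve.map] using hweq)
    have hwExp : (wExp W (T.map (algebraMap O K))).subst
        (mulSeries W (T.map (algebraMap O K)) n) = w.map (algebraMap O K) := by
      rw [hwt, wExp, PowerSeries.subst_comp_subst_apply (T.map (algebraMap O K)).hasSubst
        (PowerSeries.HasSubst.of_constantCoeff_zero' (constantCoeff_mulSeries hV T n)), hmul]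
    rw [hP, mapPoint_some, Affine.Point.some.injEq]
    constructor
    · rw [hx, xExp, map_div₀, laurentSubstHom_coe, laurentSubstHom_coe, PowerSeries.map_id, id, id,
        hwExp, hmul, ← hmap]
      rfl
    · rw [hy, yExp, map_div₀, map_neg, map_one, laurentSubstHom_coe, PowerSeries.map_id, id, hwExp]
      rfl

/-- Substitution of [n](z) acts on points by a group homomorphism, so it commutes with
multiplication by m; applied to the expanded generic point it gives n times that point. -/
lemma mulT_mul (hV : V.map (algebraMap O K) = W) (T : FormalParameter O) (m n : ℕ)
    (hn : mulSeries W (T.map (algebraMap O K)) n ≠ 0) :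
    mulT W (T.map (algebraMap O K)) (m * n) = (mulT W (T.map (algebraMap O K)) m).subst
      (mulSeries W (T.map (algebraMap O K)) n) := by
  obtain ⟨-, -, -, h1⟩ := exists_map_eq_mulT hV T (m * n)
  obtain ⟨-, -, -, h2⟩ := exists_map_eq_mulT hV T m
  rw [mul_nsmul', nsmul_expandPoint hV T n hn, ← map_nsmul, tCoord_mapPoint, h2,
    laurentSubstHom_coe, PowerSeries.map_id] at h1
  exact (HahnSeries.ofPowerSeries_injective h1).symm

lemma mulSeries_mul (hV : V.map (algebraMap O K) = W) (T : FormalParameter O) (m n : ℕ)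
    (hn : mulSeries W (T.map (algebraMap O K)) n ≠ 0) :
    mulSeries W (T.map (algebraMap O K)) (m * n) =
      (mulSeries W (T.map (algebraMap O K)) m).subst (mulSeries W (T.map (algebraMap O K)) n) := by
  rw [mulSeries, mulT_mul hV T m n hn]
  exact (PowerSeries.subst_comp_subst_apply
    (PowerSeries.HasSubst.of_constantCoeff_zero' (constantCoeff_mulT hV T m))
    (PowerSeries.HasSubst.of_constantCoeff_zero' (constantCoeff_mulSeries hV T n)) _).symm

lemma mulT_eq_subst_standard (hV : V.map (algebraMap O K) = W) (T : FormalParameter O) (n : ℕ) :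
    mulT W (T.map (algebraMap O K)) n =
      (mulT W (FormalParameter.standard K) n).subst (T.map (algebraMap O K)).series := by
  obtain ⟨-, -, -, h1⟩ := exists_map_eq_mulT hV T n
  obtain ⟨-, -, -, h2⟩ := exists_map_eq_mulT hV (FormalParameter.standard O) n
  rw [FormalParameter.standard_map] at h2
  rw [← expand_neg_mulX_div_mulY, expand_eq_subst_standard, expand_neg_mulX_div_mulY, h2,
    laurentSubstHom_coe, PowerSeries.map_id] at h1
  exact (HahnSeries.ofPowerSeries_injective h1).symm

lemma mulSeries_standard (hV : V.map (algebraMap O K) = W) (n : ℕ) :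
    mulSeries W (FormalParameter.standard K) n = mulT W (FormalParameter.standard K) n := by
  have := series_subst_mulSeries hV (FormalParameter.standard O) n
  rw [FormalParameter.standard_map] at this
  rw [← this]
  have h0 := constantCoeff_mulSeries hV (FormalParameter.standard O) n
  rw [FormalParameter.standard_map] at h0
  exact (PowerSeries.subst_X (PowerSeries.HasSubst.of_constantCoeff_zero' h0)).symm

end FormalMultiplication

/-! ### The expansion of ω and the shape of [p](z) in characteristic p -/

section InvariantDifferential

open scoped Classical

variable {K : Type*} [Field K] (W : WeierstrassCurve K) (T : FormalParameter K)

lemma exists_wExp_mul_eq : ∃ v : K⟦X⟧, wExp W T * v = T.series ^ 3 ∧ v.constantCoeff = 1 := by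
  obtain ⟨v, hv, hv1⟩ := exists_wSeries_mul W
  refine ⟨v.subst T.series, ?_, ?_⟩
  · rw [wExp, ← PowerSeries.subst_mul T.hasSubst, hv, PowerSeries.subst_pow T.hasSubst,
      PowerSeries.subst_X T.hasSubst]
  · rw [constantCoeff_subst_of_zero T.constantCoeff_series, hv1]

lemma coe_series_ne_zero : (T.series : K⸨X⸩) ≠ 0 :=
  (map_ne_zero_iff _ HahnSeries.ofPowerSeries_injective).mpr T.series_ne_zero

lemma exists_xExp_yExp_eq : ∃ v : K⟦X⟧, v.constantCoeff = 1 ∧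
    xExp W T = v / (T.series : K⸨X⸩) ^ 2 ∧ yExp W T = -v / (T.series : K⸨X⸩) ^ 3 := by
  obtain ⟨v, hv, hv1⟩ := exists_wExp_mul_eq W T
  have hw : (wExp W T : K⸨X⸩) ≠ 0 :=
    (map_ne_zero_iff _ HahnSeries.ofPowerSeries_injective).mpr (wExp_ne_zero W T)
  have hT := coe_series_ne_zero T
  have h : (wExp W T : K⸨X⸩) * v = (T.series : K⸨X⸩) ^ 3 := by
    rw [← map_mul, hv, map_pow]
  refine ⟨v, hv1, ?_, ?_⟩
  · rw [xExp]; field_simp; linear_combination -h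
  · rw [yExp]; field_simp; linear_combination h

/-- The invariant differential has an expansion `(β + ⋯) dz`. -/
lemma exists_invariantDifferential (h2 : (2 : K) ≠ 0) : ∃ d : K⟦X⟧,
    d.constantCoeff = T.series.coeff 1 ∧
    2 * yExp W T + HahnSeries.C W.a₁ * xExp W T + HahnSeries.C W.a₃ ≠ 0 ∧
    laurentDeriv K (xExp W T) =
      (d : K⸨X⸩) * (2 * yExp W T + HahnSeries.C W.a₁ * xExp W T + HahnSeries.C W.a₃) := by
  obtain ⟨v, hv1, hx, hy⟩ := exists_xExp_yExp_eq W T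
  have hT := coe_series_ne_zero T
  set N : K⟦X⟧ := -2 * v + PowerSeries.C W.a₁ * T.series * v + PowerSeries.C W.a₃ * T.series ^ 3
    with hN
  have hN0 : N.constantCoeff = -2 := by
    rw [hN]; simp only [map_add, map_mul, map_neg, map_pow, hv1, T.constantCoeff_series, map_ofNat]
    ring
  have hNN : N * N⁻¹ = 1 := PowerSeries.mul_inv_cancel _ (by rw [hN0]; simpa using h2)
  have hNne : (N : K⸨X⸩) ≠ 0 := by
    refine (map_ne_zero_iff _ HahnSeries.ofPowerSeries_injective).mpr fun h => ?_
    rw [h, zero_mul] at hNN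
    exact zero_ne_one hNN
  have hη : 2 * yExp W T + HahnSeries.C W.a₁ * xExp W T + HahnSeries.C W.a₃ =
      (N : K⸨X⸩) / (T.series : K⸨X⸩) ^ 3 := by
    rw [hx, hy, hN]
    simp only [map_add, map_mul, map_neg, map_pow, HahnSeries.ofPowerSeries_C, map_ofNat]
    field_simp
  refine ⟨(PowerSeries.derivative K v * T.series - 2 * v * PowerSeries.derivative K T.series) *
    N⁻¹, ?_, ?_, ?_⟩
  · have hc : (N⁻¹).constantCoeff = (-2)⁻¹ := by rw [PowerSeries.constantCoeff_inv, hN0]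
    have hd : (PowerSeries.derivative K T.series).constantCoeff = T.series.coeff 1 := by
      rw [← PowerSeries.coeff_zero_eq_constantCoeff_apply, PowerSeries.coeff_derivative]; simp
    rw [map_mul, hc, map_sub, map_mul, map_mul, map_mul, hd, T.constantCoeff_series, hv1]
    simp only [map_ofNat]
    field_simp
    ring
  · rw [hη]; exact div_ne_zero hNne (pow_ne_zero _ hT)
  · have hDx : laurentDeriv K (xExp W T) * (T.series : K⸨X⸩) ^ 3 =
        ((PowerSeries.derivative K v * T.series -
          2 * v * PowerSeries.derivative K T.series : K⟦X⟧) : K⸨X⸩) := by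
      have hxv : xExp W T * (T.series : K⸨X⸩) ^ 2 = v := by rw [hx]; field_simp
      have hD := congrArg (laurentDeriv K) hxv
      rw [derivation_mul, derivation_pow, laurentDeriv_apply (T.series : K⸨X⸩),
        laurentDeriv_apply (v : K⸨X⸩), laurentDerivative_coe, laurentDerivative_coe] at hD
      simp only [map_sub, map_mul, map_ofNat]
      push_cast at hD
      linear_combination (T.series : K⸨X⸩) * hD -
        2 * ((PowerSeries.derivative K T.series : K⟦X⟧) : K⸨X⸩) * hxv
    rw [hη, map_mul, ← hDx]
    have : (N : K⸨X⸩) * ((N⁻¹ : K⟦X⟧) : K⸨X⸩) = 1 := by rw [← map_mul, hNN, map_one]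
    field_simp
    linear_combination -laurentDeriv K (xExp W T) * this

/-- With t = T(z), x = T⁻²(1 + ⋯) and 2y + a₁x + a₃ = -2T⁻³(1 + ⋯), so ω = (T'(0) + ⋯)dz. -/
lemma beta_eq (h2 : (2 : K) ≠ 0) : beta W T = T.series.coeff 1 := by
  obtain ⟨d, hd, hη, hx⟩ := exists_invariantDifferential W T h2
  rw [beta, ← laurentDeriv_apply, hx, mul_div_assoc, div_self hη, mul_one, ← hd,
    ← PowerSeries.coeff_zero_eq_constantCoeff_apply]
  exact LaurentSeries.coeff_coe_powerSeries d 0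

/-- The condition on x is the expansion of ω; the one on y follows by differentiating the
Weierstrass equation and cancelling 2y + a₁x + a₃. -/
lemma exists_hasLogDeriv [W.IsElliptic] (h2 : (2 : K) ≠ 0) :
    ∃ d, HasLogDeriv (laurentDeriv K) d (expandPoint W T) := by
  obtain ⟨d, hd, hη, hx⟩ := exists_invariantDifferential W T h2
  obtain ⟨h, hP⟩ := expandPoint_eq W T
  refine ⟨d, ?_⟩
  rw [hP]
  refine ⟨hx, ?_⟩
  have hD := congrArg (laurentDeriv K) (equation_exp W T)
  simp only [map_add, derivation_mul, derivation_pow, laurentDeriv_C, hx, mul_zero, add_zero] at hD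
  apply mul_right_cancel₀ hη
  simp only [WeierstrassCurve.map]
  push_cast at hD
  linear_combination hD

end InvariantDifferential

section MultiplicationByP

open scoped Classical

variable {O K : Type*} [CommRing O] [Field K] [Algebra O K] [FaithfulSMul O K]
  {V : WeierstrassCurve O} {W : WeierstrassCurve K} [W.IsElliptic] (p : ℕ) [CharP K p]

lemma hasLogDeriv_zero (h2 : (2 : K) ≠ 0) (T : FormalParameter K) :
    HasLogDeriv (laurentDeriv K) 0 (p • expandPoint W T) := by
  obtain ⟨d, hd⟩ := exists_hasLogDeriv W T h2
  have := hd.nsmul (laurentDeriv_C _) (laurentDeriv_C _) (laurentDeriv_C _) (laurentDeriv_C _) p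
  have hp : (p : K⸨X⸩) = 0 := by
    rw [← map_natCast (HahnSeries.C : K →+* K⸨X⸩), CharP.cast_eq_zero, map_zero]
  rwa [hp, zero_mul] at this

/-- The logarithmic derivative of the p-fold multiple is p times that of the generic point, hence 0.
So both coordinates of the multiple have zero derivative, and so has their quotient t∘[p]. -/
lemma derivative_mulT (h2 : (2 : K) ≠ 0) (hV : V.map (algebraMap O K) = W)
    (T : FormalParameter O) :
    PowerSeries.derivative K (mulT W (T.map (algebraMap O K)) p) = 0 := by
  obtain ⟨-, -, -, ht⟩ := exists_map_eq_mulT hV T p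
  have h := hasLogDeriv_zero (W := W) p h2 (T.map (algebraMap O K))
  apply HahnSeries.ofPowerSeries_injective (Γ := ℤ)
  rw [← laurentDerivative_coe, ← ht, ← laurentDeriv_apply, map_zero]
  generalize p • expandPoint W (T.map (algebraMap O K)) = P at h
  obtain _ | ⟨x, y, hxy⟩ := P
  · exact map_zero _
  · obtain ⟨hx, hy⟩ := h
    rw [zero_mul] at hx hy
    exact derivation_div_eq_zero _ (by rw [map_neg, hx, neg_zero]) hy

/-- A vanishing derivative kills the coefficients of index prime to p. The derivative is taken over
the field, but the resulting series in X^p remains integral. -/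
lemma exists_eq_subst_X_pow [Fact p.Prime] {t : O⟦X⟧}
    (ht : PowerSeries.derivative K (t.map (algebraMap O K)) = 0) :
    t = (PowerSeries.mk fun n => t.coeff (p * n)).subst (PowerSeries.X ^ p : O⟦X⟧) := by
  have hp := (Fact.out : p.Prime)
  ext n
  rw [PowerSeries.coeff_subst_X_pow hp.ne_zero]
  split_ifs with h
  · rw [PowerSeries.coeff_mk, Nat.mul_div_cancel' h]; rfl
  · obtain ⟨m, rfl⟩ : ∃ m, n = m + 1 := Nat.exists_eq_succ_of_ne_zero fun h0 => h (h0 ▸ dvd_zero p)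
    have h1 := congrArg (PowerSeries.coeff m) ht
    rw [PowerSeries.coeff_derivative, PowerSeries.coeff_map, map_zero, mul_eq_zero] at h1
    rcases h1 with h1 | h1
    · exact (map_eq_zero_iff _ (FaithfulSMul.algebraMap_injective O K)).mp h1
    · exfalso
      apply h
      rw [← CharP.cast_eq_zero_iff K p]
      exact_mod_cast h1

lemma coeff_one_subst {R : Type*} [CommRing R] {a f : R⟦X⟧} (ha : a.constantCoeff = 0)
    (hf : f.constantCoeff = 0) :
    PowerSeries.coeff 1 (f.subst a : R⟦X⟧) = f.coeff 1 * a.coeff 1 := by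
  have hs := PowerSeries.HasSubst.of_constantCoeff_zero' ha
  obtain ⟨g, rfl⟩ := PowerSeries.X_dvd_iff.mpr hf
  obtain ⟨b, rfl⟩ := PowerSeries.X_dvd_iff.mpr ha
  rw [PowerSeries.subst_mul hs, PowerSeries.subst_X hs, mul_assoc]
  rw [show (1 : ℕ) = 0 + 1 from rfl, PowerSeries.coeff_succ_X_mul, PowerSeries.coeff_succ_X_mul,
    PowerSeries.coeff_succ_X_mul]
  simp only [PowerSeries.coeff_zero_eq_constantCoeff_apply, map_mul]
  rw [constantCoeff_subst_of_zero (by simp), mul_comm]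

lemma coeff_subst_pow {R : Type*} [CommRing R] {a f : R⟦X⟧} (ha : a.constantCoeff = 0)
    (hf : f.constantCoeff = 0) {p : ℕ} (hp : p ≠ 0) :
    PowerSeries.coeff p (f.subst (a ^ p) : R⟦X⟧) = f.coeff 1 * a.coeff 1 ^ p := by
  have hap : (a ^ p).constantCoeff = 0 := by rw [map_pow, ha, zero_pow hp]
  have hs := PowerSeries.HasSubst.of_constantCoeff_zero' hap
  obtain ⟨g, rfl⟩ := PowerSeries.X_dvd_iff.mpr hf
  obtain ⟨b, rfl⟩ := PowerSeries.X_dvd_iff.mpr ha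
  rw [PowerSeries.subst_mul hs, PowerSeries.subst_X hs, mul_pow, mul_assoc,
    show (1 : ℕ) = 0 + 1 from rfl, PowerSeries.coeff_succ_X_mul, PowerSeries.coeff_succ_X_mul]
  have := PowerSeries.coeff_X_pow_mul (b ^ p * PowerSeries.subst ((PowerSeries.X * b) ^ p) g) p 0
  rw [zero_add] at this
  rw [← mul_pow, this]
  simp only [PowerSeries.coeff_zero_eq_constantCoeff_apply, map_mul, map_pow]
  rw [constantCoeff_subst_of_zero (by simp [hp]), mul_comm]

/-- `[p](z)` is a power series in `z ^ p` with integral coefficients, and its coefficient of `z ^ p`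
is `α β ^ (p - 1)`. -/
theorem exists_mulSeries_eq [Fact p.Prime] (h2 : (2 : K) ≠ 0) (hV : V.map (algebraMap O K) = W)
    (T : FormalParameter O) : ∃ m : O⟦X⟧, m.constantCoeff = 0 ∧
      mulSeries W (T.map (algebraMap O K)) p =
        PowerSeries.map (algebraMap O K) (m.subst (PowerSeries.X ^ p : O⟦X⟧)) ∧
      algebraMap O K (T.series.coeff 1 * m.coeff 1) =
        hasseInvariant W p * algebraMap O K (T.series.coeff 1) ^ p := by
  have hp := (Fact.out : p.Prime)
  obtain ⟨t, ht0, ht, -⟩ := exists_map_eq_mulT hV T p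
  obtain ⟨s, hs0, hs, -⟩ := exists_map_eq_mulT hV (FormalParameter.standard O) p
  have hdt := derivative_mulT p h2 hV T
  have hds := derivative_mulT p h2 hV (FormalParameter.standard O)
  rw [← ht] at hdt
  rw [← hs] at hds
  have ht' := exists_eq_subst_X_pow p hdt
  have hs' := exists_eq_subst_X_pow p hds
  rw [FormalParameter.standard_map] at hs
  set v : O⟦X⟧ := PowerSeries.mk fun n => t.coeff (p * n) with hv
  set u : O⟦X⟧ := PowerSeries.mk fun n => s.coeff (p * n) with hu
  have hv0 : v.constantCoeff = 0 := by
    rw [← PowerSeries.coeff_zero_eq_constantCoeff_apply, hv, PowerSeries.coeff_mk, mul_zero,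
      PowerSeries.coeff_zero_eq_constantCoeff_apply, ht0]
  have hu0 : u.constantCoeff = 0 := by
    rw [← PowerSeries.coeff_zero_eq_constantCoeff_apply, hu, PowerSeries.coeff_mk, mul_zero,
      PowerSeries.coeff_zero_eq_constantCoeff_apply, hs0]
  have hX0 : (PowerSeries.X ^ p : O⟦X⟧).constantCoeff = 0 := by simp [hp.ne_zero]
  have hXp := PowerSeries.HasSubst.of_constantCoeff_zero' hX0
  set I : O⟦X⟧ := T.series.substInvOfIsUnit T.isUnit_coeff_one with hI
  have hI0 : I.constantCoeff = 0 := PowerSeries.constantCoeff_substInvOfIsUnit _ _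
  have hm0 : PowerSeries.constantCoeff (I.subst v : O⟦X⟧) = 0 := by
    rw [constantCoeff_subst_of_zero hv0, hI0]
  have hTm : T.series.subst (I.subst v : O⟦X⟧) = v := by
    rw [← PowerSeries.subst_comp_subst_apply (PowerSeries.HasSubst.of_constantCoeff_zero' hI0)
      (PowerSeries.HasSubst.of_constantCoeff_zero' hv0),
      PowerSeries.subst_substInvOfIsUnit_right _ T.constantCoeff_series,
      PowerSeries.subst_X (PowerSeries.HasSubst.of_constantCoeff_zero' hv0)]
  refine ⟨I.subst v, hm0, ?_, ?_⟩
  · have hIT : T.series.subst I = PowerSeries.X :=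
      PowerSeries.subst_substInvOfIsUnit_right _ T.constantCoeff_series _
    rw [PowerSeries.subst_comp_subst_apply (PowerSeries.HasSubst.of_constantCoeff_zero' hv0) hXp,
      ← ht', powerSeries_map_subst _ ht0, ht, mulSeries]
    -- The compositional inverse of the parameter commutes with base change, by uniqueness of
    -- inverses.
    have hIK : (T.map (algebraMap O K)).series.substInvOfIsUnit
        (T.map (algebraMap O K)).isUnit_coeff_one = I.map (algebraMap O K) := by
      have h1 : (T.map (algebraMap O K)).series.subst (I.map (algebraMap O K)) =
          PowerSeries.X := by
        rw [FormalParameter.series_map, ← powerSeries_map_subst _ hI0, hIT, PowerSeries.map_X]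
      have hIm0 : (I.map (algebraMap O K)).constantCoeff = 0 := by
        rw [← PowerSeries.coeff_zero_eq_constantCoeff_apply, PowerSeries.coeff_map,
          PowerSeries.coeff_zero_eq_constantCoeff_apply, hI0, map_zero]
      have h3 := congrArg (PowerSeries.subst (I.map (algebraMap O K)))
        (PowerSeries.subst_substInvOfIsUnit_left (T.map (algebraMap O K)).series
          (T.map (algebraMap O K)).constantCoeff_series (T.map (algebraMap O K)).isUnit_coeff_one)
      rw [PowerSeries.subst_comp_subst_apply (T.map (algebraMap O K)).hasSubst
        (PowerSeries.HasSubst.of_constantCoeff_zero' hIm0), h1,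
        PowerSeries.subst_X (PowerSeries.HasSubst.of_constantCoeff_zero' hIm0)] at h3
      rwa [PowerSeries.X_subst] at h3
    rw [hIK]
  · have h1 := congrArg (PowerSeries.coeff 1) hTm
    rw [coeff_one_subst hm0 T.constantCoeff_series] at h1
    rw [h1]
    have hα : hasseInvariant W p = algebraMap O K (u.coeff 1) := by
      rw [hasseInvariant, mulSeries_standard hV, ← hs, PowerSeries.coeff_map, hu,
        PowerSeries.coeff_mk, mul_one]
    -- The coefficient of z^p in t∘[p] computed through the standard parameter: with t∘[p] = u(t^p)
    -- and t = T(z), it is u₁T₁^p, where u₁ = α and T₁ is the linear coefficient of T.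
    rw [hα, hv, PowerSeries.coeff_mk, mul_one, ← PowerSeries.coeff_map, ht,
      mulT_eq_subst_standard hV T p, ← hs, FormalParameter.series_map,
      ← powerSeries_map_subst _ T.constantCoeff_series, PowerSeries.coeff_map, hs',
      PowerSeries.subst_comp_subst_apply hXp
        (PowerSeries.HasSubst.of_constantCoeff_zero' T.constantCoeff_series),
      PowerSeries.subst_pow (PowerSeries.HasSubst.of_constantCoeff_zero' T.constantCoeff_series),
      PowerSeries.subst_X (PowerSeries.HasSubst.of_constantCoeff_zero' T.constantCoeff_series),
      coeff_subst_pow T.constantCoeff_series hu0 hp.ne_zero, map_mul, map_pow]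

end MultiplicationByP

/-! ### Even and odd functions on the curve -/

section PolyFun

variable {K : Type*} [Field K] (W : WeierstrassCurve K) (T : FormalParameter K)

/-- Polynomials in the function `x`. -/
def polyFun : Polynomial K →+* W.toAffine.FunctionField :=
  (algebraMap W.toAffine.CoordinateRing W.toAffine.FunctionField).comp
    ((Affine.CoordinateRing.mk W.toAffine).comp Polynomial.C)

lemma polyFun_C (c : K) : polyFun W (Polynomial.C c) = algebraMap K W.toAffine.FunctionField c := by
  rw [IsScalarTower.algebraMap_apply K W.toAffine.CoordinateRing W.toAffine.FunctionField]
  rfl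

lemma polyFun_X : polyFun W Polynomial.X = xFun W := rfl

lemma expand_polyFun (q : Polynomial K) :
    expand W T (polyFun W q) = q.eval₂ HahnSeries.C (xExp W T) := by
  rw [polyFun, RingHom.comp_apply, expand_algebraMap_coordinateRing, RingHom.comp_apply,
    expandRing, Affine.CoordinateRing.mk, AdjoinRoot.lift_mk, Polynomial.eval₂_C]
  rfl

lemma polyFun_injective : Function.Injective (polyFun W) := by
  rw [injective_iff_map_eq_zero]
  intro q hq
  apply eval_xExp_ne_zero W (FormalParameter.standard K)
  rw [← expand_polyFun, hq, map_zero]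

/-- The function `2y + a₁x + a₃`, the denominator of the invariant differential. -/
def etaFun : W.toAffine.FunctionField :=
  2 * yFun W + algebraMap K _ W.a₁ * xFun W + algebraMap K _ W.a₃

/-- The cofactor is the conjugate of b, and the product is the norm to K[x], nonzero because the
coordinate ring is a finite free domain over K[x]. -/
lemma exists_mul_eq_polyFun (b : W.toAffine.CoordinateRing) (hb : b ≠ 0) :
    ∃ (b' : W.toAffine.CoordinateRing) (n : Polynomial K), n ≠ 0 ∧
      b * b' = Affine.CoordinateRing.mk W.toAffine (Polynomial.C n) := by
  obtain ⟨p, q, rfl⟩ := Affine.CoordinateRing.exists_smul_basis_eq b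
  have h := Affine.CoordinateRing.coe_norm_smul_basis (W' := W.toAffine) p q
  rw [map_mul] at h
  have h3 : Affine.CoordinateRing.mk W.toAffine (Polynomial.C p + Polynomial.C q * Polynomial.X) =
      p • (1 : W.toAffine.CoordinateRing) + q • Affine.CoordinateRing.mk W.toAffine Polynomial.X := by
    rw [map_add, map_mul, Affine.CoordinateRing.smul, Affine.CoordinateRing.smul, mul_one]
  rw [h3] at h
  refine ⟨_, _, ?_, h.symm⟩
  intro hn
  have hF : Module.Finite (Polynomial K) W.toAffine.CoordinateRing :=
    Module.Finite.of_basis (Affine.CoordinateRing.basis W.toAffine)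
  have hB : Module.Free (Polynomial K) W.toAffine.CoordinateRing :=
    Module.Free.of_basis (Affine.CoordinateRing.basis W.toAffine)
  exact hb (Algebra.norm_eq_zero_iff.mp hn)

/-- Rationalize the denominator by the norm, then trade y for 2y + a₁x + a₃, on which inversion acts
by -1; this separates even and odd parts and needs 2 to be invertible. -/
lemma exists_polyFun_mul_eq (h2 : (2 : K) ≠ 0) (g : W.toAffine.FunctionField) :
    ∃ n p q : Polynomial K, n ≠ 0 ∧
      polyFun W n * g = polyFun W p + polyFun W q * etaFun W := by
  obtain ⟨a, b, hb, rfl⟩ := IsFractionRing.div_surjective (A := W.toAffine.CoordinateRing) g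
  have hb0 := nonZeroDivisors.ne_zero hb
  obtain ⟨b', n, hn, hbn⟩ := exists_mul_eq_polyFun W b hb0
  obtain ⟨p, q, hpq⟩ := Affine.CoordinateRing.exists_smul_basis_eq (a * b')
  have h1 : algebraMap _ W.toAffine.FunctionField b * algebraMap _ W.toAffine.FunctionField b' =
      polyFun W n := by
    rw [← map_mul, hbn]; rfl
  have h3 : algebraMap _ W.toAffine.FunctionField a * algebraMap _ W.toAffine.FunctionField b' =
      polyFun W p + polyFun W q * yFun W := by
    rw [← map_mul, ← hpq, map_add, Affine.CoordinateRing.smul, Affine.CoordinateRing.smul, mul_one,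
      map_mul]
    rfl
  have hbF : algebraMap _ W.toAffine.FunctionField b ≠ 0 :=
    (map_ne_zero_iff _ (IsFractionRing.injective _ _)).mpr hb0
  refine ⟨Polynomial.C 2 * n, Polynomial.C 2 * p -
    q * (Polynomial.C W.a₁ * Polynomial.X + Polynomial.C W.a₃), q, ?_, ?_⟩
  · exact mul_ne_zero (by simpa using h2) hn
  · have h4 : polyFun W n * (algebraMap _ W.toAffine.FunctionField a /
        algebraMap _ W.toAffine.FunctionField b) = polyFun W p + polyFun W q * yFun W := by
      rw [← h3, ← h1]; field_simp
    simp only [map_mul, map_sub, map_add, polyFun_C, polyFun_X, map_ofNat, etaFun]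
    linear_combination 2 * h4

lemma expand_etaFun : expand W T (etaFun W) =
    2 * yExp W T + HahnSeries.C W.a₁ * xExp W T + HahnSeries.C W.a₃ := by
  simp only [etaFun, map_add, map_mul, expand_algebraMap, expand_xFun, expand_yFun, map_ofNat]

end PolyFun

section Conjugation

variable {K : Type*} [Field K] (W : WeierstrassCurve K)

/-- The automorphism of the coordinate ring induced by the inversion of the curve. -/
def conjRing : W.toAffine.CoordinateRing →+* W.toAffine.CoordinateRing :=
  AdjoinRoot.lift ((Affine.CoordinateRing.mk W.toAffine).comp Polynomial.C)
    (Affine.CoordinateRing.mk W.toAffine W.toAffine.negPolynomial) <| by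
    have h : Affine.CoordinateRing.mk W.toAffine W.toAffine.polynomial = 0 := AdjoinRoot.mk_self
    simp only [Affine.polynomial, Affine.negPolynomial, map_add, map_sub, map_neg, map_mul,
      map_pow] at h ⊢
    simp only [Polynomial.eval₂_add, Polynomial.eval₂_sub, Polynomial.eval₂_mul,
      Polynomial.eval₂_pow, Polynomial.eval₂_X, Polynomial.eval₂_C, RingHom.comp_apply]
    linear_combination h

lemma conjRing_C (q : Polynomial K) : conjRing W (Affine.CoordinateRing.mk W.toAffine
    (Polynomial.C q)) = Affine.CoordinateRing.mk W.toAffine (Polynomial.C q) := by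
  refine (AdjoinRoot.lift_mk _ _).trans ?_
  rw [Polynomial.eval₂_C]
  rfl

lemma conjRing_Y : conjRing W (Affine.CoordinateRing.mk W.toAffine Polynomial.X) =
    Affine.CoordinateRing.mk W.toAffine W.toAffine.negPolynomial := by
  refine (AdjoinRoot.lift_mk _ _).trans ?_
  rw [Polynomial.eval₂_X]

lemma conjRing_conjRing : (conjRing W).comp (conjRing W) = RingHom.id _ := by
  apply AdjoinRoot.ringHom_ext
  · refine RingHom.ext fun q => ?_
    exact (congrArg (conjRing W) (conjRing_C W q)).trans (conjRing_C W q)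
  · refine (congrArg (conjRing W) (conjRing_Y W)).trans ?_
    rw [Affine.negPolynomial, map_sub, map_neg, map_sub, map_neg, conjRing_C, conjRing_Y,
      Affine.negPolynomial, map_sub, map_neg]
    change _ = Affine.CoordinateRing.mk W.toAffine Polynomial.X
    ring

lemma conjRing_injective : Function.Injective (conjRing W) :=
  Function.LeftInverse.injective (g := conjRing W) fun r => congrArg (· r) (conjRing_conjRing W)

/-- The automorphism of the function field induced by the inversion of the curve. -/
def conj : W.toAffine.FunctionField →+* W.toAffine.FunctionField :=
  IsFractionRing.lift (A := W.toAffine.CoordinateRing)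
    (g := (algebraMap W.toAffine.CoordinateRing W.toAffine.FunctionField).comp (conjRing W))
    ((IsFractionRing.injective _ _).comp (conjRing_injective W))

lemma conj_algebraMap_coordinateRing (r : W.toAffine.CoordinateRing) :
    conj W (algebraMap _ _ r) = algebraMap _ _ (conjRing W r) :=
  IsFractionRing.lift_algebraMap _ _

lemma conj_polyFun (q : Polynomial K) : conj W (polyFun W q) = polyFun W q :=
  (conj_algebraMap_coordinateRing W _).trans (congrArg _ (conjRing_C W q))

lemma conj_algebraMap (c : K) :
    conj W (algebraMap K _ c) = algebraMap K W.toAffine.FunctionField c := by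
  rw [← polyFun_C, conj_polyFun]

lemma conj_xFun : conj W (xFun W) = xFun W := conj_polyFun W Polynomial.X

lemma conj_yFun : conj W (yFun W) =
    -yFun W - algebraMap K _ W.a₁ * xFun W - algebraMap K _ W.a₃ := by
  have h1 : algebraMap _ W.toAffine.FunctionField (Affine.CoordinateRing.mk W.toAffine
      (Polynomial.C (Polynomial.C W.a₁ * Polynomial.X + Polynomial.C W.a₃))) =
      algebraMap K _ W.a₁ * xFun W + algebraMap K _ W.a₃ := by
    rw [← polyFun_C, ← polyFun_C, ← polyFun_X, ← map_mul, ← map_add]; rfl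
  rw [yFun, conj_algebraMap_coordinateRing, conjRing_Y, Affine.negPolynomial, map_sub, map_sub, h1,
    map_neg, map_neg]
  ring

lemma conj_etaFun : conj W (etaFun W) = -etaFun W := by
  simp only [etaFun, map_add, map_mul, conj_algebraMap, conj_xFun, conj_yFun, map_ofNat]
  ring

lemma conj_conj (g : W.toAffine.FunctionField) : conj W (conj W g) = g := by
  suffices h : (conj W).comp (conj W) = RingHom.id _ from congrArg (· g) h
  apply functionField_hom_ext
  · intro c; simp [conj_algebraMap]
  · simp [conj_xFun]
  · simp only [RingHom.comp_apply, conj_yFun, map_sub, map_neg, map_mul, conj_algebraMap,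
      conj_xFun, RingHom.id_apply]
    ring

open scoped Classical in
-- Inversion sends the generic point to its negative, commutes with multiplication by m, and x is
-- insensitive to sign.
lemma conj_mulX [W.IsElliptic] (m : ℕ) : conj W (mulX W m) = mulX W m := by
  have hV : (overFunctionField W).map (conj W) = overFunctionField W := by
    rw [overFunctionField, WeierstrassCurve.map_map]
    congr 1
    ext1 c
    exact conj_algebraMap W c
  have h1 : mapPoint (conj W) hV (genericPoint W) = -genericPoint W := by
    rw [genericPoint, mapPoint_some, Affine.Point.neg_some, Affine.Point.some.injEq]
    exact ⟨conj_xFun W, by rw [conj_yFun, Affine.negY]; rfl⟩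
  have h3 : mapPoint (conj W) hV (mulGeneric W m) = -mulGeneric W m := by
    rw [mulGeneric, map_nsmul, h1, neg_nsmul]
  rw [mulX]
  cases h : mulGeneric W m with
  | zero => exact map_zero _
  | some x y hxy =>
    rw [h, mapPoint_some, Affine.Point.neg_some, Affine.Point.some.injEq] at h3
    exact h3.1

lemma exists_polyFun_mul_eq_of_conj_eq (h2 : (2 : K) ≠ 0) {g : W.toAffine.FunctionField}
    (hg : conj W g = g) :
    ∃ n p : Polynomial K, n ≠ 0 ∧ polyFun W n * g = polyFun W p := by
  obtain ⟨n, p, q, hn, h⟩ := exists_polyFun_mul_eq W h2 g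
  refine ⟨n, p, hn, ?_⟩
  have h' := congrArg (conj W) h
  simp only [map_add, map_mul, conj_polyFun, conj_etaFun, hg] at h'
  have h2' : (2 : W.toAffine.FunctionField) ≠ 0 := by
    have := (map_ne_zero (algebraMap K W.toAffine.FunctionField)).mpr h2
    rwa [map_ofNat] at this
  apply mul_left_cancel₀ h2'
  linear_combination h + h'

lemma exists_polyFun_mul_eq_of_conj_eq_neg (h2 : (2 : K) ≠ 0) {g : W.toAffine.FunctionField}
    (hg : conj W g = -g) :
    ∃ n q : Polynomial K, n ≠ 0 ∧ polyFun W n * g = polyFun W q * etaFun W := by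
  obtain ⟨n, p, q, hn, h⟩ := exists_polyFun_mul_eq W h2 g
  refine ⟨n, q, hn, ?_⟩
  have h' := congrArg (conj W) h
  simp only [map_add, map_mul, conj_polyFun, conj_etaFun, hg] at h'
  have h2' : (2 : W.toAffine.FunctionField) ≠ 0 := by
    have := (map_ne_zero (algebraMap K W.toAffine.FunctionField)).mpr h2
    rwa [map_ofNat] at this
  apply mul_left_cancel₀ h2'
  linear_combination h - h'

end Conjugation

/-! ### Orders of vanishing at the origin -/

section Order

variable {K : Type*} [Field K]

lemma order_coe_of_constantCoeff {u : K⟦X⟧} (hu : u.constantCoeff ≠ 0) :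
    (u : K⸨X⸩).order = 0 := by
  apply le_antisymm
  · apply HahnSeries.order_le_of_coeff_ne_zero
    rw [← PowerSeries.coeff_zero_eq_constantCoeff_apply] at hu
    convert hu using 1
    exact LaurentSeries.coeff_coe_powerSeries u 0
  · by_contra! h
    have h0 : (u : K⸨X⸩) ≠ 0 := by
      refine (map_ne_zero_iff _ HahnSeries.ofPowerSeries_injective).mpr ?_
      rintro rfl
      simp at hu
    have h1 := HahnSeries.leadingCoeff_ne_zero.mpr h0
    rw [HahnSeries.leadingCoeff_eq] at h1
    apply h1
    rw [PowerSeries.coeff_coe, if_pos h]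

lemma order_single_mul_coe {u : K⟦X⟧} (hu : u.constantCoeff ≠ 0) (n : ℤ) :
    (HahnSeries.single n 1 * (u : K⸨X⸩)).order = n := by
  have h0 : (u : K⸨X⸩) ≠ 0 := by
    refine (map_ne_zero_iff _ HahnSeries.ofPowerSeries_injective).mpr ?_
    rintro rfl
    simp at hu
  rw [HahnSeries.order_mul (HahnSeries.single_ne_zero one_ne_zero) h0,
    HahnSeries.order_single one_ne_zero, order_coe_of_constantCoeff hu, add_zero]

lemma order_coe_nonneg (u : K⟦X⟧) : 0 ≤ (u : K⸨X⸩).order := by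
  by_cases h0 : (u : K⸨X⸩) = 0
  · rw [h0, HahnSeries.order_zero]
  by_contra! h
  have h1 := HahnSeries.leadingCoeff_ne_zero.mpr h0
  rw [HahnSeries.leadingCoeff_eq] at h1
  apply h1
  rw [PowerSeries.coeff_coe, if_pos h]

variable (W : WeierstrassCurve K) (T : FormalParameter K)

lemma order_coe_series : (T.series : K⸨X⸩).order = 1 := by
  obtain ⟨u, hu⟩ := PowerSeries.X_dvd_iff.mpr T.constantCoeff_series
  have h1 : u.constantCoeff ≠ 0 := by
    have := T.isUnit_coeff_one.ne_zero
    rw [hu, ← zero_add 1, PowerSeries.coeff_succ_X_mul] at this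
    simpa using this
  rw [hu, map_mul, PowerSeries.coe_X, order_single_mul_coe h1]

lemma order_eval₂_xExp {q : Polynomial K} (hq : q ≠ 0) :
    (q.eval₂ HahnSeries.C (xExp W T)).order = -2 * q.natDegree := by
  obtain ⟨v, hv1, hx, -⟩ := exists_xExp_yExp_eq W T
  have hT := coe_series_ne_zero T
  -- Horner induction: multiplying by T^(2n) clears the pole of a polynomial of degree n in x, and
  -- the constant coefficient stays nonzero because x·T² has constant coefficient 1.
  have key : ∀ (n : ℕ) (q : Polynomial K), q ≠ 0 → q.natDegree = n → ∃ u : K⟦X⟧,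
      u.constantCoeff ≠ 0 ∧
      q.eval₂ HahnSeries.C (xExp W T) * (T.series : K⸨X⸩) ^ (2 * n) = u := by
    intro n
    induction n with
    | zero =>
      intro q hq hn
      rw [Polynomial.eq_C_of_natDegree_eq_zero hn] at hq ⊢
      refine ⟨PowerSeries.C (q.coeff 0), by simpa using hq, ?_⟩
      rw [Polynomial.eval₂_C, mul_zero, pow_zero, mul_one]
      exact (HahnSeries.ofPowerSeries_C _).symm
    | succ n ih =>
      intro q hq hn
      have hd : q.divX.natDegree = n := by
        rw [Polynomial.natDegree_divX_eq_natDegree_tsub_one, hn]; rfl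
      have hd0 : q.divX ≠ 0 := by
        intro h
        rw [Polynomial.divX_eq_zero_iff] at h
        rw [h, Polynomial.natDegree_C] at hn
        omega
      obtain ⟨u, hu, hqu⟩ := ih _ hd0 hd
      refine ⟨u * v + PowerSeries.C (q.coeff 0) * T.series ^ (2 * (n + 1)), ?_, ?_⟩
      · simpa [T.constantCoeff_series, hv1] using hu
      · conv_lhs => rw [← Polynomial.divX_mul_X_add q]
        rw [Polynomial.eval₂_add, Polynomial.eval₂_mul, Polynomial.eval₂_X, Polynomial.eval₂_C,
          map_add, map_mul, ← hqu, map_mul, map_pow, HahnSeries.ofPowerSeries_C]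
        have : xExp W T * (T.series : K⸨X⸩) ^ 2 = v := by rw [hx]; field_simp
        rw [← this]; ring
  obtain ⟨u, hu, h⟩ := key _ q hq rfl
  have h0 : q.eval₂ HahnSeries.C (xExp W T) ≠ 0 := fun h => hq (eval_xExp_ne_zero W T h)
  have h1 := congrArg HahnSeries.order h
  rw [HahnSeries.order_mul h0 (pow_ne_zero _ hT), HahnSeries.order_pow, order_coe_series,
    order_coe_of_constantCoeff hu] at h1
  simp only [nsmul_eq_mul, Nat.cast_mul, Nat.cast_ofNat, mul_one] at h1
  linarith

lemma order_eta (h2 : (2 : K) ≠ 0) :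
    (2 * yExp W T + HahnSeries.C W.a₁ * xExp W T + HahnSeries.C W.a₃).order = -3 := by
  obtain ⟨v, hv1, hx, hy⟩ := exists_xExp_yExp_eq W T
  have hT := coe_series_ne_zero T
  obtain ⟨d, hd, hη, -⟩ := exists_invariantDifferential W T h2
  have h : (2 * yExp W T + HahnSeries.C W.a₁ * xExp W T + HahnSeries.C W.a₃) *
      (T.series : K⸨X⸩) ^ 3 = ((-2 * v + PowerSeries.C W.a₁ * T.series * v +
        PowerSeries.C W.a₃ * T.series ^ 3 : K⟦X⟧) : K⸨X⸩) := by
    rw [hx, hy]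
    simp only [map_add, map_mul, map_neg, map_pow, HahnSeries.ofPowerSeries_C, map_ofNat]
    field_simp
  have h1 := congrArg HahnSeries.order h
  rw [HahnSeries.order_mul hη (pow_ne_zero _ hT), HahnSeries.order_pow, order_coe_series,
    order_coe_of_constantCoeff (by simpa [T.constantCoeff_series, hv1, map_ofNat] using h2)] at h1
  simp only [nsmul_eq_mul, Nat.cast_ofNat, mul_one] at h1
  linarith

/-- An odd function is a rational function of x, of even order, times 2y + a₁x + a₃, of order -3. -/
lemma odd_order_of_conj_eq_neg (h2 : (2 : K) ≠ 0) {g : W.toAffine.FunctionField} (hg0 : g ≠ 0)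
    (hg : conj W g = -g) : Odd (expand W T g).order := by
  obtain ⟨n, q, hn, h⟩ := exists_polyFun_mul_eq_of_conj_eq_neg W h2 hg
  have hnF : polyFun W n ≠ 0 := (map_ne_zero_iff _ (polyFun_injective W)).mpr hn
  have hq : q ≠ 0 := by
    rintro rfl
    rw [map_zero, zero_mul] at h
    exact mul_ne_zero hnF hg0 h
  have hη : etaFun W ≠ 0 := by
    intro h'
    rw [h', mul_zero] at h
    exact mul_ne_zero hnF hg0 h
  have hqF : polyFun W q ≠ 0 := (map_ne_zero_iff _ (polyFun_injective W)).mpr hq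
  have h1 := congrArg (fun g => (expand W T g).order) h
  simp only [map_mul] at h1
  rw [HahnSeries.order_mul ((map_ne_zero _).mpr hnF) ((map_ne_zero _).mpr hg0),
    HahnSeries.order_mul ((map_ne_zero _).mpr hqF) ((map_ne_zero _).mpr hη),
    expand_polyFun, expand_polyFun, expand_etaFun, order_eval₂_xExp W T hn,
    order_eval₂_xExp W T hq, order_eta W T h2] at h1
  exact ⟨n.natDegree - q.natDegree - 2, by linarith⟩

end Order

/-! ### Integral elements and places of the function field -/

section Integral

variable {R F : Type*} [CommRing R] [Field F]

/-- The integral closure of a subring of a field is the intersection of the valuation rings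
containing it. -/
lemma mem_integralClosure_iff_forall_valuationSubring (φ : R →+* F) (g : F) :
    g ∈ integralClosure φ.range F ↔
      ∀ A : ValuationSubring F, (∀ r, φ r ∈ A) → g ∈ A := by
  have h := iInf_valuationSubring_superset (K := F) (s := (φ.range : Set F))
  rw [Subring.closure_eq] at h
  have h1 := SetLike.ext_iff.mp h g
  rw [Subring.mem_iInf] at h1
  refine Iff.trans (Iff.trans Iff.rfl h1.symm) ?_
  constructor
  · intro h' A hA
    exact h' ⟨A, by rintro _ ⟨r, rfl⟩; exact hA r⟩
  · rintro h' ⟨A, hA⟩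
    exact h' A fun r => hA ⟨r, rfl⟩

lemma isIntegralElem_of_forall_valuationSubring (φ : R →+* F) {g : F}
    (h : ∀ A : ValuationSubring F, (∀ r, φ r ∈ A) → g ∈ A) : φ.IsIntegralElem g := by
  obtain ⟨q, hq, hqg⟩ := (mem_integralClosure_iff_forall_valuationSubring φ g).mpr h
  have hl : q ∈ Polynomial.lifts φ.rangeRestrict := by
    rw [Polynomial.mem_lifts]
    exact Polynomial.map_surjective _ φ.rangeRestrict_surjective q
  obtain ⟨r, hr, -, hrm⟩ := Polynomial.lifts_and_natDegree_eq_and_monic hl hq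
  refine ⟨r, hrm, ?_⟩
  rw [← hr, Polynomial.eval₂_map] at hqg
  exact hqg

/-- An element that lies in all places over a field has its inverse in all of them. -/
lemma inv_mem_of_forall_valuationSubring {K : Type*} [Field K] (φ : K →+* F) {g : F}
    (h : ∀ A : ValuationSubring F, (∀ r, φ r ∈ A) → g ∈ A) (A : ValuationSubring F)
    (hA : ∀ r, φ r ∈ A) : g⁻¹ ∈ A := by
  let _ := φ.toAlgebra
  have h1 : IsIntegral K g := isIntegralElem_of_forall_valuationSubring φ h
  obtain ⟨q, hq, hqg⟩ := h1.inv
  refine (mem_integralClosure_iff_forall_valuationSubring φ g⁻¹).mp ?_ A hA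
  refine ⟨q.map φ.rangeRestrict, hq.map _, ?_⟩
  rw [Polynomial.eval₂_map]
  exact hqg

end Integral

section Places

variable {K : Type*} [Field K] (W : WeierstrassCurve K) (T : FormalParameter K)

/-- A rational function of x that is integral over K[x] lies in K[x], which is integrally closed. -/
lemma exists_eq_polyFun {g : W.toAffine.FunctionField} {n p : Polynomial K} (hn : n ≠ 0)
    (h : polyFun W n * g = polyFun W p) (hg : (polyFun W).IsIntegralElem g) :
    ∃ P, g = polyFun W P := by
  set φ : FractionRing (Polynomial K) →+* W.toAffine.FunctionField :=
    IsFractionRing.lift (polyFun_injective W) with hφ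
  have hφa : ∀ r, φ (algebraMap _ _ r) = polyFun W r := fun r => IsFractionRing.lift_algebraMap _ _
  have hnF : polyFun W n ≠ 0 := (map_ne_zero_iff _ (polyFun_injective W)).mpr hn
  have hgφ : g = φ (algebraMap _ _ p / algebraMap _ _ n) := by
    rw [map_div₀, hφa, hφa, ← h]; field_simp
  obtain ⟨r, hr, hrg⟩ := hg
  have hi : IsIntegral (Polynomial K) (algebraMap _ (FractionRing (Polynomial K)) p /
      algebraMap _ _ n) := by
    refine ⟨r, hr, ?_⟩
    apply φ.injective
    rw [Polynomial.hom_eval₂, map_zero, ← hgφ, ← hrg]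
    congr 1
    exact RingHom.ext hφa
  obtain ⟨P, hP⟩ := IsIntegrallyClosed.isIntegral_iff.mp hi
  exact ⟨P, by rw [hgφ, ← hP, hφa]⟩

/-- The place of the function field at the origin. -/
def originPlace : ValuationSubring W.toAffine.FunctionField :=
  (Valuation.valuationSubring (Valued.v : Valuation K⸨X⸩ _)).comap (expand W T)

lemma mem_originPlace {g : W.toAffine.FunctionField} :
    g ∈ originPlace W T ↔ ∃ u : K⟦X⟧, (u : K⸨X⸩) = expand W T g :=
  LaurentSeries.val_le_one_iff_eq_coe K _

lemma algebraMap_mem_originPlace (c : K) :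
    algebraMap K W.toAffine.FunctionField c ∈ originPlace W T :=
  (mem_originPlace W T).mpr ⟨PowerSeries.C c, by
    rw [expand_algebraMap]; exact HahnSeries.ofPowerSeries_C c⟩

lemma order_nonneg_of_mem_originPlace {g : W.toAffine.FunctionField} (h : g ∈ originPlace W T) :
    0 ≤ (expand W T g).order := by
  obtain ⟨u, hu⟩ := (mem_originPlace W T).mp h
  rw [← hu]
  exact order_coe_nonneg u

lemma order_eq_zero_of_mem_originPlace {g : W.toAffine.FunctionField} (h : g ∈ originPlace W T)
    (h' : g⁻¹ ∈ originPlace W T) : (expand W T g).order = 0 := by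
  by_cases hg : g = 0
  · rw [hg, map_zero, HahnSeries.order_zero]
  have h1 := order_nonneg_of_mem_originPlace W T h
  have h2 := order_nonneg_of_mem_originPlace W T h'
  have h3 := HahnSeries.order_mul ((map_ne_zero (expand W T)).mpr hg)
    ((map_ne_zero (expand W T)).mpr (inv_ne_zero hg))
  rw [← map_mul, mul_inv_cancel₀ hg, map_one, HahnSeries.order_one] at h3
  linarith

/-- The valuation of the place at the origin lives in an abstract value group; equality of values is
turned into equality of orders by noting that a/b and b/a both expand to power series. -/
lemma order_eq_of_valuation_eq {a b : W.toAffine.FunctionField} (hb : b ≠ 0)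
    (h : (originPlace W T).valuation a = (originPlace W T).valuation b) :
    (expand W T a).order = (expand W T b).order := by
  have hvb : (originPlace W T).valuation b ≠ 0 := (Valuation.ne_zero_iff _).mpr hb
  have hva : (originPlace W T).valuation a ≠ 0 := h ▸ hvb
  have ha : a ≠ 0 := (Valuation.ne_zero_iff _).mp hva
  have h1 := order_eq_zero_of_mem_originPlace W T (g := a / b)
    (by rw [← ValuationSubring.valuation_le_one_iff, map_div₀, h, div_self hvb])
    (by rw [inv_div, ← ValuationSubring.valuation_le_one_iff, map_div₀, h, div_self hvb])
  have h3 := HahnSeries.order_mul ((map_ne_zero (expand W T)).mpr (div_ne_zero ha hb))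
    ((map_ne_zero (expand W T)).mpr hb)
  rw [← map_mul, div_mul_cancel₀ _ hb, h1, zero_add] at h3
  exact h3

open scoped Classical in
-- Realizes the maximum as the value of an actual function, so that divisor conditions can be
-- transported along inversion.
lemma valuation_ite_eq_max {F : Type*} [Field F] (A : ValuationSubring F) (g : F) :
    A.valuation (if g ∈ A then 1 else g) = max 1 (A.valuation g) := by
  split_ifs with h
  · rw [map_one, max_eq_left ((A.valuation_le_one_iff g).mpr h)]
  · rw [max_eq_right]
    rw [← A.valuation_le_one_iff, not_le] at h
    exact h.le

variable {W} {X f : W.toAffine.FunctionField} {m : ℕ}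

lemma ne_zero_of_divisor
    (hdiv : ∀ A : ValuationSubring W.toAffine.FunctionField,
      (∀ c : K, algebraMap K W.toAffine.FunctionField c ∈ A) →
      A.valuation f ^ 2 * max 1 (A.valuation X) = max 1 (A.valuation (xFun W)) ^ m) : f ≠ 0 := by
  rintro rfl
  -- The divisor condition also covers the trivial valuation ring, where f = 0 would make the left
  -- side 0 and the right side at least 1.
  have h := hdiv ⊤ fun c => trivial
  rw [map_zero, zero_pow two_ne_zero, zero_mul] at h
  exact (zero_lt_one.trans_le (one_le_pow₀ (le_max_left _ _))).ne h

open scoped Classical in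
/-- A function whose divisor is determined by even functions is even up to a function without
zeros and poles. -/
lemma valuation_conj_eq (hX : conj W X = X)
    (hdiv : ∀ A : ValuationSubring W.toAffine.FunctionField,
      (∀ c : K, algebraMap K W.toAffine.FunctionField c ∈ A) →
      A.valuation f ^ 2 * max 1 (A.valuation X) = max 1 (A.valuation (xFun W)) ^ m)
    (A : ValuationSubring W.toAffine.FunctionField)
    (hA : ∀ c : K, algebraMap K W.toAffine.FunctionField c ∈ A) :
    A.valuation (conj W f) = A.valuation f := by
  have hA' : ∀ c : K, algebraMap K W.toAffine.FunctionField c ∈ A.comap (conj W) := fun c => by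
    rw [ValuationSubring.mem_comap, conj_algebraMap]; exact hA c
  have h1 := hdiv A hA
  -- The condition at the place conjugate to A, read back at A, concerns `conj W f`; x and X are
  -- unchanged by inversion.
  have h2 := hdiv (A.comap (conj W)) hA'
  rw [← valuation_ite_eq_max, ← valuation_ite_eq_max] at h1 h2
  simp only [ValuationSubring.mem_comap, conj_xFun, hX] at h2
  set s := if X ∈ A then 1 else X with hs
  set r := if xFun W ∈ A then 1 else xFun W with hr
  have hs' : conj W s = s := by rw [hs]; split_ifs <;> simp [hX]
  have hr' : conj W r = r := by rw [hr]; split_ifs <;> simp [conj_xFun]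
  rw [← map_pow, ← map_mul, ← map_pow] at h1 h2
  have hr0 : r ≠ 0 := by
    intro h
    have := valuation_ite_eq_max A (xFun W)
    rw [← hr, h, map_zero] at this
    exact (zero_lt_one.trans_le (le_max_left _ _)).ne this
  have hg0 : r ^ m ≠ 0 := pow_ne_zero _ hr0
  have hv : ∀ B : ValuationSubring W.toAffine.FunctionField, B.valuation (r ^ m) ≠ 0 :=
    fun B => (Valuation.ne_zero_iff _).mpr hg0
  have h3 : f ^ 2 * s / r ^ m ∈ A.comap (conj W) := by
    rw [← ValuationSubring.valuation_le_one_iff, map_div₀, h2, div_self (hv _)]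
  have h4 : r ^ m / (f ^ 2 * s) ∈ A.comap (conj W) := by
    rw [← ValuationSubring.valuation_le_one_iff, map_div₀, h2, div_self (hv _)]
  rw [ValuationSubring.mem_comap, map_div₀, map_mul, map_pow, map_pow, hs', hr',
    ← ValuationSubring.valuation_le_one_iff, map_div₀] at h3 h4
  have h5 : A.valuation (conj W f ^ 2 * s) ≠ 0 := by
    intro h
    rw [Valuation.zero_iff, mul_eq_zero] at h
    rcases h with h | h
    · have hf0 := (map_eq_zero (conj W)).mp (pow_eq_zero_iff two_ne_zero |>.mp h)
      rw [hf0, zero_pow two_ne_zero, zero_mul, map_zero] at h1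
      exact hv A h1.symm
    · rw [h, mul_zero, map_zero] at h1
      exact hv A h1.symm
  have h6 : A.valuation (conj W f ^ 2 * s) = A.valuation (r ^ m) := by
    apply le_antisymm
    · exact (div_le_one₀ (zero_lt_iff.mpr (hv A))).mp h3
    · exact (div_le_one₀ (zero_lt_iff.mpr h5)).mp h4
  rw [← h1, map_mul, map_mul, map_pow, map_pow] at h6
  have hs0 : A.valuation s ≠ 0 := fun h => h5 (by rw [map_mul, h, mul_zero])
  exact (pow_left_inj₀ zero_le zero_le two_ne_zero).mp (mul_right_cancel₀ hs0 h6)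

/-- The quotient of f by its conjugate has neither zeros nor poles. Its antisymmetrization d is odd
and regular everywhere; if nonzero it would have order 0 at the origin, against oddness. So f is
even or odd, and the order decides. -/
lemma conj_eq_of_even_order (h2 : (2 : K) ≠ 0) (hX : conj W X = X)
    (hdiv : ∀ A : ValuationSubring W.toAffine.FunctionField,
      (∀ c : K, algebraMap K W.toAffine.FunctionField c ∈ A) →
      A.valuation f ^ 2 * max 1 (A.valuation X) = max 1 (A.valuation (xFun W)) ^ m)
    (heven : Even (expand W T f).order) : conj W f = f := by
  have hf0 := ne_zero_of_divisor hdiv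
  have hc0 : conj W f ≠ 0 := (map_ne_zero _).mpr hf0
  set d := f / conj W f - conj W f / f with hd
  have hdA : ∀ A : ValuationSubring W.toAffine.FunctionField,
      (∀ c : K, algebraMap K W.toAffine.FunctionField c ∈ A) → d ∈ A := by
    intro A hA
    have h := valuation_conj_eq hX hdiv A hA
    have hv : A.valuation f ≠ 0 := (Valuation.ne_zero_iff _).mpr hf0
    apply sub_mem <;>
      rw [← ValuationSubring.valuation_le_one_iff, map_div₀, h, div_self hv]
  have hdc : conj W d = -d := by
    rw [hd, map_sub, map_div₀, map_div₀, conj_conj]; ring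
  have hd0 : d = 0 := by
    by_contra hd0
    have h3 := odd_order_of_conj_eq_neg W T h2 hd0 hdc
    rw [order_eq_zero_of_mem_originPlace W T (hdA _ (algebraMap_mem_originPlace W T))
      (inv_mem_of_forall_valuationSubring _ hdA _ (algebraMap_mem_originPlace W T))] at h3
    exact (by decide : ¬ Odd (0 : ℤ)) h3
  have h3 : (conj W f - f) * (conj W f + f) = 0 := by
    rw [hd, sub_eq_zero, div_eq_div_iff hc0 hf0] at hd0
    linear_combination -hd0
  rcases mul_eq_zero.mp h3 with h | h
  · exact sub_eq_zero.mp h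
  · have h4 := odd_order_of_conj_eq_neg W T h2 hf0 (eq_neg_of_add_eq_zero_left h)
    exact absurd heven (Int.not_even_iff_odd.mpr h4)

/-- A function of even order at the origin whose divisor is that of a division polynomial is a
polynomial in `x`. -/
theorem exists_polyFun_of_divisor (h2 : (2 : K) ≠ 0) (hX : conj W X = X)
    (hdiv : ∀ A : ValuationSubring W.toAffine.FunctionField,
      (∀ c : K, algebraMap K W.toAffine.FunctionField c ∈ A) →
      A.valuation f ^ 2 * max 1 (A.valuation X) = max 1 (A.valuation (xFun W)) ^ m)
    (heven : Even (expand W T f).order) :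
    ∃ P Q : Polynomial K, f = polyFun W P ∧ f ^ 2 * X = polyFun W Q ∧ IsCoprime (P ^ 2) Q := by
  have hfc := conj_eq_of_even_order T h2 hX hdiv heven
  -- At a place where x is finite the divisor condition says that f² and f²X have no pole and are
  -- not both zero; this gives integrality over K[x] and then coprimality.
  have hpl : ∀ A : ValuationSubring W.toAffine.FunctionField, (∀ r, polyFun W r ∈ A) →
      max (A.valuation (f ^ 2)) (A.valuation (f ^ 2 * X)) = 1 := by
    intro A hA
    have h := hdiv A fun c => by rw [← polyFun_C]; exact hA _
    have hx : A.valuation (xFun W) ≤ 1 := (A.valuation_le_one_iff _).mpr (hA Polynomial.X)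
    rw [max_eq_left hx, one_pow] at h
    rw [← h, mul_max, mul_one, map_mul, map_pow]
  have hf : (polyFun W).IsIntegralElem f := by
    refine isIntegralElem_of_forall_valuationSubring _ fun A hA => ?_
    rw [← A.valuation_le_one_iff, ← pow_le_one_iff_of_nonneg zero_le two_ne_zero, ← map_pow,
      ← hpl A hA]
    exact le_max_left _ _
  have hfX : (polyFun W).IsIntegralElem (f ^ 2 * X) := by
    refine isIntegralElem_of_forall_valuationSubring _ fun A hA => ?_
    rw [← A.valuation_le_one_iff, ← hpl A hA]
    exact le_max_right _ _
  obtain ⟨n₁, p₁, hn₁, e₁⟩ := exists_polyFun_mul_eq_of_conj_eq W h2 hfc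
  obtain ⟨n₂, p₂, hn₂, e₂⟩ := exists_polyFun_mul_eq_of_conj_eq W h2 (g := f ^ 2 * X)
    (by rw [map_mul, map_pow, hfc, hX])
  obtain ⟨P, hP⟩ := exists_eq_polyFun W hn₁ e₁ hf
  obtain ⟨Q, hQ⟩ := exists_eq_polyFun W hn₂ e₂ hfX
  refine ⟨P, Q, hP, hQ, ?_⟩
  by_contra hPQ
  set a : (polyFun W).range := ⟨polyFun W (P ^ 2), _, rfl⟩ with ha
  set b : (polyFun W).range := ⟨polyFun W Q, _, rfl⟩ with hb
  -- If P² and Q were not coprime they would generate a proper ideal of K[x], dominated by some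
  -- valuation ring, where both would have value less than 1.
  have hI : Ideal.span {a, b} ≠ ⊤ := by
    intro h
    rw [Ideal.eq_top_iff_one, Ideal.mem_span_pair] at h
    obtain ⟨⟨_, u, rfl⟩, ⟨_, v, rfl⟩, h⟩ := h
    apply hPQ
    refine ⟨u, v, polyFun_injective W ?_⟩
    rw [map_add, map_mul, map_mul, map_one]
    exact congrArg Subtype.val h
  obtain ⟨A, hA, hIA⟩ := Ideal.image_subset_nonunits_valuationSubring _ hI
  have h := hpl A fun r => hA ⟨r, rfl⟩
  have h3 : A.valuation (f ^ 2) < 1 := by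
    rw [← ValuationSubring.mem_nonunits_iff, hP, ← map_pow]
    exact hIA ⟨a, Ideal.subset_span (by simp), rfl⟩
  have h4 : A.valuation (f ^ 2 * X) < 1 := by
    rw [← ValuationSubring.mem_nonunits_iff, hQ]
    exact hIA ⟨b, Ideal.subset_span (by simp), rfl⟩
  exact (max_lt h3 h4).ne h

end Places

/-! ### Unit expansions, bounded denominators and Gauss's lemma -/

section UnitExpansion

variable (O : Type*) {K : Type*} [CommRing O] [Field K] [Algebra O K]

/-- A Laurent series that is `z ^ n` times a unit of the ring of integral power series. -/
def HasUnitExpansion (g : K⸨X⸩) (n : ℤ) : Prop :=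
  ∃ u : O⟦X⟧, IsUnit u ∧ g = HahnSeries.single n 1 * integralToLaurent O K u

variable {O}

lemma HasUnitExpansion.mul {g h : K⸨X⸩} {m n : ℤ} (hg : HasUnitExpansion O g m)
    (hh : HasUnitExpansion O h n) : HasUnitExpansion O (g * h) (m + n) := by
  obtain ⟨u, hu, rfl⟩ := hg
  obtain ⟨v, hv, rfl⟩ := hh
  refine ⟨u * v, hu.mul hv, ?_⟩
  rw [map_mul, mul_mul_mul_comm, HahnSeries.single_mul_single, one_mul]

lemma HasUnitExpansion.inv {g : K⸨X⸩} {n : ℤ} (hg : HasUnitExpansion O g n) :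
    HasUnitExpansion O g⁻¹ (-n) := by
  obtain ⟨_, ⟨u, rfl⟩, rfl⟩ := hg
  refine ⟨_, u⁻¹.isUnit, inv_eq_of_mul_eq_one_right ?_⟩
  rw [mul_mul_mul_comm, HahnSeries.single_mul_single, one_mul, add_neg_cancel, ← map_mul,
    Units.mul_inv, RingHom.map_one, mul_one]
  rfl

lemma HasUnitExpansion.pow {g : K⸨X⸩} {n : ℤ} (hg : HasUnitExpansion O g n) (k : ℕ) :
    HasUnitExpansion O (g ^ k) (k * n) := by
  induction k with
  | zero => exact ⟨1, isUnit_one, by simp⟩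
  | succ k ih =>
    rw [pow_succ]
    convert ih.mul hg using 1
    push_cast
    ring

lemma HasUnitExpansion.div {g h : K⸨X⸩} {m n : ℤ} (hg : HasUnitExpansion O g m)
    (hh : HasUnitExpansion O h n) : HasUnitExpansion O (g / h) (m - n) := by
  rw [div_eq_mul_inv, sub_eq_add_neg]
  exact hg.mul hh.inv

lemma HasUnitExpansion.order_eq {g : K⸨X⸩} {n : ℤ} (hg : HasUnitExpansion O g n) :
    g.order = n := by
  obtain ⟨u, hu, rfl⟩ := hg
  apply order_single_mul_coe
  rw [← PowerSeries.coeff_zero_eq_constantCoeff_apply, PowerSeries.coeff_map,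
    PowerSeries.coeff_zero_eq_constantCoeff_apply]
  exact ((PowerSeries.isUnit_iff_constantCoeff.mp hu).map (algebraMap O K)).ne_zero

lemma HasUnitExpansion.ne_zero {g : K⸨X⸩} {n : ℤ} (hg : HasUnitExpansion O g n) : g ≠ 0 := by
  obtain ⟨u, hu, rfl⟩ := hg
  exact mul_ne_zero (HahnSeries.single_ne_zero one_ne_zero) (hu.map _).ne_zero

lemma integralToLaurent_X : integralToLaurent O K PowerSeries.X = HahnSeries.single 1 1 := by
  rw [integralToLaurent_apply, PowerSeries.map_X]
  exact PowerSeries.coe_X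

lemma integralToLaurent_C (a : O) :
    integralToLaurent O K (PowerSeries.C a) = HahnSeries.C (algebraMap O K a) := by
  rw [integralToLaurent_apply, PowerSeries.map_C]
  exact HahnSeries.ofPowerSeries_C _

lemma single_one_pow (n : ℕ) :
    (HahnSeries.single 1 1 : K⸨X⸩) ^ n = HahnSeries.single (n : ℤ) 1 := by
  rw [HahnSeries.single_pow, one_pow, nsmul_eq_mul, mul_one]

lemma hasUnitExpansion_X_pow_mul {u : O⟦X⟧} (hu : IsUnit u) (n : ℕ) :
    HasUnitExpansion O (integralToLaurent O K (PowerSeries.X ^ n * u)) n :=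
  ⟨u, hu, by rw [map_mul, map_pow, integralToLaurent_X, single_one_pow]⟩

lemma exists_isUnit_X_mul {t : O⟦X⟧} (h0 : t.constantCoeff = 0) (h1 : IsUnit (t.coeff 1)) :
    ∃ u, IsUnit u ∧ t = PowerSeries.X * u := by
  obtain ⟨u, rfl⟩ := PowerSeries.X_dvd_iff.mpr h0
  refine ⟨u, ?_, rfl⟩
  rw [← zero_add 1, PowerSeries.coeff_succ_X_mul] at h1
  exact PowerSeries.isUnit_iff_constantCoeff.mpr (by simpa using h1)

lemma hasUnitExpansion_X_mul {t : O⟦X⟧} (h0 : t.constantCoeff = 0) (h1 : IsUnit (t.coeff 1)) :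
    HasUnitExpansion O (integralToLaurent O K t) 1 := by
  obtain ⟨u, hu, rfl⟩ := exists_isUnit_X_mul h0 h1
  simpa using hasUnitExpansion_X_pow_mul (K := K) hu 1

end UnitExpansion

section BoundedDenominators

variable (O K : Type*) [CommRing O] [IsDomain O] [Field K] [Algebra O K]

/-- Laurent series with bounded denominators. -/
def boundedDenominators : Subring K⸨X⸩ where
  carrier := {g | ∃ (d : O) (n : ℕ) (G : O⟦X⟧), d ≠ 0 ∧
    integralToLaurent O K (PowerSeries.C d * PowerSeries.X ^ n) * g = integralToLaurent O K G}
  mul_mem' := by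
    rintro g h ⟨d, n, G, hd, hG⟩ ⟨e, m, H, he, hH⟩
    refine ⟨d * e, n + m, G * H, mul_ne_zero hd he, ?_⟩
    rw [map_mul _ G, ← hG, ← hH, pow_add, map_mul PowerSeries.C, mul_mul_mul_comm, map_mul]
    ring
  one_mem' := ⟨1, 0, 1, one_ne_zero, by simp⟩
  add_mem' := by
    rintro g h ⟨d, n, G, hd, hG⟩ ⟨e, m, H, he, hH⟩
    refine ⟨d * e, n + m, PowerSeries.C e * PowerSeries.X ^ m * G +
      PowerSeries.C d * PowerSeries.X ^ n * H, mul_ne_zero hd he, ?_⟩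
    rw [map_add, map_mul _ _ G, ← hG, map_mul _ _ H, ← hH, pow_add, map_mul PowerSeries.C,
      mul_mul_mul_comm, map_mul]
    ring
  zero_mem' := ⟨1, 0, 0, one_ne_zero, by simp⟩
  neg_mem' := by
    rintro g ⟨d, n, G, hd, hG⟩
    exact ⟨d, n, -G, hd, by rw [mul_neg, hG, map_neg]⟩

variable {O K}

lemma C_mem_boundedDenominators [IsFractionRing O K] (c : K) :
    HahnSeries.C c ∈ boundedDenominators O K := by
  obtain ⟨a, d, hd, rfl⟩ := IsFractionRing.div_surjective (A := O) c
  refine ⟨d, 0, PowerSeries.C a, nonZeroDivisors.ne_zero hd, ?_⟩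
  rw [pow_zero, mul_one, integralToLaurent_C, integralToLaurent_C, ← map_mul]
  congr 1
  have : algebraMap O K d ≠ 0 :=
    (map_ne_zero_iff _ (IsFractionRing.injective O K)).mpr (nonZeroDivisors.ne_zero hd)
  field_simp

lemma HasUnitExpansion.mem_boundedDenominators {g : K⸨X⸩} {n : ℤ}
    (hg : HasUnitExpansion O g n) : g ∈ boundedDenominators O K := by
  obtain ⟨u, -, rfl⟩ := hg
  refine ⟨1, n.natAbs, PowerSeries.X ^ (n.natAbs + n).toNat * u, one_ne_zero, ?_⟩
  rw [map_one, one_mul, map_pow, map_mul, map_pow, integralToLaurent_X, single_one_pow,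
    single_one_pow, ← mul_assoc, HahnSeries.single_mul_single, one_mul,
    Int.toNat_of_nonneg (by omega)]

end BoundedDenominators

section DVR

variable {O : Type*} [CommRing O] [IsDomain O]

/-- X is prime in O[[X]], so its powers can be distributed between the two factors one at a time. -/
lemma exists_eq_of_mul_eq_X_pow {F G H : O⟦X⟧} {n : ℕ} (h : F * G = PowerSeries.X ^ n * H) :
    ∃ (i : ℕ) (F' G' : O⟦X⟧), F = PowerSeries.X ^ i * F' ∧ F' * G' = H := by
  induction n generalizing F G with
  | zero => exact ⟨0, F, G, by simp, by simpa using h⟩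
  | succ n ih =>
    rcases (PowerSeries.X_prime (R := O)).dvd_or_dvd (a := F) (b := G)
      ⟨PowerSeries.X ^ n * H, by rw [h, pow_succ']; ring⟩ with ⟨F₁, rfl⟩ | ⟨G₁, rfl⟩
    · obtain ⟨i, F', G', rfl, hFG⟩ := ih (F := F₁) (G := G)
        (mul_left_cancel₀ PowerSeries.X_ne_zero (by rw [← mul_assoc, h, pow_succ', mul_assoc]))
      exact ⟨i + 1, F', G', by ring, hFG⟩
    · exact ih (F := F) (G := G₁)
        (mul_left_cancel₀ PowerSeries.X_ne_zero (by rw [mul_left_comm, h, pow_succ', mul_assoc]))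

lemma C_dvd_of_forall_dvd {R : Type*} [CommRing R] {ϖ : R} {F : R⟦X⟧} (h : ∀ n, ϖ ∣ F.coeff n) : PowerSeries.C ϖ ∣ F := by
  choose c hc using h
  exact ⟨PowerSeries.mk c, by ext n; rw [PowerSeries.coeff_C_mul, PowerSeries.coeff_mk, hc]⟩

/-- Reduction modulo ϖ lands in power series over the residue field, which form a domain. -/
lemma prime_C [IsDiscreteValuationRing O] {ϖ : O} (h : Irreducible ϖ) {F G : O⟦X⟧}
    (hd : PowerSeries.C ϖ ∣ F * G) : PowerSeries.C ϖ ∣ F ∨ PowerSeries.C ϖ ∣ G := by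
  have hker : ∀ a : O, IsLocalRing.residue O a = 0 ↔ ϖ ∣ a := fun a => by
    rw [IsLocalRing.residue_eq_zero_iff, h.maximalIdeal_eq, Ideal.mem_span_singleton]
  have hz : ∀ F : O⟦X⟧, F.map (IsLocalRing.residue O) = 0 → PowerSeries.C ϖ ∣ F := fun F hF =>
    C_dvd_of_forall_dvd fun n => by rw [← hker, ← PowerSeries.coeff_map, hF, map_zero]
  have h0 : F.map (IsLocalRing.residue O) * G.map (IsLocalRing.residue O) = 0 := by
    obtain ⟨H, hH⟩ := hd
    rw [← map_mul, hH, map_mul, PowerSeries.map_C, (hker ϖ).mpr dvd_rfl, map_zero, zero_mul]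
  exact (mul_eq_zero.mp h0).imp (hz F) (hz G)

lemma exists_eq_of_mul_eq_C_pow [IsDiscreteValuationRing O] {ϖ : O} (hϖ : Irreducible ϖ)
    {F G U : O⟦X⟧} (hU : IsUnit U) {k : ℕ} (h : F * G = PowerSeries.C ϖ ^ k * U) :
    ∃ (j : ℕ) (V : O⟦X⟧), IsUnit V ∧ F = PowerSeries.C (ϖ ^ j) * V := by
  have hC : PowerSeries.C ϖ ≠ 0 :=
    (map_ne_zero_iff _ PowerSeries.C_injective).mpr hϖ.ne_zero
  induction k generalizing F G with
  | zero =>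
    refine ⟨0, F, ?_, by simp⟩
    rw [pow_zero, one_mul] at h
    exact isUnit_of_mul_isUnit_left (h ▸ hU)
  | succ k ih =>
    rcases prime_C hϖ (F := F) (G := G) ⟨PowerSeries.C ϖ ^ k * U, by rw [h, pow_succ']; ring⟩ with
      ⟨F₁, rfl⟩ | ⟨G₁, rfl⟩
    · obtain ⟨j, V, hV, rfl⟩ := ih (F := F₁) (G := G)
        (mul_left_cancel₀ hC (by rw [← mul_assoc, h, pow_succ', mul_assoc]))
      exact ⟨j + 1, V, hV, by rw [pow_succ', map_mul]; ring⟩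
    · exact ih (F := F) (G := G₁)
        (mul_left_cancel₀ hC (by rw [mul_left_comm, h, pow_succ', mul_assoc]))

/-- Gauss's lemma: if a Laurent series and its inverse have bounded denominators, then up to a
constant the series is a power of `z` times a unit. -/
lemma exists_hasUnitExpansion [IsDiscreteValuationRing O] {K : Type*} [Field K] [Algebra O K]
    [FaithfulSMul O K] {g h : K⸨X⸩} (hg : g ∈ boundedDenominators O K)
    (hh : h ∈ boundedDenominators O K) (hgh : g * h = 1) :
    ∃ (c : K) (g' : K⸨X⸩) (n : ℤ), g = HahnSeries.C c * g' ∧ HasUnitExpansion O g' n := by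
  obtain ⟨d, n, F, hd, hF⟩ := hg
  obtain ⟨e, m, G, he, hG⟩ := hh
  obtain ⟨ϖ, hϖ⟩ := IsDiscreteValuationRing.exists_irreducible O
  obtain ⟨k, u, hu⟩ := IsDiscreteValuationRing.eq_unit_mul_pow_irreducible (mul_ne_zero hd he) hϖ
  -- The product of the numerators is the product of the denominators, that is a unit times a power
  -- of ϖ times a power of X; both primes are then divided out of F.
  have hFG : F * G = PowerSeries.X ^ (n + m) * (PowerSeries.C ϖ ^ k * PowerSeries.C (u : O)) := by
    apply integralToLaurent_injective (K := K)
    rw [map_mul, ← hF, ← hG, mul_mul_mul_comm, hgh, mul_one, ← map_mul]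
    congr 1
    rw [mul_mul_mul_comm, ← map_mul, hu, map_mul, map_pow]
    ring
  obtain ⟨i, F', G', rfl, h'⟩ := exists_eq_of_mul_eq_X_pow hFG
  obtain ⟨j, V, hV, rfl⟩ := exists_eq_of_mul_eq_C_pow hϖ (u.isUnit.map PowerSeries.C) h'
  have hd' : algebraMap O K d ≠ 0 :=
    (map_ne_zero_iff _ (FaithfulSMul.algebraMap_injective O K)).mpr hd
  have hX : (HahnSeries.single (n : ℤ) 1 : K⸨X⸩) ≠ 0 := HahnSeries.single_ne_zero one_ne_zero
  refine ⟨algebraMap O K (ϖ ^ j) / algebraMap O K d,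
    integralToLaurent O K (PowerSeries.X ^ i * V) / integralToLaurent O K (PowerSeries.X ^ n * 1),
    i - n, ?_,
    (hasUnitExpansion_X_pow_mul hV i).div (hasUnitExpansion_X_pow_mul isUnit_one n)⟩
  simp only [map_mul, map_pow, integralToLaurent_C, integralToLaurent_X, single_one_pow,
    map_div₀, mul_one] at hF ⊢
  have hCd : HahnSeries.C (algebraMap O K d) ≠ (0 : K⸨X⸩) := by simpa using hd'
  field_simp
  linear_combination hF

end DVR

/-! ### Expansions of x and x∘[p], and vanishing derivatives -/

section SubstExpansion

variable {O K : Type*} [CommRing O] [Field K] [Algebra O K]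

lemma HasUnitExpansion.zpow {g : K⸨X⸩} {n : ℤ} (hg : HasUnitExpansion O g n) (k : ℤ) :
    HasUnitExpansion O (g ^ k) (k * n) := by
  obtain ⟨k, rfl | rfl⟩ := k.eq_nat_or_neg
  · rw [zpow_natCast]; exact hg.pow k
  · rw [zpow_neg, zpow_natCast, neg_mul]; exact (hg.pow k).inv

lemma HasUnitExpansion.laurentSubstHom {s : O⟦X⟧} (h0 : s.constantCoeff = 0)
    (h0' : (PowerSeries.map (algebraMap O K) s).constantCoeff = 0)
    (hs' : PowerSeries.map (algebraMap O K) s ≠ 0) {m : ℤ}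
    (hs : HasUnitExpansion O (integralToLaurent O K s) m) {g : K⸨X⸩} {n : ℤ}
    (hg : HasUnitExpansion O g n) :
    HasUnitExpansion O (MazurTate.laurentSubstHom (RingHom.id K) h0' hs' g) (n * m) := by
  obtain ⟨u, hu, rfl⟩ := hg
  rw [map_mul, laurentSubstHom_single, integralToLaurent_apply, laurentSubstHom_coe,
    PowerSeries.map_id, id, ← powerSeries_map_subst _ h0, ← integralToLaurent_apply,
    ← add_zero (n * m)]
  refine (hs.zpow n).mul ⟨_, ?_, (one_mul _).symm⟩
  rw [PowerSeries.isUnit_iff_constantCoeff, constantCoeff_subst_of_zero h0]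
  exact PowerSeries.isUnit_iff_constantCoeff.mp hu

lemma exists_subst_X_pow_eq {m : O⟦X⟧} (h0 : m.constantCoeff = 0) (h1 : IsUnit (m.coeff 1)) {p : ℕ}
    (hp : p ≠ 0) : ∃ e : O⟦X⟧, IsUnit e ∧ e.constantCoeff = m.coeff 1 ∧
      m.subst (PowerSeries.X ^ p : O⟦X⟧) = PowerSeries.X ^ p * e := by
  have hX0 : (PowerSeries.X ^ p : O⟦X⟧).constantCoeff = 0 := by simp [hp]
  have hXp := PowerSeries.HasSubst.of_constantCoeff_zero' hX0
  obtain ⟨e, he, rfl⟩ := exists_isUnit_X_mul h0 h1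
  refine ⟨e.subst (PowerSeries.X ^ p : O⟦X⟧), ?_, ?_, ?_⟩
  · rw [PowerSeries.isUnit_iff_constantCoeff, constantCoeff_subst_of_zero hX0]
    exact PowerSeries.isUnit_iff_constantCoeff.mp he
  · rw [constantCoeff_subst_of_zero hX0, ← zero_add 1, PowerSeries.coeff_succ_X_mul,
      PowerSeries.coeff_zero_eq_constantCoeff_apply]
  · rw [PowerSeries.subst_mul hXp, PowerSeries.subst_X hXp]

end SubstExpansion

section Coordinates

variable {O K : Type*} [CommRing O] [Field K] [Algebra O K] [FaithfulSMul O K]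
  {V : WeierstrassCurve O} {W : WeierstrassCurve K}

/-- Over O the Weierstrass equation reads w·v = t³ with v(0) = 1, so x = t/w = v/t² where t is z
times a unit. -/
lemma hasUnitExpansion_xExp (hV : V.map (algebraMap O K) = W) (T : FormalParameter O) :
    HasUnitExpansion O (xExp W (T.map (algebraMap O K))) (-2) := by
  obtain ⟨w, hw, hw'⟩ := exists_map_eq_wExp hV T
  have hw0 := PowerSeries.X_dvd_iff.mp hw
  set v : O⟦X⟧ := 1 - (PowerSeries.C V.a₁ * T.series + PowerSeries.C V.a₂ * T.series ^ 2) -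
    (PowerSeries.C V.a₃ + PowerSeries.C V.a₄ * T.series) * w - PowerSeries.C V.a₆ * w ^ 2 with hv
  have hv0 : v.constantCoeff = 1 := by
    rw [hv]; simp [hw0, T.constantCoeff_series]
  have hvu : IsUnit v := PowerSeries.isUnit_iff_constantCoeff.mpr (hv0 ▸ isUnit_one)
  have hT : HasUnitExpansion O (integralToLaurent O K T.series) 1 :=
    hasUnitExpansion_X_mul T.constantCoeff_series T.isUnit_coeff_one
  have hvU : HasUnitExpansion O (integralToLaurent O K v) 0 := ⟨v, hvu, (one_mul _).symm⟩
  have h : w * v = T.series ^ 3 := by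
    apply PowerSeries.map_injective _ (FaithfulSMul.algebraMap_injective O K)
    have h := wExp_eq W (T.map (algebraMap O K))
    rw [← hw', FormalParameter.series_map, ← hV] at h
    simp only [WeierstrassCurve.map] at h
    rw [hv]
    simp only [map_mul, map_sub, map_add, map_one, map_pow, PowerSeries.map_C]
    linear_combination h
  have h' : integralToLaurent O K w = integralToLaurent O K T.series ^ 3 / integralToLaurent O K v := by
    rw [eq_div_iff hvU.ne_zero, ← map_mul, h, map_pow]
  have hx : xExp W (T.map (algebraMap O K)) =
      integralToLaurent O K T.series / integralToLaurent O K w := by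
    rw [xExp, ← hw']; rfl
  rw [hx, h']
  have h3 := hT.div ((hT.pow 3).div hvU)
  rwa [show (1 : ℤ) - (((3 : ℕ) : ℤ) * 1 - 0) = -2 by norm_num] at h3

open scoped Classical in
lemma expand_mulX [W.IsElliptic] (hV : V.map (algebraMap O K) = W) (T : FormalParameter O) (n : ℕ)
    (hn : mulSeries W (T.map (algebraMap O K)) n ≠ 0) :
    expand W (T.map (algebraMap O K)) (mulX W n) =
      laurentSubstHom (RingHom.id K) (constantCoeff_mulSeries hV T n) hn
        (xExp W (T.map (algebraMap O K))) := by
  have h := mapPoint_mulGeneric W (T.map (algebraMap O K)) n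
  obtain ⟨h', hP⟩ := expandPoint_eq W (T.map (algebraMap O K))
  rw [nsmul_expandPoint hV T n hn, hP, mapPoint_some] at h
  rw [mulX]
  cases hm : mulGeneric W n with
  | zero => rw [hm] at h; exact absurd h.symm (Affine.Point.some_ne_zero _)
  | some x y hxy =>
    rw [hm, mapPoint_some, Affine.Point.some.injEq] at h
    exact h.1

open scoped Classical in
lemma laurentDeriv_expand_mulX [W.IsElliptic] (p : ℕ) [CharP K p] (h2 : (2 : K) ≠ 0)
    (T : FormalParameter K) : laurentDeriv K (expand W T (mulX W p)) = 0 := by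
  have h := hasLogDeriv_zero p h2 T (W := W)
  rw [← mapPoint_mulGeneric] at h
  rw [mulX]
  cases hm : mulGeneric W p with
  | zero => exact (congrArg _ (map_zero _)).trans (map_zero _)
  | some x y hxy =>
    rw [hm, mapPoint_some] at h
    exact h.1.trans (zero_mul _)

lemma laurentDeriv_eval₂ (x : K⸨X⸩) (q : Polynomial K) :
    laurentDeriv K (q.eval₂ HahnSeries.C x) =
      q.derivative.eval₂ HahnSeries.C x * laurentDeriv K x := by
  induction q using Polynomial.induction_on' with
  | add q r hq hr =>
    rw [Polynomial.eval₂_add, map_add, hq, hr, Polynomial.derivative_add, Polynomial.eval₂_add,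
      add_mul]
  | monomial n a =>
    rw [Polynomial.eval₂_monomial, derivation_mul, laurentDeriv_C, mul_zero, add_zero,
      derivation_pow, Polynomial.derivative_monomial, Polynomial.eval₂_monomial, map_mul,
      map_natCast]
    ring

lemma laurentDeriv_xExp_ne_zero (h2 : (2 : K) ≠ 0) (T : FormalParameter K) :
    laurentDeriv K (xExp W T) ≠ 0 := by
  obtain ⟨d, hd, hη, hx⟩ := exists_invariantDifferential W T h2
  rw [hx]
  refine mul_ne_zero ((map_ne_zero_iff _ HahnSeries.ofPowerSeries_injective).mpr ?_) hη
  rintro rfl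
  exact T.isUnit_coeff_one.ne_zero (by rw [← hd, map_zero])

lemma expand_polyFun_mem_boundedDenominators [IsDomain O] [IsFractionRing O K]
    (hV : V.map (algebraMap O K) = W) (T : FormalParameter O) (q : Polynomial K) :
    expand W (T.map (algebraMap O K)) (polyFun W q) ∈ boundedDenominators O K := by
  rw [expand_polyFun, Polynomial.eval₂_eq_sum_range]
  exact sum_mem fun i _ => mul_mem (C_mem_boundedDenominators _)
    (pow_mem (hasUnitExpansion_xExp hV T).mem_boundedDenominators i)

/-- If `P(x) ^ 2 X = Q(x)` with `P ^ 2` and `Q` coprime, and `X` has zero derivative, then so does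
`P(x)`. -/
lemma derivative_eq_zero_of_isCoprime (h2 : (2 : K) ≠ 0) (T : FormalParameter K)
    {P Q : Polynomial K} (hP0 : P ≠ 0) {X : K⸨X⸩} (hX : laurentDeriv K X = 0)
    (h : P.eval₂ HahnSeries.C (xExp W T) ^ 2 * X = Q.eval₂ HahnSeries.C (xExp W T))
    (hPQ : IsCoprime (P ^ 2) Q) : P.derivative = 0 := by
  have hD := congrArg (laurentDeriv K) h
  rw [derivation_mul, hX, mul_zero, zero_add, derivation_pow, laurentDeriv_eval₂,
    laurentDeriv_eval₂, pow_one] at hD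
  have hD2 : 2 * P.eval₂ HahnSeries.C (xExp W T) * P.derivative.eval₂ HahnSeries.C (xExp W T) * X =
      Q.derivative.eval₂ HahnSeries.C (xExp W T) := by
    apply mul_right_cancel₀ (laurentDeriv_xExp_ne_zero (W := W) h2 T)
    push_cast at hD
    linear_combination hD
  -- Eliminates X between P²X = Q and 2PP'X = Q'. By coprimality P then divides 2P', whose degree is
  -- smaller.
  have hpoly : Q * (Polynomial.C 2 * P.derivative) = Q.derivative * P := by
    rw [← sub_eq_zero]
    apply eval_xExp_ne_zero W T
    rw [Polynomial.eval₂_sub, Polynomial.eval₂_mul, Polynomial.eval₂_mul, Polynomial.eval₂_mul,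
      Polynomial.eval₂_C, ← h, ← hD2, map_ofNat]
    ring
  have hdvd : P ∣ Polynomial.C 2 * P.derivative :=
    (IsCoprime.of_isCoprime_of_dvd_left hPQ (dvd_pow_self P two_ne_zero)).dvd_of_dvd_mul_left
      ⟨Q.derivative, by rw [hpoly, mul_comm]⟩
  have hdeg : (Polynomial.C 2 * P.derivative).degree < P.degree := by
    rw [Polynomial.degree_C_mul h2]
    exact Polynomial.degree_derivative_lt hP0
  have h0 := Polynomial.eq_zero_of_dvd_of_degree_lt hdvd hdeg
  exact (mul_eq_zero.mp h0).resolve_left (by simpa using h2)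

end Coordinates

/-! ### The expansion of the division polynomial -/

section DivisionPolynomial

variable {O K : Type*} [CommRing O] [IsDomain O] [IsDiscreteValuationRing O] [Field K] [Algebra O K]
  [IsFractionRing O K] {V : WeierstrassCurve O} {W : WeierstrassCurve K} {p : ℕ}

/-- At the origin the divisor condition reads 2 ord f - 2p = -2p². -/
lemma order_of_divisor (T : FormalParameter K) {f X : W.toAffine.FunctionField}
    (hX : (expand W T X).order = -2 * p)
    (hp : p ≠ 0)
    (hdiv : ∀ A : ValuationSubring W.toAffine.FunctionField,
      (∀ c : K, algebraMap K W.toAffine.FunctionField c ∈ A) →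
      A.valuation f ^ 2 * max 1 (A.valuation X) = max 1 (A.valuation (xFun W)) ^ p ^ 2) :
    (expand W T f).order = p - (p : ℤ) ^ 2 := by
  have hf0 := ne_zero_of_divisor hdiv
  have hx : (expand W T (xFun W)).order = -2 := by
    rw [← polyFun_X, expand_polyFun, order_eval₂_xExp W T Polynomial.X_ne_zero,
      Polynomial.natDegree_X]
    norm_num
  have hlt : ∀ g : W.toAffine.FunctionField, (expand W T g).order < 0 →
      max 1 ((originPlace W T).valuation g) = (originPlace W T).valuation g := fun g hg => by
    refine max_eq_right (le_of_not_ge fun h => ?_)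
    rw [ValuationSubring.valuation_le_one_iff] at h
    exact absurd (order_nonneg_of_mem_originPlace W T h) (not_le.mpr hg)
  have hX0 : X ≠ 0 := by
    rintro rfl
    rw [map_zero, HahnSeries.order_zero] at hX
    omega
  have hx0 : xFun W ≠ 0 := by
    intro h
    rw [h, map_zero, HahnSeries.order_zero] at hx
    omega
  have h := hdiv _ (algebraMap_mem_originPlace W T)
  rw [hlt X (by rw [hX]; omega), hlt _ (by rw [hx]; omega), ← map_pow, ← map_pow, ← map_mul] at h
  have h1 := order_eq_of_valuation_eq W T (pow_ne_zero _ hx0) h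
  have hfE := (map_ne_zero (expand W T)).mpr hf0
  rw [map_mul, map_pow, map_pow, HahnSeries.order_mul (pow_ne_zero _ hfE)
    ((map_ne_zero (expand W T)).mpr hX0), HahnSeries.order_pow, HahnSeries.order_pow, hX, hx] at h1
  simp only [nsmul_eq_mul] at h1
  push_cast at h1
  linarith

/-- Evenness makes f a polynomial in x with zero derivative, Gauss's lemma makes its unit part
integral, and zero derivative makes that part a series in z^p. The normalization identifies the
leading constant. -/
theorem IsDivisionPolynomial.exists_expand_eq [W.IsElliptic] [Fact p.Prime] [CharP K p] (h2 : (2 : K) ≠ 0)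
    (hV : V.map (algebraMap O K) = W) (T : FormalParameter O) {f : W.toAffine.FunctionField}
    (hf : IsDivisionPolynomial W (T.map (algebraMap O K)) p f) {m : O⟦X⟧}
    (hm0 : m.constantCoeff = 0) (hm1 : IsUnit (m.coeff 1))
    (hm : mulSeries W (T.map (algebraMap O K)) p =
      PowerSeries.map (algebraMap O K) (m.subst (PowerSeries.X ^ p : O⟦X⟧))) :
    ∃ k : O⟦X⟧, k.constantCoeff = 1 ∧ expand W (T.map (algebraMap O K)) f =
      HahnSeries.C (algebraMap O K (m.coeff 1) *
        beta W (T.map (algebraMap O K)) ^ (1 - (p : ℤ) ^ 2)) *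
      HahnSeries.single ((p : ℤ) - (p : ℤ) ^ 2) 1 *
      integralToLaurent O K (k.subst (PowerSeries.X ^ p : O⟦X⟧)) := by
  have hp := (Fact.out : p.Prime)
  set T' := T.map (algebraMap O K) with hT'
  obtain ⟨e, he, he0, hme⟩ := exists_subst_X_pow_eq hm0 hm1 hp.ne_zero
  have hMU : HasUnitExpansion O (integralToLaurent O K (m.subst (PowerSeries.X ^ p : O⟦X⟧))) p := by
    rw [hme]; exact hasUnitExpansion_X_pow_mul he p
  have hM0 : mulSeries W T' p ≠ 0 := by
    intro h
    apply hMU.ne_zero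
    rw [integralToLaurent_apply, ← hm, h, map_zero]
  have hXU : HasUnitExpansion O (expand W T' (mulX W p)) (-2 * p) := by
    rw [expand_mulX hV T p hM0]
    simp only [← hT', hm]
    refine HasUnitExpansion.laurentSubstHom ?_ _ _ hMU (hasUnitExpansion_xExp hV T)
    rw [hme]; simp [hp.ne_zero]
  have hord := order_of_divisor T' hXU.order_eq hp.ne_zero hf.divisor
  have heven : Even (expand W T' f).order := by
    rw [hord, show (p : ℤ) - (p : ℤ) ^ 2 = -((p - 1) * ((p - 1) + 1)) by ring]
    exact (Int.even_mul_succ_self _).neg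
  obtain ⟨P, Q, hP, hQ, hPQ⟩ :=
    exists_polyFun_of_divisor T' h2 (conj_mulX W p) hf.divisor heven
  have hf0 := ne_zero_of_divisor hf.divisor
  have hP0 : P ≠ 0 := by
    rintro rfl
    exact hf0 (by rw [hP, map_zero])
  have hPz : expand W T' f = P.eval₂ HahnSeries.C (xExp W T') := by rw [hP, expand_polyFun]
  have hQz := congrArg (expand W T') hQ
  rw [map_mul, map_pow, expand_polyFun] at hQz
  have hDP := derivative_eq_zero_of_isCoprime h2 T' hP0
    (laurentDeriv_expand_mulX p h2 T') (hPz ▸ hQz) hPQ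
  have hDf : laurentDeriv K (expand W T' f) = 0 := by
    rw [hPz, laurentDeriv_eval₂, hDP, Polynomial.eval₂_zero, zero_mul]
  obtain ⟨u, v, huv⟩ := hPQ
  -- The Bezout relation uP² + vQ = 1 divided by f exhibits 1/f as f(u + vX), which visibly has
  -- bounded denominators.
  have hinv : expand W T' f * (expand W T' f * (expand W T' (polyFun W u) +
      expand W T' (polyFun W v) * expand W T' (mulX W p))) = 1 := by
    have h := congrArg (fun q => expand W T' (polyFun W q)) huv
    simp only [map_add, map_mul, map_pow, map_one, ← hP, ← hQ] at h
    linear_combination h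
  have hfB : expand W T' f ∈ boundedDenominators O K := by
    rw [hP]; exact expand_polyFun_mem_boundedDenominators hV T P
  obtain ⟨c, _, n, hc, U, hU, rfl⟩ := exists_hasUnitExpansion hfB
    (mul_mem hfB (add_mem (expand_polyFun_mem_boundedDenominators hV T u)
      (mul_mem (expand_polyFun_mem_boundedDenominators hV T v) hXU.mem_boundedDenominators))) hinv
  have hgU : HasUnitExpansion O (HahnSeries.single n 1 * integralToLaurent O K U) n := ⟨U, hU, rfl⟩
  have hc0 : c ≠ 0 := by
    rintro rfl
    rw [map_zero, zero_mul] at hc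
    exact (map_ne_zero (expand W T')).mpr hf0 hc
  have hn : n = (p : ℤ) - (p : ℤ) ^ 2 := by
    have h := congrArg HahnSeries.order hc
    rw [hord, HahnSeries.order_mul (by simpa using hc0) hgU.ne_zero, hgU.order_eq,
      HahnSeries.order_C, zero_add] at h
    exact h.symm
  have hU0 := PowerSeries.isUnit_iff_constantCoeff.mp hU
  obtain ⟨a, ha⟩ := hU0
  -- The exponent p - p² is zero in K, so the power of z is a constant for d/dz and only the unit
  -- part is differentiated.
  have hDU : PowerSeries.derivative K (U.map (algebraMap O K)) = 0 := by
    have h := hDf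
    rw [hc, derivation_mul, laurentDeriv_C, mul_zero, add_zero, mul_eq_zero] at h
    have h := h.resolve_left (by simpa using hc0)
    rw [laurentDeriv_apply, laurentDerivative_single_mul, hn] at h
    rw [show (((p : ℤ) - (p : ℤ) ^ 2 : ℤ) : K) = 0 by simp, map_zero, zero_mul, zero_mul, zero_add,
      mul_eq_zero] at h
    have h := h.resolve_left (HahnSeries.single_ne_zero one_ne_zero)
    rw [integralToLaurent_apply, laurentDerivative_coe] at h
    exact (map_eq_zero_iff _ HahnSeries.ofPowerSeries_injective).mp h
  have hUk := exists_eq_subst_X_pow p hDU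
  set k : O⟦X⟧ := PowerSeries.mk fun n => U.coeff (p * n) with hk
  have hk0 : k.constantCoeff = a := by
    rw [← PowerSeries.coeff_zero_eq_constantCoeff_apply, hk, PowerSeries.coeff_mk, mul_zero,
      PowerSeries.coeff_zero_eq_constantCoeff_apply, ha]
  have hX0 : (PowerSeries.X ^ p : O⟦X⟧).constantCoeff = 0 := by simp [hp.ne_zero]
  have hXp := PowerSeries.HasSubst.of_constantCoeff_zero' hX0
  have ha0 : algebraMap O K a ≠ 0 := (a.isUnit.map _).ne_zero
  -- In z^(p²) f / [p] all powers of z cancel, leaving c·U divided by the unit part of [p](z), whose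
  -- constant coefficient is that of z^p in [p](z).
  have hnorm : c * algebraMap O K a = algebraMap O K (m.coeff 1) *
      beta W T' ^ (1 - (p : ℤ) ^ 2) := by
    have hee : IsUnit (algebraMap O K (m.coeff 1)) := hm1.map _
    have h := hf.normalized
    rw [hm, ← integralToLaurent_apply, hme, hc, hn] at h
    obtain ⟨e', rfl⟩ := he
    rw [map_mul (integralToLaurent O K) _ (e' : O⟦X⟧), map_pow, integralToLaurent_X, single_one_pow, single_one_pow,
      show (HahnSeries.single ((p ^ 2 : ℕ) : ℤ) 1 : K⸨X⸩) * (HahnSeries.C c *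
        (HahnSeries.single ((p : ℤ) - (p : ℤ) ^ 2) 1 * integralToLaurent O K U)) /
        (HahnSeries.single (p : ℤ) 1 * integralToLaurent O K e') =
        HahnSeries.C c * integralToLaurent O K (U * (e'⁻¹ : (O⟦X⟧)ˣ)) by
          rw [div_eq_iff (mul_ne_zero (HahnSeries.single_ne_zero one_ne_zero)
            (e'.isUnit.map _).ne_zero)]
          have h1 : (HahnSeries.single ((p ^ 2 : ℕ) : ℤ) 1 : K⸨X⸩) *
              HahnSeries.single ((p : ℤ) - (p : ℤ) ^ 2) 1 = HahnSeries.single (p : ℤ) 1 := by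
            rw [HahnSeries.single_mul_single, one_mul,
              show ((p ^ 2 : ℕ) : ℤ) + ((p : ℤ) - (p : ℤ) ^ 2) = p by push_cast; ring]
          have h3 : integralToLaurent O K (e'⁻¹ : (O⟦X⟧)ˣ) * integralToLaurent O K e' = 1 := by
            rw [← map_mul, Units.inv_mul, map_one]
          rw [map_mul]
          linear_combination HahnSeries.C c * integralToLaurent O K U * h1 -
            HahnSeries.C c * integralToLaurent O K U * HahnSeries.single (p : ℤ) 1 * h3,
      HahnSeries.C_mul_eq_smul, HahnSeries.coeff_smul, smul_eq_mul, integralToLaurent_apply] at h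
    have h4 := LaurentSeries.coeff_coe_powerSeries
      (PowerSeries.map (algebraMap O K) (U * (e'⁻¹ : (O⟦X⟧)ˣ))) 0
    rw [Nat.cast_zero] at h4
    rw [h4, PowerSeries.coeff_map, PowerSeries.coeff_zero_eq_constantCoeff_apply, map_mul, ← ha] at h
    rw [← h, ← he0]
    have h5 : (e' : O⟦X⟧).constantCoeff * (e'⁻¹ : (O⟦X⟧)ˣ).val.constantCoeff = 1 := by
      rw [← map_mul, Units.mul_inv, map_one]
    have h6 := congrArg (algebraMap O K) h5
    rw [map_mul, map_one] at h6
    rw [map_mul]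
    linear_combination -c * algebraMap O K a * h6
  refine ⟨PowerSeries.C ((a⁻¹ : Oˣ) : O) * k, ?_, ?_⟩
  · rw [map_mul, hk0, PowerSeries.constantCoeff_C, Units.inv_mul]
  · rw [← hnorm, PowerSeries.subst_mul hXp, PowerSeries.subst_C, map_mul (integralToLaurent O K),
      ← hUk, hc, hn, map_mul HahnSeries.C]
    have h1 : integralToLaurent O K (PowerSeries.C ((a⁻¹ : Oˣ) : O)) *
        HahnSeries.C (algebraMap O K a) = 1 := by
      rw [integralToLaurent_C, ← map_mul, ← map_mul, Units.inv_mul, map_one, map_one]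
    have h3 : integralToLaurent O K (MvPowerSeries.C ((a⁻¹ : Oˣ) : O)) =
      integralToLaurent O K (PowerSeries.C ((a⁻¹ : Oˣ) : O)) := rfl
    rw [h3]
    linear_combination -HahnSeries.C c * HahnSeries.single ((p : ℤ) - (p : ℤ) ^ 2) 1 *
      integralToLaurent O K U * h1

end DivisionPolynomial

/-! ### Composition and Frobenius on power series -/

section Composition

variable {R : Type*} [CommRing R] {a b : R⟦X⟧}

lemma subst_subst_of_zero (ha : a.constantCoeff = 0) (hb : b.constantCoeff = 0) (f : R⟦X⟧) :
    PowerSeries.subst b (f.subst a : R⟦X⟧) = f.subst (a.subst b : R⟦X⟧) :=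
  PowerSeries.subst_comp_subst_apply (PowerSeries.HasSubst.of_constantCoeff_zero' ha)
    (PowerSeries.HasSubst.of_constantCoeff_zero' hb) f

lemma subst_mul_of_zero (ha : a.constantCoeff = 0) (f g : R⟦X⟧) :
    ((f * g).subst a : R⟦X⟧) = f.subst a * g.subst a :=
  PowerSeries.subst_mul (PowerSeries.HasSubst.of_constantCoeff_zero' ha) f g

lemma subst_pow_of_zero (ha : a.constantCoeff = 0) (f : R⟦X⟧) (n : ℕ) :
    ((f ^ n).subst a : R⟦X⟧) = (f.subst a) ^ n :=
  PowerSeries.subst_pow (PowerSeries.HasSubst.of_constantCoeff_zero' ha) f n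

lemma subst_X_of_zero (ha : a.constantCoeff = 0) :
    ((PowerSeries.X : R⟦X⟧).subst a : R⟦X⟧) = a :=
  PowerSeries.subst_X (PowerSeries.HasSubst.of_constantCoeff_zero' ha)

lemma subst_C_eq_C (a : R⟦X⟧) (r : R) :
    ((PowerSeries.C r : R⟦X⟧).subst a : R⟦X⟧) = PowerSeries.C r :=
  PowerSeries.subst_C r

lemma subst_one_of_zero (ha : a.constantCoeff = 0) : ((1 : R⟦X⟧).subst a : R⟦X⟧) = 1 := by
  have := subst_pow_of_zero ha 1 0
  rwa [pow_zero, pow_zero] at this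

lemma constantCoeff_X_pow_of_ne_zero {n : ℕ} (hn : n ≠ 0) :
    (PowerSeries.X ^ n : R⟦X⟧).constantCoeff = 0 := by simp [hn]

lemma X_pow_dvd_subst (ha : a.constantCoeff = 0) {f : R⟦X⟧} {n : ℕ}
    (hf : PowerSeries.X ^ n ∣ f) : PowerSeries.X ^ n ∣ (f.subst a : R⟦X⟧) := by
  obtain ⟨g, rfl⟩ := hf
  rw [subst_mul_of_zero ha, subst_pow_of_zero ha, subst_X_of_zero ha]
  exact (pow_dvd_pow_of_dvd (PowerSeries.X_dvd_iff.mpr ha) n).mul_right _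

end Composition

section Frobenius

lemma charP_powerSeries {R : Type*} [CommRing R] (p : ℕ) [CharP R p] : CharP R⟦X⟧ p :=
  charP_of_injective_ringHom (f := (PowerSeries.C : R →+* R⟦X⟧)) PowerSeries.C_injective p

variable {R : Type*} [CommRing R] (p : ℕ) [Fact p.Prime] [CharP R p]

/-- Both sides are ring homomorphisms in f agreeing on constants and X, hence on polynomials;
truncating f modulo X^(N+1) compares each coefficient. -/
lemma pow_pow_eq_subst (n : ℕ) (f : R⟦X⟧) :
    f ^ p ^ n = (f.map (iterateFrobenius R p n)).subst (PowerSeries.X ^ p ^ n : R⟦X⟧) := by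
  have hC := charP_powerSeries (R := R) p
  have hpn : p ^ n ≠ 0 := pow_ne_zero _ (Fact.out : p.Prime).ne_zero
  set Φ : R⟦X⟧ →+* R⟦X⟧ := ((PowerSeries.substAlgHom (PowerSeries.HasSubst.X_pow hpn) :
    R⟦X⟧ →ₐ[R] R⟦X⟧) : R⟦X⟧ →+* R⟦X⟧).comp (PowerSeries.map (iterateFrobenius R p n)) with hΦ
  have hΦa : ∀ g, Φ g = (g.map (iterateFrobenius R p n)).subst (PowerSeries.X ^ p ^ n : R⟦X⟧) :=
    fun g => congrFun (PowerSeries.coe_substAlgHom (PowerSeries.HasSubst.X_pow hpn)) _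
  have hpoly : ∀ q : Polynomial R, Φ q = (q : R⟦X⟧) ^ p ^ n := by
    intro q
    have h : Φ.comp (Polynomial.coeToPowerSeries.ringHom (R := R)) =
        (iterateFrobenius R⟦X⟧ p n).comp Polynomial.coeToPowerSeries.ringHom := by
      apply Polynomial.ringHom_ext
      · intro a
        simp only [RingHom.comp_apply, Polynomial.coeToPowerSeries.ringHom_apply,
          Polynomial.coe_C, hΦa, PowerSeries.map_C, subst_C_eq_C, iterateFrobenius_def]
        exact map_pow _ _ _
      · simp only [RingHom.comp_apply, Polynomial.coeToPowerSeries.ringHom_apply,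
          Polynomial.coe_X, hΦa, PowerSeries.map_X, iterateFrobenius_def,
          subst_X_of_zero (constantCoeff_X_pow_of_ne_zero hpn)]
    exact congrArg (· q) h
  rw [← hΦa]
  ext N
  have hd : PowerSeries.X ^ (N + 1) ∣ f - (PowerSeries.trunc (N + 1) f : R⟦X⟧) := by
    rw [PowerSeries.X_pow_dvd_iff]
    intro j hj
    rw [map_sub, Polynomial.coeff_coe, PowerSeries.coeff_trunc, if_pos hj, sub_self]
  have h1 : PowerSeries.X ^ (N + 1) ∣
      f ^ p ^ n - (PowerSeries.trunc (N + 1) f : R⟦X⟧) ^ p ^ n :=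
    hd.trans (sub_dvd_pow_sub_pow _ _ _)
  have h2 : PowerSeries.X ^ (N + 1) ∣ Φ f - (PowerSeries.trunc (N + 1) f : R⟦X⟧) ^ p ^ n := by
    rw [← hpoly, ← map_sub, hΦa]
    apply X_pow_dvd_subst (constantCoeff_X_pow_of_ne_zero hpn)
    have := map_dvd (PowerSeries.map (iterateFrobenius R p n)) hd
    rwa [map_pow, PowerSeries.map_X] at this
  have h3 := dvd_sub h1 h2
  rw [sub_sub_sub_cancel_right] at h3
  rw [← sub_eq_zero, ← map_sub]
  exact PowerSeries.X_pow_dvd_iff.mp h3 N (Nat.lt_succ_self N)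

lemma pow_char_eq_subst (f : R⟦X⟧) :
    f ^ p = (f.map (frobenius R p)).subst (PowerSeries.X ^ p : R⟦X⟧) := by
  have := pow_pow_eq_subst p 1 f
  rwa [pow_one, iterateFrobenius_one] at this

end Frobenius

/-! ### The functional equation: convergence, existence, uniqueness -/

section Product

variable {R : Type*} [CommRing R] (p : ℕ) [Fact p.Prime] [CharP R p]

/-- The factors of the product for the sigma function, recursively. -/
def factorSeries (h s k : R⟦X⟧) : ℕ → R⟦X⟧
  | 0 => h * k.subst s
  | n + 1 => h * ((factorSeries h s k n).map (frobenius R p)).subst s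

/-- The partial products of the product for the sigma function. -/
def partialProduct (h s k : R⟦X⟧) (N : ℕ) : R⟦X⟧ :=
  ∏ n ∈ Finset.range N, factorSeries p h s k n ^ p ^ n

variable {h s k : R⟦X⟧}

lemma constantCoeff_factorSeries (hh : h.constantCoeff = 1) (hs : s.constantCoeff = 0)
    (hk : k.constantCoeff = 1) (n : ℕ) : (factorSeries p h s k n).constantCoeff = 1 := by
  induction n with
  | zero => rw [factorSeries, map_mul, hh, constantCoeff_subst_of_zero hs, hk, one_mul]
  | succ n ih =>
    rw [factorSeries, map_mul, hh, constantCoeff_subst_of_zero hs, one_mul,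
      ← PowerSeries.coeff_zero_eq_constantCoeff_apply, PowerSeries.coeff_map,
      PowerSeries.coeff_zero_eq_constantCoeff_apply, ih, map_one]

lemma map_factorSeries {S : Type*} [CommRing S] [CharP S p] (φ : R →+* S)
    (hs : s.constantCoeff = 0) (n : ℕ) :
    (factorSeries p h s k n).map φ = factorSeries p (h.map φ) (s.map φ) (k.map φ) n := by
  induction n with
  | zero => rw [factorSeries, factorSeries, map_mul, powerSeries_map_subst _ hs]
  | succ n ih =>
    rw [factorSeries, factorSeries, map_mul, powerSeries_map_subst _ hs, ← ih]
    congr 2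
    ext j
    simp only [PowerSeries.coeff_map]
    exact φ.map_frobenius p _

/-- In characteristic p the difference is (g - 1)^(p^n), and X divides g - 1. -/
lemma X_pow_dvd_pow_sub_one {g : R⟦X⟧} (hg : g.constantCoeff = 1) (n : ℕ) :
    PowerSeries.X ^ p ^ n ∣ g ^ p ^ n - 1 := by
  have hC := charP_powerSeries (R := R) p
  have h : g ^ p ^ n - 1 = (g - 1) ^ p ^ n := by rw [sub_pow_char_pow, one_pow]
  rw [h]
  exact pow_dvd_pow_of_dvd (PowerSeries.X_dvd_iff.mpr (by rw [map_sub, hg, map_one, sub_self])) _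

variable {M e : R⟦X⟧}

/-- The functional equation of the partial products. -/
lemma partialProduct_subst (hM : M.constantCoeff = 0) (hs : s.constantCoeff = 0)
    (hsM : (s.subst M : R⟦X⟧) = PowerSeries.X ^ p) (hhM : (h.subst M : R⟦X⟧) = e ^ (p - 1)) (N : ℕ) :
    e * (partialProduct p h s k (N + 1)).subst M = e ^ p ^ (N + 1) *
      k.subst (PowerSeries.X ^ p : R⟦X⟧) * partialProduct p h s k N ^ p ^ 2 := by
  have hp := (Fact.out : p.Prime).one_le
  induction N with
  | zero =>
    rw [partialProduct, Finset.prod_range_one, pow_zero, pow_one, factorSeries,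
      subst_mul_of_zero hM, hhM, subst_subst_of_zero hs hM, hsM, partialProduct,
      Finset.prod_range_zero, one_pow, mul_one, zero_add, pow_one, ← mul_assoc, ← pow_succ',
      Nat.sub_add_cancel hp]
  | succ N ih =>
    have h1 : ((factorSeries p h s k (N + 1)).subst M : R⟦X⟧) =
        e ^ (p - 1) * factorSeries p h s k N ^ p := by
      rw [factorSeries, subst_mul_of_zero hM, hhM, subst_subst_of_zero hs hM, hsM,
        ← pow_char_eq_subst]
    have h2 : partialProduct p h s k (N + 1 + 1) =
        partialProduct p h s k (N + 1) * factorSeries p h s k (N + 1) ^ p ^ (N + 1) :=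
      Finset.prod_range_succ _ _
    have h3 : partialProduct p h s k (N + 1) =
        partialProduct p h s k N * factorSeries p h s k N ^ p ^ N :=
      Finset.prod_range_succ _ _
    -- Each new factor contributes e^(p-1) to the power p^(N+1), which raises the accumulated
    -- exponent of e from p^(N+1) to p^(N+2).
    have h4 : e ^ p ^ (N + 1 + 1) = e ^ p ^ (N + 1) * (e ^ (p - 1)) ^ p ^ (N + 1) := by
      rw [← pow_mul, ← pow_add]
      congr 1
      calc p ^ (N + 1 + 1) = p ^ (N + 1) * (p - 1 + 1) := by rw [Nat.sub_add_cancel hp, pow_succ]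
        _ = p ^ (N + 1) + (p - 1) * p ^ (N + 1) := by ring
    rw [h2, subst_mul_of_zero hM, subst_pow_of_zero hM, h1, ← mul_assoc, ih, h3, h4]
    ring

/-- The limit of the partial products. -/
lemma exists_limit_partialProduct (hh : h.constantCoeff = 1) (hs : s.constantCoeff = 0)
    (hk : k.constantCoeff = 1) :
    ∃ S : R⟦X⟧, ∀ N, PowerSeries.X ^ N ∣ S - partialProduct p h s k N := by
  have hstep : ∀ N, PowerSeries.X ^ (N + 1) ∣
      partialProduct p h s k (N + 1) - partialProduct p h s k N := by
    intro N
    rw [partialProduct, Finset.prod_range_succ, ← partialProduct,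
      show partialProduct p h s k N * factorSeries p h s k N ^ p ^ N - partialProduct p h s k N =
        partialProduct p h s k N * (factorSeries p h s k N ^ p ^ N - 1) by ring]
    refine Dvd.dvd.mul_left (dvd_trans (pow_dvd_pow _ ?_)
      (X_pow_dvd_pow_sub_one p (constantCoeff_factorSeries p hh hs hk N) N)) _
    exact Nat.lt_pow_self (Fact.out : p.Prime).one_lt
  -- Passing from N to N + 1 factors changes nothing below degree N + 1, so the coefficient of
  -- degree j is final after j + 1 factors.
  refine ⟨PowerSeries.mk fun j => (partialProduct p h s k (j + 1)).coeff j, fun N => ?_⟩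
  rw [PowerSeries.X_pow_dvd_iff]
  intro j hj
  rw [map_sub, PowerSeries.coeff_mk, sub_eq_zero]
  obtain ⟨i, rfl⟩ := Nat.exists_eq_add_of_le hj
  induction i with
  | zero => rfl
  | succ i ih =>
    rw [ih (by omega), eq_comm, ← sub_eq_zero, ← map_sub]
    exact PowerSeries.X_pow_dvd_iff.mp (hstep (j + 1 + i)) j (by omega)

lemma eq_of_forall_X_pow_dvd_sub {f g : R⟦X⟧} (hfg : ∀ N, PowerSeries.X ^ N ∣ f - g) : f = g := by
  ext j
  rw [← sub_eq_zero, ← map_sub]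
  exact PowerSeries.X_pow_dvd_iff.mp (hfg (j + 1)) j (Nat.lt_succ_self j)

/-- Passage to the limit in the equation for partial products: the extra factor e^(p^(N+1)) tends to
1 because e(0) = 1. -/
lemma exists_product (hh : h.constantCoeff = 1) (hs : s.constantCoeff = 0)
    (hk : k.constantCoeff = 1) (hM : M.constantCoeff = 0) (he : e.constantCoeff = 1)
    (hsM : (s.subst M : R⟦X⟧) = PowerSeries.X ^ p) (hhM : (h.subst M : R⟦X⟧) = e ^ (p - 1)) :
    ∃ S : R⟦X⟧, S.constantCoeff = 1 ∧ (∀ N, PowerSeries.X ^ N ∣ S - partialProduct p h s k N) ∧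
      e * S.subst M = k.subst (PowerSeries.X ^ p : R⟦X⟧) * S ^ p ^ 2 := by
  obtain ⟨S, hS⟩ := exists_limit_partialProduct p hh hs hk
  refine ⟨S, ?_, hS, ?_⟩
  · have h1 := PowerSeries.X_dvd_iff.mp (by simpa using hS 1)
    rw [map_sub, partialProduct, Finset.prod_range_one, pow_zero, pow_one,
      constantCoeff_factorSeries p hh hs hk, sub_eq_zero] at h1
    exact h1
  · refine eq_of_forall_X_pow_dvd_sub fun N => ?_
    have hMs := PowerSeries.HasSubst.of_constantCoeff_zero' hM
    have h1 : PowerSeries.X ^ N ∣ S.subst M - (partialProduct p h s k (N + 1)).subst M := by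
      rw [← PowerSeries.subst_sub hMs]
      exact X_pow_dvd_subst hM ((pow_dvd_pow _ N.le_succ).trans (hS (N + 1)))
    have h2 : PowerSeries.X ^ N ∣ S ^ p ^ 2 - partialProduct p h s k N ^ p ^ 2 :=
      (hS N).trans (sub_dvd_pow_sub_pow _ _ _)
    have h3 : PowerSeries.X ^ N ∣ e ^ p ^ (N + 1) - 1 :=
      (pow_dvd_pow _ (N.le_succ.trans (Nat.lt_pow_self (Fact.out : p.Prime).one_lt).le)).trans
        (X_pow_dvd_pow_sub_one p he (N + 1))
    have h4 := partialProduct_subst p (k := k) hM hs hsM hhM N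
    set κ : R⟦X⟧ := k.subst (PowerSeries.X ^ p : R⟦X⟧)
    have h5 : e * S.subst M - κ * S ^ p ^ 2 =
        e * (S.subst M - (partialProduct p h s k (N + 1)).subst M) +
        κ * partialProduct p h s k N ^ p ^ 2 * (e ^ p ^ (N + 1) - 1) -
        κ * (S ^ p ^ 2 - partialProduct p h s k N ^ p ^ 2) := by
      linear_combination h4
    rw [h5]
    exact dvd_sub (dvd_add (h1.mul_left _) (h3.mul_left _)) (h2.mul_left _)

/-- The functional equation of the sigma function has at most one solution. -/
lemma eq_of_functional_equation [IsDomain R] {κ S S' u : R⟦X⟧} (hu : IsUnit u)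
    (hM : M = PowerSeries.X ^ p * u) (he : e ≠ 0)
    (hS0 : S.constantCoeff = 1) (hS0' : S'.constantCoeff = 1)
    (hS : e * S.subst M = κ * S ^ p ^ 2) (hS' : e * S'.subst M = κ * S' ^ p ^ 2) : S' = S := by
  have hp := (Fact.out : p.Prime)
  have hC := charP_powerSeries (R := R) p
  have hM0 : M.constantCoeff = 0 := by rw [hM]; simp [hp.ne_zero]
  have hMs := PowerSeries.HasSubst.of_constantCoeff_zero' hM0
  obtain ⟨v, rfl⟩ : IsUnit S := PowerSeries.isUnit_iff_constantCoeff.mpr (hS0 ▸ isUnit_one)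
  obtain ⟨D, hD⟩ : ∃ D, S' = (1 + D) * v := ⟨S' * (v⁻¹ : (R⟦X⟧)ˣ) - 1, by simp⟩
  have hv0 : (v : R⟦X⟧).subst M ≠ (0 : R⟦X⟧) := by
    intro h
    have := constantCoeff_subst_of_zero hM0 (v : R⟦X⟧)
    rw [h, hS0, map_zero] at this
    exact zero_ne_one this
  -- Dividing the two equations gives (1 + D)(M) = (1 + D)^(p²), and the right side is 1 + D^(p²) in
  -- characteristic p.
  have hDM : (D.subst M : R⟦X⟧) = D ^ p ^ 2 := by
    have h1 : (S'.subst M : R⟦X⟧) = (1 + D.subst M) * (v : R⟦X⟧).subst M := by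
      rw [hD, subst_mul_of_zero hM0, PowerSeries.subst_add hMs, subst_one_of_zero hM0]
    have h2 : e * ((v : R⟦X⟧).subst M * (v : R⟦X⟧) ^ p ^ 2) * (1 + D.subst M) =
        e * ((v : R⟦X⟧).subst M * (v : R⟦X⟧) ^ p ^ 2) * (1 + D) ^ p ^ 2 := by
      rw [h1, hD, mul_pow] at hS'
      linear_combination (v : R⟦X⟧) ^ p ^ 2 * hS' - (1 + D) ^ p ^ 2 * (v : R⟦X⟧) ^ p ^ 2 * hS
    have h3 := mul_left_cancel₀
      (mul_ne_zero he (mul_ne_zero hv0 (pow_ne_zero _ v.isUnit.ne_zero))) h2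
    rw [add_pow_char_pow, one_pow] at h3
    exact add_left_cancel h3
  suffices h0 : D = 0 by rw [hD, h0, add_zero, one_mul]
  have hD0 : D.constantCoeff = 0 := by
    have := congrArg PowerSeries.constantCoeff hD
    rw [hS0', map_mul, hS0, mul_one, map_add, map_one] at this
    simpa using this
  by_contra hne
  have hX := PowerSeries.X_pow_order_mul_divXPowOrder (f := D)
  have hE0 := (PowerSeries.constantCoeff_divXPowOrder_eq_zero_iff (f := D)).not.mpr hne
  set n := D.order.toNat with hn
  set E := D.divXPowOrder with hE
  have hn0 : n ≠ 0 := by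
    intro h
    rw [h, pow_zero, one_mul] at hX
    exact hE0 (by rw [hX, hD0])
  rw [← hX, subst_mul_of_zero hM0, subst_pow_of_zero hM0, subst_X_of_zero hM0, hM, mul_pow, mul_pow,
    ← pow_mul, ← pow_mul, mul_assoc] at hDM
  -- If D has order n > 0, then D(M) has order pn, since M has order p, while D^(p²) has order p²n.
  have hlt : p * n < n * p ^ 2 := by
    have := Nat.mul_lt_mul_of_pos_left hp.one_lt (Nat.mul_pos hp.pos (Nat.pos_of_ne_zero hn0))
    nlinarith
  obtain ⟨l, hl⟩ := Nat.exists_eq_add_of_lt hlt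
  rw [hl, add_assoc, pow_add, mul_assoc] at hDM
  have h1 := congrArg PowerSeries.constantCoeff
    (mul_left_cancel₀ (pow_ne_zero _ PowerSeries.X_ne_zero) hDM)
  rw [← hM, map_mul, map_mul, constantCoeff_subst_of_zero hM0, map_pow, map_pow,
    PowerSeries.constantCoeff_X, zero_pow (Nat.succ_ne_zero l), zero_mul] at h1
  exact mul_ne_zero (pow_ne_zero _ (PowerSeries.isUnit_iff_constantCoeff.mp hu).ne_zero) hE0 h1

end Product

/-! ### Inverting the Verschiebung and the powers of [p] -/

section Inverse

variable {R : Type*} [CommRing R]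

/-- The compositional inverse `s` of `m`, the unit `h = (X / (c s)) ^ (p - 1)` where `c` is the
leading coefficient of `m`, and the unit `e` with `m(X ^ p) = c X ^ p e`. -/
lemma exists_inverse_data {m : R⟦X⟧} (hm0 : m.constantCoeff = 0) (hm1 : IsUnit (m.coeff 1)) {p : ℕ}
    (hp : p ≠ 0) : ∃ s h e : R⟦X⟧, s.constantCoeff = 0 ∧ h.constantCoeff = 1 ∧
      e.constantCoeff = 1 ∧ (m.subst s : R⟦X⟧) = PowerSeries.X ∧
      (s.subst m : R⟦X⟧) = PowerSeries.X ∧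
      h * (PowerSeries.C (m.coeff 1) * s) ^ (p - 1) = PowerSeries.X ^ (p - 1) ∧
      m.subst (PowerSeries.X ^ p : R⟦X⟧) = PowerSeries.X ^ p * (PowerSeries.C (m.coeff 1) * e) ∧
      (s.subst (m.subst (PowerSeries.X ^ p : R⟦X⟧) : R⟦X⟧) : R⟦X⟧) = PowerSeries.X ^ p ∧
      (h.subst (m.subst (PowerSeries.X ^ p : R⟦X⟧) : R⟦X⟧) : R⟦X⟧) = e ^ (p - 1) := by
  have hXp := constantCoeff_X_pow_of_ne_zero (R := R) hp
  set s := m.substInvOfIsUnit hm1 with hs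
  have hs0 : s.constantCoeff = 0 := PowerSeries.constantCoeff_substInvOfIsUnit _ _
  have hms : (m.subst s : R⟦X⟧) = PowerSeries.X :=
    PowerSeries.subst_substInvOfIsUnit_right _ hm0 _
  have hsm : (s.subst m : R⟦X⟧) = PowerSeries.X :=
    PowerSeries.subst_substInvOfIsUnit_left _ hm0 _
  obtain ⟨t, ht⟩ := PowerSeries.X_dvd_iff.mpr hs0
  have hmt : m.coeff 1 * t.constantCoeff = 1 := by
    have h1 := coeff_one_subst hs0 hm0
    rw [hms, PowerSeries.coeff_one_X, ht, ← zero_add 1, PowerSeries.coeff_succ_X_mul] at h1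
    simpa using h1.symm
  have hct : (PowerSeries.C (m.coeff 1) * t).constantCoeff = 1 := by
    rw [map_mul, PowerSeries.constantCoeff_C, hmt]
  obtain ⟨v, hv⟩ : IsUnit (PowerSeries.C (m.coeff 1) * t) :=
    PowerSeries.isUnit_iff_constantCoeff.mpr (hct ▸ isUnit_one)
  obtain ⟨e, he, he0, hme⟩ := exists_subst_X_pow_eq hm0 hm1 hp
  have hM0 : PowerSeries.constantCoeff (m.subst (PowerSeries.X ^ p : R⟦X⟧) : R⟦X⟧) = 0 := by
    rw [constantCoeff_subst_of_zero hXp, hm0]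
  have hsM : (s.subst (m.subst (PowerSeries.X ^ p : R⟦X⟧) : R⟦X⟧) : R⟦X⟧) = PowerSeries.X ^ p := by
    rw [← subst_subst_of_zero hm0 hXp, hsm, subst_X_of_zero hXp]
  obtain ⟨c, hc⟩ := hm1
  have hvi : (v : R⟦X⟧) ^ (p - 1) * ((v⁻¹ : (R⟦X⟧)ˣ) : R⟦X⟧) ^ (p - 1) = 1 := by
    rw [← mul_pow, Units.mul_inv, one_pow]
  have hv0 : (v : R⟦X⟧).constantCoeff = 1 := by rw [hv, hct]
  refine ⟨s, ((v⁻¹ : (R⟦X⟧)ˣ) : R⟦X⟧) ^ (p - 1), PowerSeries.C ((c⁻¹ : Rˣ) : R) * e, hs0, ?_, ?_,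
    hms, hsm, ?_, ?_, hsM, ?_⟩
  · have := congrArg PowerSeries.constantCoeff hvi
    rwa [map_mul, map_pow, hv0, one_pow, one_mul, map_one] at this
  · rw [map_mul, he0, ← hc, PowerSeries.constantCoeff_C, Units.inv_mul]
  · rw [ht, mul_left_comm, ← hv, mul_pow]
    linear_combination PowerSeries.X ^ (p - 1) * hvi
  · rw [hme, ← hc, ← mul_assoc (PowerSeries.C _), ← map_mul, Units.mul_inv, map_one, one_mul]
  · have hMs := hsM
    rw [ht, subst_mul_of_zero hM0, subst_X_of_zero hM0] at hMs
    set M : R⟦X⟧ := m.subst (PowerSeries.X ^ p : R⟦X⟧) with hM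
    -- From s = Xt and s(M) = X^p: here e is the unnormalized unit with M = X^p e, and cancelling
    -- X^p leaves e·t(M) = 1. Hence h = (ct)^(-(p-1)) takes at M the value of the (p-1)-th power of
    -- e/c.
    have h1 : e * t.subst M = 1 := by
      rw [hme, mul_assoc] at hMs
      rw [← hme] at hMs
      ext n
      have := congrArg (PowerSeries.coeff (n + p)) (hMs.trans (mul_one _).symm)
      rwa [PowerSeries.coeff_X_pow_mul, PowerSeries.coeff_X_pow_mul] at this
    have h2 : ((v : R⟦X⟧).subst M : R⟦X⟧) = PowerSeries.C (m.coeff 1) * t.subst M := by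
      rw [hv, subst_mul_of_zero hM0, subst_C_eq_C]
    have h3 : ((v : R⟦X⟧).subst M : R⟦X⟧) * (((v⁻¹ : (R⟦X⟧)ˣ) : R⟦X⟧).subst M) = 1 := by
      rw [← subst_mul_of_zero hM0, Units.mul_inv, subst_one_of_zero hM0]
    have h4 : PowerSeries.C ((c⁻¹ : Rˣ) : R) * PowerSeries.C (m.coeff 1) = 1 := by
      rw [← map_mul, ← hc, Units.inv_mul, map_one]
    rw [subst_pow_of_zero hM0]
    congr 1
    rw [h2] at h3
    set w : R⟦X⟧ := ((v⁻¹ : (R⟦X⟧)ˣ) : R⟦X⟧).subst M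
    linear_combination (-w) * h4 -
      w * PowerSeries.C ((c⁻¹ : Rˣ) : R) * PowerSeries.C (m.coeff 1) * h1 +
      PowerSeries.C ((c⁻¹ : Rˣ) : R) * e * h3

end Inverse

section Cancellation

variable {F : Type*} [Field F] {p : ℕ} [Fact p.Prime] [CharP F p] {s m : F⟦X⟧}

/-- Multiplication by a power of `p` is right cancellable. -/
lemma eq_of_subst_eq_subst (hm : m.constantCoeff = 0)
    (hsm : (s.subst m : F⟦X⟧) = PowerSeries.X) {M : ℕ → F⟦X⟧} (hM0 : ∀ n, (M n).constantCoeff = 0)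
    (hM1 : M 1 = m.subst (PowerSeries.X ^ p : F⟦X⟧))
    (hM : ∀ n, 1 ≤ n → M (n + 1) = (M n).subst (M 1)) (n : ℕ) {a b : F⟦X⟧}
    (ha : a.constantCoeff = 0) (hb : b.constantCoeff = 0)
    (hab : ((M (n + 1)).subst a : F⟦X⟧) = (M (n + 1)).subst b) : a = b := by
  have hp := (Fact.out : p.Prime).ne_zero
  have hXp := constantCoeff_X_pow_of_ne_zero (R := F) hp
  induction n generalizing a b with
  | zero =>
    have hC := charP_powerSeries (R := F) p
    have hap : (a ^ p).constantCoeff = 0 := by rw [map_pow, ha, zero_pow hp]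
    have hbp : (b ^ p).constantCoeff = 0 := by rw [map_pow, hb, zero_pow hp]
    rw [zero_add, hM1, subst_subst_of_zero hXp ha, subst_subst_of_zero hXp hb,
      subst_pow_of_zero ha, subst_pow_of_zero hb, subst_X_of_zero ha, subst_X_of_zero hb] at hab
    -- The inverse s cancels m and leaves a^p = b^p; Frobenius is injective on power series over a
    -- field of characteristic p.
    have h := congrArg (fun g : F⟦X⟧ => (s.subst g : F⟦X⟧)) hab
    simp only [← subst_subst_of_zero hm hap, ← subst_subst_of_zero hm hbp, hsm, subst_X_of_zero hap,
      subst_X_of_zero hbp] at h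
    exact frobenius_inj F⟦X⟧ p h
  | succ n ih =>
    rw [hM _ (Nat.succ_pos n), subst_subst_of_zero (hM0 _) ha, subst_subst_of_zero (hM0 _) hb] at hab
    have h := ih (by rw [constantCoeff_subst_of_zero ha, hM0])
      (by rw [constantCoeff_subst_of_zero hb, hM0]) hab
    rw [hM1] at h
    have hap : (a ^ p).constantCoeff = 0 := by rw [map_pow, ha, zero_pow hp]
    have hbp : (b ^ p).constantCoeff = 0 := by rw [map_pow, hb, zero_pow hp]
    rw [subst_subst_of_zero hXp ha, subst_subst_of_zero hXp hb,
      subst_pow_of_zero ha, subst_pow_of_zero hb, subst_X_of_zero ha, subst_X_of_zero hb] at h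
    have h := congrArg (fun g : F⟦X⟧ => (s.subst g : F⟦X⟧)) h
    simp only [← subst_subst_of_zero hm hap, ← subst_subst_of_zero hm hbp, hsm, subst_X_of_zero hap,
      subst_X_of_zero hbp] at h
    have hC := charP_powerSeries (R := F) p
    exact frobenius_inj F⟦X⟧ p h

end Cancellation

section PerfectField

variable {F : Type*} [Field F] (p : ℕ) [Fact p.Prime] [CharP F p] [PerfectRing F p]

/-- The series `s ^ (p ^ -n)`, in the variable `X ^ (p ^ -n)`. -/
def rootSeries (s : F⟦X⟧) (n : ℕ) : F⟦X⟧ :=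
  s.map ((iterateFrobeniusEquiv F p n).symm : F →+* F)

lemma rootSeries_pow (s : F⟦X⟧) (n : ℕ) :
    rootSeries p s n ^ p ^ n = s.subst (PowerSeries.X ^ p ^ n : F⟦X⟧) := by
  rw [pow_pow_eq_subst]
  congr 1
  ext j
  rw [rootSeries, PowerSeries.coeff_map, PowerSeries.coeff_map]
  exact (iterateFrobeniusEquiv F p n).apply_symm_apply _

/-- The compositional inverses of multiplication by powers of `p`, where `s` is the inverse of the
Verschiebung. -/
def powInverse (s : F⟦X⟧) : ℕ → F⟦X⟧
  | 0 => PowerSeries.X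
  | n + 1 => (powInverse s n).subst (rootSeries p s (n + 1))

variable {s h k m : F⟦X⟧} {p}

lemma constantCoeff_rootSeries (hs : s.constantCoeff = 0) (n : ℕ) :
    (rootSeries p s n).constantCoeff = 0 := by
  rw [rootSeries, ← PowerSeries.coeff_zero_eq_constantCoeff_apply, PowerSeries.coeff_map,
    PowerSeries.coeff_zero_eq_constantCoeff_apply, hs, map_zero]

lemma constantCoeff_powInverse (hs : s.constantCoeff = 0) (n : ℕ) :
    (powInverse p s n).constantCoeff = 0 := by
  induction n with
  | zero => exact PowerSeries.constantCoeff_X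
  | succ n ih => rw [powInverse, constantCoeff_subst_of_zero (constantCoeff_rootSeries hs _), ih]

/-- The root series r satisfies r^(p^(n+1)) = s(X^(p^(n+1))), and m undoes s. This is the inversion
of one factor [p]. -/
lemma subst_X_pow_subst_rootSeries (hs : s.constantCoeff = 0)
    (hms : (m.subst s : F⟦X⟧) = PowerSeries.X) (n : ℕ) :
    PowerSeries.subst (rootSeries p s (n + 1) ^ p ^ n : F⟦X⟧)
      (m.subst (PowerSeries.X ^ p : F⟦X⟧) : F⟦X⟧) =
      PowerSeries.X ^ p ^ (n + 1) := by
  have hp := (Fact.out : p.Prime).ne_zero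
  have hr := constantCoeff_rootSeries (p := p) hs (n + 1)
  have hrn : (rootSeries p s (n + 1) ^ p ^ n).constantCoeff = 0 := by
    rw [map_pow, hr, zero_pow (pow_ne_zero _ hp)]
  have hX := constantCoeff_X_pow_of_ne_zero (R := F) (pow_ne_zero (n + 1) hp)
  rw [subst_subst_of_zero (constantCoeff_X_pow_of_ne_zero hp) hrn, subst_pow_of_zero hrn,
    subst_X_of_zero hrn, ← pow_mul, ← pow_succ, rootSeries_pow, ← subst_subst_of_zero hs hX, hms,
    subst_X_of_zero hX]

/-- The series `powInverse p s n` is a right inverse of multiplication by `p ^ n`. -/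
lemma subst_powInverse (hs : s.constantCoeff = 0)
    (hms : (m.subst s : F⟦X⟧) = PowerSeries.X) {M : ℕ → F⟦X⟧} (hM0 : ∀ n, (M n).constantCoeff = 0)
    (hM1 : M 1 = m.subst (PowerSeries.X ^ p : F⟦X⟧))
    (hM : ∀ n, 1 ≤ n → M (n + 1) = (M 1).subst (M n)) (n : ℕ) :
    ((M (n + 1)).subst (powInverse p s (n + 1)) : F⟦X⟧) = PowerSeries.X ^ p ^ (n + 1) := by
  have hp := (Fact.out : p.Prime).ne_zero
  induction n with
  | zero =>
    have h := subst_X_pow_subst_rootSeries (p := p) hs hms 0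
    rw [pow_zero, pow_one] at h
    rw [hM1, powInverse, powInverse, subst_X_of_zero (constantCoeff_rootSeries hs _)]
    exact h
  | succ n ih =>
    have hr := constantCoeff_rootSeries (p := p) hs (n + 1 + 1)
    rw [hM _ (Nat.succ_pos n), subst_subst_of_zero (hM0 _) (constantCoeff_powInverse hs _),
      powInverse, ← subst_subst_of_zero (constantCoeff_powInverse hs _) hr, ih,
      subst_pow_of_zero hr, subst_X_of_zero hr, hM1, subst_X_pow_subst_rootSeries hs hms]

end PerfectField

/-! ### Identification of the factors of the product -/

section FactorIdentity

/-- The leading coefficients `c · c ^ p ⋯ c ^ (p ^ (n - 1))` of the powers of the Verschiebung. -/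
def verschiebungCoeff {R : Type*} [CommRing R] (p : ℕ) (c : R) : ℕ → R
  | 0 => 1
  | n + 1 => c * verschiebungCoeff p c n ^ p

variable {F : Type*} [Field F] {p : ℕ} [Fact p.Prime] [CharP F p] [PerfectRing F p]
  {s h k : F⟦X⟧}

/-- With z = X^(p^(n+1)) and ζ the inverse series, this is the formula for the factor with
denominators cleared. In the induction the identity is raised to the power p, which produces the
Frobenius twist, and evaluated at the next root series, which replaces z by s(z). -/
lemma powInverse_pow_mul_factorSeries (hs : s.constantCoeff = 0) {c : F}
    (hh : h * (PowerSeries.C c * s) ^ (p - 1) = PowerSeries.X ^ (p - 1)) (n : ℕ) :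
    (powInverse p s (n + 1) ^ p ^ (n + 1)) ^ (p - 1) *
      (factorSeries p h s k n).subst (PowerSeries.X ^ p ^ (n + 1) : F⟦X⟧) *
      PowerSeries.C (verschiebungCoeff p c (n + 1) ^ (p - 1)) =
    (PowerSeries.X ^ p ^ (n + 1)) ^ (p - 1) *
      k.subst (powInverse p s (n + 1) ^ p : F⟦X⟧) ^ p ^ n := by
  have hp := (Fact.out : p.Prime).ne_zero
  have hsub : ∀ n, h.subst (PowerSeries.X ^ p ^ n : F⟦X⟧) *
      (PowerSeries.C c * s.subst (PowerSeries.X ^ p ^ n : F⟦X⟧)) ^ (p - 1) =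
      (PowerSeries.X ^ p ^ n) ^ (p - 1) := by
    intro n
    have hX := constantCoeff_X_pow_of_ne_zero (R := F) (pow_ne_zero n hp)
    have := congrArg (fun g : F⟦X⟧ => (g.subst (PowerSeries.X ^ p ^ n : F⟦X⟧) : F⟦X⟧)) hh
    simp only [subst_mul_of_zero hX, subst_pow_of_zero hX, subst_X_of_zero hX, subst_C_eq_C] at this
    exact this
  induction n with
  | zero =>
    have hr := constantCoeff_rootSeries (p := p) hs 1
    have hX := constantCoeff_X_pow_of_ne_zero (R := F) hp
    have hζ : powInverse p s 1 ^ p = s.subst (PowerSeries.X ^ p : F⟦X⟧) := by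
      have := rootSeries_pow p s 1
      rw [pow_one] at this
      rw [powInverse, powInverse, subst_X_of_zero hr]
      exact this
    have h1 := hsub 1
    rw [zero_add]
    rw [pow_one] at h1 ⊢
    rw [hζ, factorSeries, subst_mul_of_zero hX, subst_subst_of_zero hs hX, verschiebungCoeff,
      verschiebungCoeff, one_pow, mul_one, pow_zero, pow_one, map_pow, ← h1, mul_pow]
    ring
  | succ n ih =>
    have hr := constantCoeff_rootSeries (p := p) hs (n + 1 + 1)
    have hX := constantCoeff_X_pow_of_ne_zero (R := F) (pow_ne_zero (n + 1 + 1) hp)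
    have hX' := constantCoeff_X_pow_of_ne_zero (R := F) (pow_ne_zero (n + 1) hp)
    have hXp := constantCoeff_X_pow_of_ne_zero (R := F) hp
    have hζ0 := constantCoeff_powInverse (p := p) hs (n + 1)
    have hζp : (powInverse p s (n + 1) ^ p).constantCoeff = 0 := by rw [map_pow, hζ0, zero_pow hp]
    have hb : (factorSeries p h s k n).subst (PowerSeries.X ^ p ^ (n + 1) : F⟦X⟧) ^ p =
        ((factorSeries p h s k n).map (frobenius F p)).subst
          (PowerSeries.X ^ p ^ (n + 1 + 1) : F⟦X⟧) := by
      rw [← subst_pow_of_zero hX', pow_char_eq_subst p (factorSeries p h s k n), subst_subst_of_zero hXp hX',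
        subst_pow_of_zero hX', subst_X_of_zero hX', ← pow_mul, ← pow_succ]
    have ih := congrArg (fun g : F⟦X⟧ => ((g ^ p).subst (rootSeries p s (n + 1 + 1)) : F⟦X⟧)) ih
    simp only [mul_pow _ _ p, hb, subst_mul_of_zero hr, subst_pow_of_zero hr,
      subst_subst_of_zero hX hr, subst_subst_of_zero hζp hr, subst_C_eq_C,
      subst_X_of_zero hr, rootSeries_pow] at ih
    have hζ : ((powInverse p s (n + 1)).subst (rootSeries p s (n + 1 + 1)) : F⟦X⟧) =
      powInverse p s (n + 1 + 1) := rfl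
    rw [hζ] at ih
    have h1 := hsub (n + 1 + 1)
    rw [factorSeries, subst_mul_of_zero hX, subst_subst_of_zero hs hX, verschiebungCoeff, ← h1]
    have e1 : ∀ ζ : F⟦X⟧, (ζ ^ p ^ (n + 1 + 1)) ^ (p - 1) = ((ζ ^ p ^ (n + 1)) ^ (p - 1)) ^ p := by
      intro ζ
      rw [← pow_mul, ← pow_mul, ← pow_mul]; congr 1; ring
    have e2 : ∀ ζ : F⟦X⟧, ζ ^ p ^ (n + 1) = (ζ ^ p ^ n) ^ p := by
      intro ζ
      rw [← pow_mul, ← pow_succ]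
    have e3 : (s.subst (PowerSeries.X ^ p ^ (n + 1 + 1) : F⟦X⟧) : F⟦X⟧) ^ (p - 1) =
        ((rootSeries p s (n + 1 + 1) ^ p ^ (n + 1)) ^ (p - 1)) ^ p := by
      rw [← rootSeries_pow, e1]
    rw [e1 (powInverse p s (n + 1 + 1)), e2 (PowerSeries.subst _ _), mul_pow (PowerSeries.C c), e3,
      mul_pow c, map_mul, map_pow PowerSeries.C c, ← pow_mul (verschiebungCoeff p c (n + 1)),
      mul_comm p (p - 1), pow_mul (verschiebungCoeff p c (n + 1)),
      map_pow PowerSeries.C (verschiebungCoeff p c (n + 1) ^ (p - 1)) p]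
    linear_combination h.subst (PowerSeries.X ^ p ^ (n + 1 + 1) : F⟦X⟧) *
      PowerSeries.C c ^ (p - 1) * ih

end FactorIdentity

section Factor

variable {O K : Type*} [CommRing O] [Field K] [Algebra O K] {W : WeierstrassCurve K}

/-- The powers of β in the product of the p^i-th powers of c = αβ^(p-1) telescope to β^(p^n - 1). -/
lemma verschiebungCoeff_mul [W.IsElliptic] {p : ℕ} [Fact p.Prime] {β c : K}
    (hc : c = hasseInvariant W p * β ^ (p - 1)) (n : ℕ) :
    verschiebungCoeff p c n * β = hasseProd W p n * β ^ p ^ n := by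
  have hp := (Fact.out : p.Prime).one_le
  induction n with
  | zero => simp [verschiebungCoeff, hasseProd]
  | succ n ih =>
    have h1 : hasseProd W p (n + 1) = hasseInvariant W p * hasseProd W p n ^ p := by
      rw [hasseProd, Finset.prod_range_succ', hasseProd, ← Finset.prod_pow, pow_zero, pow_one,
        mul_comm]
      congr 1
      exact Finset.prod_congr rfl fun i _ => by rw [← pow_mul, ← pow_succ]
    have h2 : β ^ (p - 1) * β = β ^ p := by rw [← pow_succ, Nat.sub_add_cancel hp]
    rw [verschiebungCoeff, hc, h1, pow_succ p n, pow_mul]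
    calc hasseInvariant W p * β ^ (p - 1) * verschiebungCoeff p _ n ^ p * β
        = hasseInvariant W p * (verschiebungCoeff p _ n ^ p * (β ^ (p - 1) * β)) := by ring
      _ = hasseInvariant W p * (verschiebungCoeff p _ n * β) ^ p := by rw [h2, mul_pow]
      _ = _ := by rw [← hc, ih, mul_pow]; ring

lemma map_verschiebungCoeff {R S : Type*} [CommRing R] [CommRing S] (φ : R →+* S) (p : ℕ) (c : R)
    (n : ℕ) : φ (verschiebungCoeff p c n) = verschiebungCoeff p (φ c) n := by
  induction n with
  | zero => exact map_one φ
  | succ n ih => rw [verschiebungCoeff, verschiebungCoeff, map_mul, map_pow, ih]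

/-- The constant in the factors of the product. -/
lemma factor_constant [W.IsElliptic] {p : ℕ} [Fact p.Prime] {β c : K} (hβ : β ≠ 0) (hc0 : c ≠ 0)
    (hc : c = hasseInvariant W p * β ^ (p - 1)) (n : ℕ) :
    β ^ (p - 1) / (hasseInvariant W p ^ p ^ n * hasseProd W p (n + 1) ^ (p - 1)) *
      (c * β ^ (1 - (p : ℤ) ^ 2)) ^ p ^ n * verschiebungCoeff p c (n + 1) ^ (p - 1) = 1 := by
  have hp := (Fact.out : p.Prime).one_le
  have hα : hasseInvariant W p ≠ 0 := by
    intro h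
    rw [h, zero_mul] at hc
    exact hc0 hc
  have hA : hasseProd W p (n + 1) ≠ 0 :=
    Finset.prod_ne_zero_iff.mpr fun i _ => pow_ne_zero _ hα
  have h1 : verschiebungCoeff p c (n + 1) = hasseProd W p (n + 1) * β ^ (((p ^ (n + 1) : ℕ) : ℤ) - 1) := by
    rw [zpow_sub_one₀ hβ, zpow_natCast, ← mul_assoc, ← verschiebungCoeff_mul hc]
    field_simp
  have h2 : c * β ^ (1 - (p : ℤ) ^ 2) = hasseInvariant W p * β ^ ((p : ℤ) - (p : ℤ) ^ 2) := by
    rw [hc, mul_assoc, ← zpow_natCast β (p - 1), ← zpow_add₀ hβ]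
    congr 2
    push_cast [Nat.cast_sub hp]
    ring
  rw [h1, h2, mul_pow, mul_pow, ← zpow_natCast β (p - 1), ← zpow_natCast (β ^ _) (p ^ n),
    ← zpow_natCast (β ^ _) (p - 1), ← zpow_mul, ← zpow_mul]
  have h3 : β ^ ((p - 1 : ℕ) : ℤ) * β ^ (((p : ℤ) - (p : ℤ) ^ 2) * ((p ^ n : ℕ) : ℤ)) *
      β ^ ((((p ^ (n + 1) : ℕ) : ℤ) - 1) * ((p - 1 : ℕ) : ℤ)) = 1 := by
    rw [← zpow_add₀ hβ, ← zpow_add₀ hβ]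
    convert zpow_zero β using 2
    push_cast [Nat.cast_sub hp]
    ring
  generalize β ^ ((p - 1 : ℕ) : ℤ) = x at h3 ⊢
  generalize β ^ (((p : ℤ) - (p : ℤ) ^ 2) * ((p ^ n : ℕ) : ℤ)) = y at h3 ⊢
  generalize β ^ ((((p ^ (n + 1) : ℕ) : ℤ) - 1) * ((p - 1 : ℕ) : ℤ)) = z at h3 ⊢
  field_simp
  linear_combination h3

lemma laurentSubst_expand {F : Type*} [Field F] (ι : K →+* F) {g : K⸨X⸩} {l : K} {j : ℤ} {k : O⟦X⟧}
    {p : ℕ} (hp : p ≠ 0) (hg : g = HahnSeries.C l * HahnSeries.single j 1 *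
      integralToLaurent O K (k.subst (PowerSeries.X ^ p : O⟦X⟧))) {ζ : F⟦X⟧}
    (h0 : ζ.constantCoeff = 0) (hζ : ζ ≠ 0) :
    laurentSubst (g.map ι) ζ = HahnSeries.C (ι l) * (ζ : F⸨X⸩) ^ j *
      ((((k.map (algebraMap O K)).map ι).subst (ζ ^ p : F⟦X⟧) : F⟦X⟧) : F⸨X⸩) := by
  have hX := constantCoeff_X_pow_of_ne_zero (R := O) hp
  have hXK := constantCoeff_X_pow_of_ne_zero (R := K) hp
  have hXF := constantCoeff_X_pow_of_ne_zero (R := F) hp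
  rw [laurentSubst_map ι h0 hζ, hg, map_mul, map_mul, laurentSubstHom_C, laurentSubstHom_single,
    integralToLaurent_apply, laurentSubstHom_coe, powerSeries_map_subst _ hX, map_pow,
    PowerSeries.map_X, powerSeries_map_subst _ hXK, map_pow, PowerSeries.map_X,
    subst_subst_of_zero hXF h0, subst_pow_of_zero h0, subst_X_of_zero h0]

/-- The index shifts by one: `factorSeries` at n is the factor attached to [p^(n+1)]. Once the
expansion of f is inserted, constants cancel by `factor_constant` and powers of ζ by degree. -/
lemma factor_eq [W.IsElliptic] {p : ℕ} [Fact p.Prime] [CharP K p] {T : FormalParameter K}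
    {f : W.toAffine.FunctionField} {c : O} {s h k : O⟦X⟧}
    (hβ : beta W T ≠ 0) (hc0 : algebraMap O K c ≠ 0)
    (hc : algebraMap O K c = hasseInvariant W p * beta W T ^ (p - 1))
    (hf : expand W T f = HahnSeries.C (algebraMap O K c * beta W T ^ (1 - (p : ℤ) ^ 2)) *
      HahnSeries.single ((p : ℤ) - (p : ℤ) ^ 2) 1 *
      integralToLaurent O K (k.subst (PowerSeries.X ^ p : O⟦X⟧))) [CharP O p]
    (hs : s.constantCoeff = 0)
    (hh : h * (PowerSeries.C c * s) ^ (p - 1) = PowerSeries.X ^ (p - 1)) {n : ℕ}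
    (hζ0 : powInverse p ((s.map (algebraMap O K)).map (PerfectClosure.of K p)) (n + 1) ≠ 0) :
    factor W T p f (n + 1)
        (powInverse p ((s.map (algebraMap O K)).map (PerfectClosure.of K p)) (n + 1)) =
      ((((factorSeries p h s k n).map (algebraMap O K)).map (PerfectClosure.of K p)).subst
        (PowerSeries.X ^ p ^ (n + 1) : (PerfectClosure K p)⟦X⟧) : (PerfectClosure K p)⟦X⟧) := by
  have hp := (Fact.out : p.Prime)
  set ι := PerfectClosure.of K p
  set sF := (s.map (algebraMap O K)).map ι with hsF
  have hcc : ∀ g : O⟦X⟧, ((g.map (algebraMap O K)).map ι).constantCoeff =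
      ι (algebraMap O K g.constantCoeff) := fun g => by
    rw [← PowerSeries.coeff_zero_eq_constantCoeff_apply, PowerSeries.coeff_map,
      PowerSeries.coeff_map, PowerSeries.coeff_zero_eq_constantCoeff_apply]
  have hsK : (s.map (algebraMap O K)).constantCoeff = 0 := by
    rw [← PowerSeries.coeff_zero_eq_constantCoeff_apply, PowerSeries.coeff_map,
      PowerSeries.coeff_zero_eq_constantCoeff_apply, hs, map_zero]
  have hsF0 : sF.constantCoeff = 0 := by rw [hcc, hs, map_zero, map_zero]
  set hF := (h.map (algebraMap O K)).map ι with hhF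
  set kF := (k.map (algebraMap O K)).map ι with hkF
  have hhF' : hF * (PowerSeries.C (ι (algebraMap O K c)) * sF) ^ (p - 1) =
      PowerSeries.X ^ (p - 1) := by
    have := congrArg (fun g : O⟦X⟧ => (g.map (algebraMap O K)).map ι) hh
    simpa only [map_mul, map_pow, PowerSeries.map_C, PowerSeries.map_X] using this
  have hb : ((factorSeries p h s k n).map (algebraMap O K)).map ι = factorSeries p hF sF kF n := by
    rw [map_factorSeries p _ hs, map_factorSeries p _ hsK]
  have hid := powInverse_pow_mul_factorSeries (p := p) (k := kF) hsF0 hhF' n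
  have hconst := congrArg (fun x => (HahnSeries.C (ι x) : (PerfectClosure K p)⸨X⸩))
    (factor_constant hβ hc0 hc n)
  simp only [map_mul, map_pow, map_one, map_verschiebungCoeff] at hconst
  have hL := congrArg (HahnSeries.ofPowerSeries ℤ (PerfectClosure K p)) hid
  simp only [map_mul, map_pow, HahnSeries.ofPowerSeries_C, PowerSeries.coe_X,
    map_verschiebungCoeff] at hL
  rw [hb, factor, Nat.add_sub_cancel,
    laurentSubst_expand ι hp.ne_zero hf (constantCoeff_powInverse hsF0 _) hζ0]
  set ζ := powInverse p sF (n + 1)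
  have hζL : (ζ : (PerfectClosure K p)⸨X⸩) ≠ 0 :=
    (map_ne_zero_iff _ HahnSeries.ofPowerSeries_injective).mpr hζ0
  -- The exponents (p - p²)p^n from f and (p - 1)p^(n+1) from the cleared denominator add up to
  -- zero.
  have hz : ((ζ : (PerfectClosure K p)⸨X⸩) ^ ((p : ℤ) - (p : ℤ) ^ 2)) ^ p ^ n *
      ((ζ : (PerfectClosure K p)⸨X⸩) ^ p ^ (n + 1)) ^ (p - 1) = 1 := by
    rw [← zpow_natCast, ← zpow_mul, ← pow_mul, ← zpow_natCast, ← zpow_add₀ hζL]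
    convert zpow_zero _ using 2
    push_cast [Nat.cast_sub hp.one_le]
    ring
  rw [mul_pow, mul_pow]
  simp only [map_mul]
  generalize ((ζ : (PerfectClosure K p)⸨X⸩) ^ ((p : ℤ) - (p : ℤ) ^ 2)) ^ p ^ n = x at hz ⊢
  generalize ((ζ : (PerfectClosure K p)⸨X⸩) ^ p ^ (n + 1)) ^ (p - 1) = y at hz hL
  rw [show ∀ a b u w : (PerfectClosure K p)⸨X⸩, a * b * (u * x * w) =
    (a * u) * x * (b * w) by intros; ring, ← hL]
  linear_combination ((PowerSeries.subst (PowerSeries.X ^ p ^ (n + 1)) (factorSeries p hF sF kF n) :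
    (PerfectClosure K p)⟦X⟧) : (PerfectClosure K p)⸨X⸩) * (x * y * hconst + hz)

end Factor

/-! ### The sigma equation in terms of S, and the main theorem -/

section Sigma

variable {O K : Type*} [CommRing O] [IsDomain O] [Field K] [Algebra O K] [FaithfulSMul O K]
  {W : WeierstrassCurve K} {p : ℕ}

/-- The functional equation of the sigma function, for `σ = βzS`. -/
lemma mul_p_iff (hp : p ≠ 0) {b c : O} (hb : b ≠ 0) (hc : c ≠ 0) {M e κ S : O⟦X⟧}
    (hM : M = PowerSeries.X ^ p * (PowerSeries.C c * e)) {N : K⟦X⟧}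
    (hN : N = PowerSeries.map (algebraMap O K) M) {g : K⸨X⸩}
    (hg : g = HahnSeries.C (algebraMap O K c * algebraMap O K b ^ (1 - (p : ℤ) ^ 2)) *
      HahnSeries.single ((p : ℤ) - (p : ℤ) ^ 2) 1 * integralToLaurent O K κ) :
    (((((PowerSeries.C b * PowerSeries.X * S).map (algebraMap O K)).subst N : K⟦X⟧) : K⸨X⸩) =
      (((PowerSeries.C b * PowerSeries.X * S).map (algebraMap O K) : K⟦X⟧) : K⸨X⸩) ^ p ^ 2 * g) ↔
    e * S.subst M = κ * S ^ p ^ 2 := by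
  have hM0 : M.constantCoeff = 0 := by rw [hM]; simp [hp]
  have hb' : algebraMap O K b ≠ 0 :=
    (map_ne_zero_iff _ (FaithfulSMul.algebraMap_injective O K)).mpr hb
  have h1 : HahnSeries.C (algebraMap O K b) ^ p ^ 2 *
      HahnSeries.C (algebraMap O K c * algebraMap O K b ^ (1 - (p : ℤ) ^ 2)) =
      (HahnSeries.C (algebraMap O K (c * b)) : K⸨X⸩) := by
    have hz : algebraMap O K b ^ p ^ 2 * algebraMap O K b ^ (1 - (p : ℤ) ^ 2) =
        algebraMap O K b := by
      rw [← zpow_natCast, ← zpow_add₀ hb', Nat.cast_pow, add_sub_cancel, zpow_one]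
    rw [← map_pow, ← map_mul, mul_left_comm, hz, ← map_mul (algebraMap O K)]
  have h2 : (HahnSeries.single 1 1 : K⸨X⸩) ^ p ^ 2 * HahnSeries.single ((p : ℤ) - (p : ℤ) ^ 2) 1 =
      HahnSeries.single 1 1 ^ p := by
    rw [single_one_pow, single_one_pow, HahnSeries.single_mul_single, one_mul,
      Nat.cast_pow, add_sub_cancel]
  have hL : ((((PowerSeries.C b * PowerSeries.X * S).map (algebraMap O K)).subst N : K⟦X⟧) : K⸨X⸩) =
      integralToLaurent O K (PowerSeries.C (c * b) * PowerSeries.X ^ p * (e * S.subst M)) := by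
    rw [hN, ← powerSeries_map_subst _ hM0, ← integralToLaurent_apply, subst_mul_of_zero hM0,
      subst_mul_of_zero hM0, subst_C_eq_C, subst_X_of_zero hM0]
    nth_rewrite 1 [hM]
    rw [map_mul PowerSeries.C]
    congr 1
    ring
  have hR : (((PowerSeries.C b * PowerSeries.X * S).map (algebraMap O K) : K⟦X⟧) : K⸨X⸩) ^ p ^ 2 * g =
      integralToLaurent O K (PowerSeries.C (c * b) * PowerSeries.X ^ p * (κ * S ^ p ^ 2)) := by
    rw [← integralToLaurent_apply, hg]
    simp only [map_mul _ (_ : O⟦X⟧), map_pow, integralToLaurent_C, integralToLaurent_X]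
    rw [← h1, ← h2]
    ring
  -- Both sides of the sigma equation carry the same factor cβX^p over O, which is cancelled.
  rw [hL, hR, integralToLaurent_injective.eq_iff]
  refine (mul_right_injective₀ (mul_ne_zero ?_ (pow_ne_zero _ PowerSeries.X_ne_zero))).eq_iff
  exact (map_ne_zero_iff _ PowerSeries.C_injective).mpr (mul_ne_zero hc hb)

end Sigma

/-- Substitution of the nonzero series [p](z) is injective, so composing with [p] preserves being
nonzero. -/
lemma mulSeries_pow_ne_zero {O K : Type*} [CommRing O] [Field K] [Algebra O K]
    [FaithfulSMul O K] {V : WeierstrassCurve O} {W : WeierstrassCurve K} [W.IsElliptic] {p : ℕ}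
    (hV : V.map (algebraMap O K) = W) (T : FormalParameter O)
    (hp : mulSeries W (T.map (algebraMap O K)) p ≠ 0) (n : ℕ) :
    mulSeries W (T.map (algebraMap O K)) (p ^ (n + 1)) ≠ 0 := by
  induction n with
  | zero => rwa [zero_add, pow_one]
  | succ n ih =>
    rw [pow_succ, mulSeries_mul hV T _ p hp]
    have h := (map_ne_zero_iff _
      (substRingHom_injective (RingHom.id K) (constantCoeff_mulSeries hV T p) hp)).mpr ih
    rwa [substRingHom_apply, PowerSeries.map_id] at h

lemma constantCoeff_map_eq_zero {R S : Type*} [CommRing R] [CommRing S] (ψ : R →+* S) {g : R⟦X⟧}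
    (hg : g.constantCoeff = 0) : (g.map ψ).constantCoeff = 0 := by
  rw [← PowerSeries.coeff_zero_eq_constantCoeff_apply, PowerSeries.coeff_map,
    PowerSeries.coeff_zero_eq_constantCoeff_apply, hg, map_zero]

section Main

variable {O : Type*} [CommRing O] {K : Type*} [Field K] [Algebra O K] [IsFractionRing O K]
  {V : WeierstrassCurve O}
  {W : WeierstrassCurve K} [W.IsElliptic] {p : ℕ} [Fact p.Prime]

/-- The compositional inverse of multiplication by `p ^ n`, where `s` is the inverse of the
Verschiebung `m`. -/
lemma isMulPowInverse_powInverse [CharP K p] (hV : V.map (algebraMap O K) = W)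
    (T : FormalParameter O) {m s : O⟦X⟧} (hm0 : m.constantCoeff = 0) (hs0 : s.constantCoeff = 0)
    (hm : mulSeries W (T.map (algebraMap O K)) p =
      PowerSeries.map (algebraMap O K) (m.subst (PowerSeries.X ^ p : O⟦X⟧)))
    (hp0 : mulSeries W (T.map (algebraMap O K)) p ≠ 0)
    (hms : (m.subst s : O⟦X⟧) = PowerSeries.X) (hsm : (s.subst m : O⟦X⟧) = PowerSeries.X) (n : ℕ) :
    IsMulPowInverse W (T.map (algebraMap O K)) p (n + 1)
      (powInverse p ((s.map (algebraMap O K)).map (PerfectClosure.of K p)) (n + 1)) ∧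
    (∀ η, IsMulPowInverse W (T.map (algebraMap O K)) p (n + 1) η →
      η = powInverse p ((s.map (algebraMap O K)).map (PerfectClosure.of K p)) (n + 1)) ∧
    powInverse p ((s.map (algebraMap O K)).map (PerfectClosure.of K p)) (n + 1) ≠ 0 := by
  have hpp := (Fact.out : p.Prime)
  set ι := PerfectClosure.of K p with hι
  set T' := T.map (algebraMap O K)
  set φ := ι.comp (algebraMap O K) with hφ
  have hφm : ∀ g : O⟦X⟧, (g.map (algebraMap O K)).map ι = g.map φ := fun g => by
    ext j; simp [hφ]
  rw [hφm]
  have hsF := constantCoeff_map_eq_zero φ hs0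
  have hmF := constantCoeff_map_eq_zero φ hm0
  have hmsF : ((m.map φ).subst (s.map φ) : (PerfectClosure K p)⟦X⟧) = PowerSeries.X := by
    rw [← powerSeries_map_subst _ hs0, hms, PowerSeries.map_X]
  have hsmF : ((s.map φ).subst (m.map φ) : (PerfectClosure K p)⟦X⟧) = PowerSeries.X := by
    rw [← powerSeries_map_subst _ hm0, hsm, PowerSeries.map_X]
  set M : ℕ → (PerfectClosure K p)⟦X⟧ := fun n => (mulSeries W T' (p ^ n)).map ι with hM
  have hM0 : ∀ n, (M n).constantCoeff = 0 := fun n =>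
    constantCoeff_map_eq_zero ι (constantCoeff_mulSeries hV T (p ^ n))
  have hM1 : M 1 = (m.map φ).subst (PowerSeries.X ^ p : (PerfectClosure K p)⟦X⟧) := by
    simp only [hM]
    rw [pow_one, hm, hφm, powerSeries_map_subst _ (constantCoeff_X_pow_of_ne_zero hpp.ne_zero),
      map_pow, PowerSeries.map_X]
  have hMl : ∀ n, 1 ≤ n → M (n + 1) = (M 1).subst (M n) := by
    intro n hn
    obtain ⟨n, rfl⟩ := Nat.exists_eq_add_of_le' hn
    simp only [hM]
    rw [pow_succ', mulSeries_mul hV T p _ (mulSeries_pow_ne_zero hV T hp0 n), pow_one,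
      powerSeries_map_subst _ (constantCoeff_mulSeries hV T _)]
  have hMr : ∀ n, 1 ≤ n → M (n + 1) = (M n).subst (M 1) := by
    intro n hn
    simp only [hM]
    rw [pow_succ, mulSeries_mul hV T _ p hp0, pow_one,
      powerSeries_map_subst _ (constantCoeff_mulSeries hV T _)]
  have hζ0 := constantCoeff_powInverse (p := p) hsF (n + 1)
  have hζ := subst_powInverse (p := p) hsF hmsF hM0 hM1 hMl n
  refine ⟨⟨hζ0, hζ⟩, fun η hη => ?_, ?_⟩
  · exact eq_of_subst_eq_subst hmF hsmF hM0 hM1 hMr n hη.1 hζ0 (hη.2.trans hζ.symm)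
  · intro h
    obtain ⟨g, hg⟩ := PowerSeries.X_dvd_iff.mpr (hM0 (n + 1))
    rw [hg, subst_mul_of_zero hζ0, subst_X_of_zero hζ0, h, zero_mul] at hζ
    exact pow_ne_zero _ PowerSeries.X_ne_zero hζ.symm

theorem exists_sigma_eq_product [IsDomain O] [IsDiscreteValuationRing O] [CharP K p]
    (h2 : (2 : K) ≠ 0) (hV : V.map (algebraMap O K) = W)
    (hord : IsOrdinary O W p) (T : FormalParameter O) (f : W.toAffine.FunctionField)
    (hf : IsDivisionPolynomial W (T.map (algebraMap O K)) p f) :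
    ∃ (β : Oˣ) (ζ : ℕ → (PerfectClosure K p)⟦X⟧) (b : ℕ → O⟦X⟧) (σ : O⟦X⟧),
      algebraMap O K β = beta W (T.map (algebraMap O K)) ∧
      (∀ n, 1 ≤ n →
        IsMulPowInverse W (T.map (algebraMap O K)) p n (ζ n) ∧
        (∀ η, IsMulPowInverse W (T.map (algebraMap O K)) p n η → η = ζ n) ∧
        factor W (T.map (algebraMap O K)) p f n (ζ n) =
          ((((b n).map (algebraMap O K)).map (PerfectClosure.of K p)).subst
            (PowerSeries.X ^ p ^ n : (PerfectClosure K p)⟦X⟧) : (PerfectClosure K p)⟦X⟧)) ∧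
      (∀ k : ℕ, ∃ N₀ : ℕ, ∀ N, N₀ ≤ N →
        PowerSeries.X ^ k ∣ σ - PowerSeries.C (β : O) * PowerSeries.X *
          ∏ n ∈ Finset.Icc 1 N, b n ^ p ^ (n - 1)) ∧
      IsMazurTateSigma O W T p f σ := by
  have hpp := (Fact.out : p.Prime)
  have hinj := IsFractionRing.injective O K
  have hchar : CharP O p := (algebraMap O K).charP hinj p
  set T' := T.map (algebraMap O K) with hT'
  obtain ⟨m, hm0, hm, hmα⟩ := exists_mulSeries_eq p h2 hV T
  obtain ⟨a, ha⟩ := hord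
  obtain ⟨β, hβ⟩ := T.isUnit_coeff_one
  have hβK : algebraMap O K β = beta W T' := by
    rw [beta_eq W T' h2, hβ, hT', FormalParameter.series_map, PowerSeries.coeff_map]
  have hc : m.coeff 1 = a * (β : O) ^ (p - 1) := by
    rw [← hβ, ← ha, ← map_pow, ← map_mul] at hmα
    have h := hinj hmα
    apply mul_left_cancel₀ β.ne_zero
    rw [h, mul_left_comm, ← pow_succ', Nat.sub_add_cancel hpp.one_le]
  have hcK : algebraMap O K (m.coeff 1) = hasseInvariant W p * beta W T' ^ (p - 1) := by
    rw [hc, map_mul, map_pow, ha, hβK]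
  have hcu : IsUnit (m.coeff 1) := by
    rw [hc]; exact a.isUnit.mul (β.isUnit.pow _)
  obtain ⟨k, hk0, hfk⟩ := hf.exists_expand_eq h2 hV T hm0 hcu hm
  obtain ⟨s, h, e, hs0, hh0, he0, hms, hsm, hh, hM, hsM, hhM⟩ :=
    exists_inverse_data hm0 hcu hpp.ne_zero
  have hp0 : mulSeries W T' p ≠ 0 := by
    rw [hm, Ne, map_eq_zero_iff _ (PowerSeries.map_injective _ hinj), hM]
    have he : e ≠ 0 := by
      rintro rfl
      exact zero_ne_one ((map_zero _).symm.trans he0)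
    exact mul_ne_zero (pow_ne_zero _ PowerSeries.X_ne_zero)
      (mul_ne_zero ((map_ne_zero_iff _ PowerSeries.C_injective).mpr hcu.ne_zero) he)
  have hinv := isMulPowInverse_powInverse hV T hm0 hs0 hm hp0 hms hsm
  set M : O⟦X⟧ := m.subst (PowerSeries.X ^ p : O⟦X⟧) with hMdef
  have hM0 : M.constantCoeff = 0 := by rw [hM]; simp [hpp.ne_zero]
  obtain ⟨S, hS0, hS, hSM⟩ := exists_product p hh0 hs0 hk0 hM0 he0 hsM hhM
  have he : IsUnit e := PowerSeries.isUnit_iff_constantCoeff.mpr (he0 ▸ isUnit_one)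
  have hiff := fun S' : O⟦X⟧ =>
    mul_p_iff (S := S') hpp.ne_zero β.ne_zero hcu.ne_zero hM hm (hβK.symm ▸ hfk)
  refine ⟨β, powInverse p ((s.map (algebraMap O K)).map (PerfectClosure.of K p)),
    fun n => factorSeries p h s k (n - 1), PowerSeries.C (β : O) * PowerSeries.X * S, hβK, ?_, ?_,
    ⟨?_, (hiff S).mpr hSM⟩, ?_⟩
  · intro n hn
    obtain ⟨n, rfl⟩ := Nat.exists_eq_add_of_le' hn
    obtain ⟨h1, h3, h4⟩ := hinv n
    exact ⟨h1, h3, factor_eq (hβK ▸ (β.isUnit.map (algebraMap O K)).ne_zero)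
      (hcu.map (algebraMap O K)).ne_zero hcK hfk hs0 hh h4⟩
  · intro N₀
    -- The bound can be the exponent itself: N factors determine S modulo X^N.
    refine ⟨N₀, fun N hN => ?_⟩
    have hprod : ∏ n ∈ Finset.Icc 1 N, factorSeries p h s k (n - 1) ^ p ^ (n - 1) =
        partialProduct p h s k N := by
      clear hN
      induction N with
      | zero => simp [partialProduct]
      | succ N ih =>
        rw [Finset.prod_Icc_succ_top (by lia), ih, partialProduct, partialProduct,
          Finset.prod_range_succ, Nat.add_sub_cancel]
    rw [hprod, ← mul_sub]
    exact ((pow_dvd_pow _ hN).trans (hS N)).mul_left _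
  · obtain ⟨g, hg⟩ := PowerSeries.X_dvd_iff.mpr (show (S - 1).constantCoeff = 0 by
      rw [map_sub, hS0, map_one, sub_self])
    refine ⟨g, ?_⟩
    rw [sub_eq_iff_eq_add'] at hg
    rw [hg]
    simp only [map_mul, map_add, map_one, PowerSeries.map_C, PowerSeries.map_X, hβK]
    rfl
  · rintro τ ⟨⟨g, hg⟩, hτ⟩
    have hτ' : τ = PowerSeries.C (β : O) * PowerSeries.X * (1 + PowerSeries.X * g) := by
      apply PowerSeries.map_injective _ hinj
      rw [hg]
      simp only [map_mul, map_add, map_one, PowerSeries.map_C, PowerSeries.map_X, hβK]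
      rfl
    subst hτ'
    -- Any competitor has the form βz(1 + zg), so its unit part also has constant coefficient 1 and
    -- solves the same equation.
    rw [eq_of_functional_equation p ((hcu.map PowerSeries.C).mul he) hM he.ne_zero hS0 (by simp) hSM
      ((hiff _).mp hτ)]

end Main

end

end MazurTate

theorem theorem4p1 (p : ℕ) [Fact p.Prime] (hp : p ≠ 2)
    {O : Type*} [CommRing O] [IsDomain O] [IsDiscreteValuationRing O]
    [IsAdicComplete (IsLocalRing.maximalIdeal O) O]
    {K : Type*} [Field K] [Algebra O K] [IsFractionRing O K] [CharP K p]
    (W : WeierstrassCurve K) [W.IsElliptic] [W.IsMinimal O]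
    (hord : MazurTate.IsOrdinary O W p) (T : MazurTate.FormalParameter O)
    (f : W.toAffine.FunctionField)
    (hf : MazurTate.IsDivisionPolynomial W (T.map (algebraMap O K)) p f) :
    ∃ (β : Oˣ) (ζ : ℕ → (PerfectClosure K p)⟦X⟧) (b : ℕ → O⟦X⟧) (σ : O⟦X⟧),
      algebraMap O K β = MazurTate.beta W (T.map (algebraMap O K)) ∧
      (∀ n, 1 ≤ n →
        MazurTate.IsMulPowInverse W (T.map (algebraMap O K)) p n (ζ n) ∧
        (∀ η, MazurTate.IsMulPowInverse W (T.map (algebraMap O K)) p n η → η = ζ n) ∧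
        MazurTate.factor W (T.map (algebraMap O K)) p f n (ζ n) =
          ((((b n).map (algebraMap O K)).map (PerfectClosure.of K p)).subst
            (PowerSeries.X ^ p ^ n : (PerfectClosure K p)⟦X⟧) : (PerfectClosure K p)⟦X⟧)) ∧
      (∀ k : ℕ, ∃ N₀ : ℕ, ∀ N, N₀ ≤ N →
        PowerSeries.X ^ k ∣ σ - PowerSeries.C (β : O) * PowerSeries.X *
          ∏ n ∈ Finset.Icc 1 N, b n ^ p ^ (n - 1)) ∧
      MazurTate.IsMazurTateSigma O W T p f σ := by
  have h2 : (2 : K) ≠ 0 := by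
    intro h
    have h' : ((2 : ℕ) : K) = 0 := by exact_mod_cast h
    rw [CharP.cast_eq_zero_iff K p] at h'
    exact hp ((Nat.prime_dvd_prime_iff_eq Fact.out Nat.prime_two).mp h')
  -- A minimal equation is integral, and its integral model over O serves as V.
  exact MazurTate.exists_sigma_eq_product h2
    (WeierstrassCurve.baseChange_integralModel_eq O W) hord T f hf
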